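/- **Theorem 3.1.** All graphs are finite; loops and parallel edges are allowed, and graphs need not be connected. Let $G$ be a 4-regular plane graph (a loop counts twice towards the degree of its vertex), that is, a 4-regular planar graph with a fixed embedding in the plane; the four half-edges at each vertex are then cyclically ordered. A *vertex-orientation* $\sigma$ of $G$ partitions, at each vertex $v$, the four half-edges at $v$ into two *cells* of two half-edges each, the two half-edges of a cell being consecutive in the cyclic order at $v$. A *cut-vertex* is a vertex $v$ whose deletion disconnects two other vertices that are connected in $G$; it is oriented *nontransversely* if the two edges of each cell at $v$ lead into the same component of $G-v$, and *transversely* otherwise. A *loop-anchor* is a vertex with an incident loop; it is oriented *nontransversely* if one of its cells consists of the two halves of one loop, and *transversely* otherwise. An *o-colouring* of $(G,\sigma)$ is an assignment of colours to the edges (with no bound on the number of colours) such that at each vertex exactly two colours appear on the incident edges, and both of them appear in each cell at that vertex. An *o-cycle* is a cycle of $G$ (a loop being a cycle of length one) that enters and leaves each of its vertices through half-edges belonging to different cells. If every cut-vertex and every loop-anchor of $G$ is oriented transversely by $\sigma$, then $(G,\sigma)$ has an o-colouring. Moreover, a colouring of the edges of $G$ is an o-colouring of $(G,\sigma)$ if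 and only if the edge set of $G$ can be partitioned into o-cycles, each with all its edges of one colour, such that distinct o-cycles of the same colour have no vertex in common. -/

import Mathlib

/-!
Vertex-oriented plane 4-regular multigraphs and their o-colourings.  Multigraphs (loops and
parallel edges allowed) are Mathlib's `Graph α β`.  A plane embedding is given by its rotation
system: the cyclic order of the half-edges around each vertex, of genus zero.
-/

namespace Graph

variable {α β : Type*}

/-- The half-edges of `G`: every edge has two of them, so a loop contributes two half-edges to its
vertex. -/
abbrev HalfEdge (G : Graph α β) : Type _ := G.edgeSet × Bool

/-- The other half of the same edge. -/
def flip (G : Graph α β) : Equiv.Perm G.HalfEdge where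
  toFun d := (d.1, !d.2)
  invFun d := (d.1, !d.2)
  left_inv d := by simp
  right_inv d := by simp

/-- Every vertex has degree `4`, a loop counting twice. -/
def IsFourRegular (G : Graph α β) : Prop :=
  ∀ v ∈ G.vertexSet, (G.incidenceSet v).encard + (G.loopSet v).encard = 4

/-- `x` and `y` are joined by a walk in `G`. -/
def Reachable (G : Graph α β) (x y : α) : Prop := Relation.ReflTransGen G.Adj x y

/-- `v` is a cut-vertex: deleting it disconnects two other vertices that are connected in `G`. -/
def IsCutVertex (G : Graph α β) (v : α) : Prop :=
  v ∈ G.vertexSet ∧ ∃ x ∈ G.vertexSet \ {v}, ∃ y ∈ G.vertexSet \ {v},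
    G.Reachable x y ∧ ¬ (G.deleteVerts {v}).Reachable x y

/-- `v` is a loop-anchor: it has an incident loop. -/
def IsLoopAnchor (G : Graph α β) (v : α) : Prop := ∃ e, G.IsLoopAt e v

/-- A rotation system on `G`: each half-edge is attached to an end of its edge, and the half-edges
at each vertex are arranged in one cyclic order. -/
structure RotationSystem (G : Graph α β) where
  /-- the vertex to which a half-edge is attached -/
  vert : G.HalfEdge → α
  isLink : ∀ e : G.edgeSet, G.IsLink e (vert (e, false)) (vert (e, true))
  /-- the next half-edge in the cyclic order around the vertex -/
  rot : Equiv.Perm G.HalfEdge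
  sameCycle_iff : ∀ d d', rot.SameCycle d d' ↔ vert d = vert d'

namespace RotationSystem

variable {G : Graph α β} (R : RotationSystem G)

/-- The vertex at the other end of the edge of a half-edge. -/
def far (d : G.HalfEdge) : α := R.vert (G.flip d)

/-- The face permutation: go along the edge, then take the next half-edge in the rotation there.
Its cycles are the boundaries of the faces. -/
def facePerm : Equiv.Perm G.HalfEdge := R.rot * G.flip

/-- Number of vertices (of positive degree). -/
noncomputable def numVertices : ℕ := Nat.card (Quotient (Equiv.Perm.SameCycle.setoid R.rot))

/-- Number of faces, counted separately for each connected component. -/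
noncomputable def numFaces : ℕ := Nat.card (Quotient (Equiv.Perm.SameCycle.setoid R.facePerm))

/-- Number of connected components (having an edge). -/
noncomputable def numComponents : ℕ :=
  Nat.card (MulAction.orbitRel.Quotient (Subgroup.closure {R.rot, G.flip}) G.HalfEdge)

/-- The rotation system is that of an embedding in the plane (equivalently, the sphere):
`V - E + F = 2` for each connected component.  As `V - E + F ≤ 2` holds for each component of any
finite rotation system, it suffices to require this for the sum over the components. -/
def IsPlane : Prop :=
  R.numVertices + R.numFaces = Nat.card G.edgeSet + 2 * R.numComponents

end RotationSystem

/-- A vertex-orientation of an embedded 4-regular graph: the four half-edges at each vertex are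
partitioned into two cells of two half-edges that are consecutive in the cyclic order there.  It is
given by the involution `mate` that exchanges the two members of each cell. -/
structure VertexOrientation {G : Graph α β} (R : RotationSystem G) where
  mate : G.HalfEdge → G.HalfEdge
  mate_mate : ∀ d, mate (mate d) = d
  consecutive : ∀ d, mate d = R.rot d ∨ mate d = R.rot.symm d

namespace VertexOrientation

variable {G : Graph α β} {R : RotationSystem G} (σ : VertexOrientation R)

/-- The cell containing the half-edge `d`. -/
def cell (d : G.HalfEdge) : Set G.HalfEdge := {d, σ.mate d}

/-- Nontransverse orientation of a cut-vertex `v`: the two edges of each cell lead into the same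
component of `G - v`. -/
def NontransverseCut (v : α) : Prop :=
  ∀ d, R.vert d = v → (G.deleteVerts {v}).Reachable (R.far d) (R.far (σ.mate d))

/-- Nontransverse orientation of a loop-anchor `v`: some cell consists of the two halves of one
loop. -/
def NontransverseLoop (v : α) : Prop :=
  ∃ d, R.vert d = v ∧ σ.cell d = {d, G.flip d}

/-- Every cut-vertex and every loop-anchor is oriented transversely. -/
def IsTransverse : Prop :=
  (∀ v, G.IsCutVertex v → ¬ σ.NontransverseCut v) ∧
    ∀ v, G.IsLoopAnchor v → ¬ σ.NontransverseLoop v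

/-- An o-colouring: at each vertex exactly two colours appear, and both appear in each cell. -/
def IsOColouring {γ : Type*} (ε : G.edgeSet → γ) : Prop :=
  ∀ v ∈ G.vertexSet,
    {c | ∃ d, R.vert d = v ∧ ε d.1 = c}.ncard = 2 ∧
      ∀ d, R.vert d = v →
        (fun d' : G.HalfEdge => ε d'.1) '' σ.cell d = {c | ∃ d', R.vert d' = v ∧ ε d'.1 = c}

/-- `C` is the edge set of an o-cycle: a cycle with distinct vertices and distinct edges (`k + 1` of
them, indices modulo `k + 1`; a loop is a cycle of length one) that, at each of its vertices, enters
and leaves through different cells.  Here `d i` is the half-edge by which the cycle leaves its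
`i`-th vertex. -/
def IsOCycle (C : Set G.edgeSet) : Prop :=
  ∃ (k : ℕ) (d : Fin (k + 1) → G.HalfEdge),
    (∀ i, R.far (d i) = R.vert (d (i + 1))) ∧
    Function.Injective (fun i => R.vert (d i)) ∧
    Function.Injective (fun i => (d i).1) ∧
    (∀ i, σ.cell (G.flip (d i)) ≠ σ.cell (d (i + 1))) ∧
    C = Set.range (fun i => (d i).1)

/-- The edge colouring `ε` comes from a partition of the edge set into o-cycles, each of one colour,
such that distinct o-cycles of the same colour have no common vertex. -/
def IsOCycleColouring {γ : Type*} (ε : G.edgeSet → γ) : Prop :=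
  ∃ 𝒞 : Set (Set G.edgeSet),
    Setoid.IsPartition 𝒞 ∧
    (∀ C ∈ 𝒞, σ.IsOCycle C) ∧
    (∀ C ∈ 𝒞, ∀ e ∈ C, ∀ f ∈ C, ε e = ε f) ∧
    ∀ C ∈ 𝒞, ∀ D ∈ 𝒞, C ≠ D → ∀ e ∈ C, ∀ f ∈ D, ε e = ε f →
      ∀ v, ¬ (G.Inc e v ∧ G.Inc f v)

end VertexOrientation

end Graph

/-! The graph is replaced by its darts (half-edges). Planarity enters only as `Wiring.Planar`: every
even edge set is the boundary of a set of faces. Transversality enters only as `Wiring.Bridgeless`: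
at each vertex some even edge set splits a cell, that is, contains exactly one of its two darts.
This is necessary for a colouring, because each colour class is even and splits the cells it meets.
Being statements about mod 2 chains, both conditions can be followed through surgery
(`exists_reduction`): some edges are deleted and the strands left at a vertex are joined, crossing
deleted strands only. `Planar.colourable` is proved by induction on the number of darts.

A dimension count gives more faces than vertices, while each vertex has just two corners lying
inside a cell. Hence some face has at most one such corner (`Planar.exists_face`), and it passes
each vertex at most once. Delete its boundary. The rest is bridgeless unless both faces between the
cells of some vertex share an edge with the chosen face; then the graph falls into two smaller
graphs whose colourings fit together (`colourable_of_triangle`). Otherwise colour the rest by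
induction and give the boundary a fresh colour. If no corner of the face is inside a cell, this is a
colouring.

If there is one such corner, at `x`, only `x` is wrong: each of its cells is monochromatic
(`AlmostColouring`). When both strands at `x` lie on one circuit, the circuit can be cut there into
two colours (`colourable_of_circ`). Otherwise take a shortest chain of successively meeting circuits
from one strand to the other. A circuit off the chain can be deleted and restored after induction
(`colourable_of_avoid`), so the circuits may be assumed to form a chain, with the face boundary at
its top (`exists_heights`, `FacialChain`).

A face of length one contradicts bridgelessness, and length two is `colourable_of_digon`. For longer
faces a Jordan curve argument shows that the second circuit, leaving the face boundary at the first
vertex after `x`, returns to it at the second one (`arc_right`). Exchange this arc with the face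
edge between these vertices. Then the two strands at `x` lie on one circuit, or the new second
circuit can be avoided and deleted, or the arc is a single edge and the two vertices are split by
the same even sets (`colourable_of_parallel`).

For the given graph, `planar` follows from Euler's formula by comparing dimensions, and `bridgeless`
from a parity count of edges at a vertex. The equivalence with o-cycles is local: a colour at a
vertex occupies exactly two half-edges, in different cells, so following a colour traces an o-cycle.
-/

/-! ### Darts, cells and vertices -/

/-- Darts arranged in groups of four around vertices, each group being split into two cells of two
consecutive darts. -/
structure CellSystem (D : Type*) where
  rot : D → D
  mate : D → D
  rot_four : ∀ d, rot (rot (rot (rot d))) = d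
  rot_two_ne : ∀ d, rot (rot d) ≠ d
  mate_mate : ∀ d, mate (mate d) = d
  consecutive : ∀ d, mate d = rot d ∨ mate d = rot (rot (rot d))

namespace CellSystem

variable {D : Type*} (X : CellSystem D)

/-- The opposite dart. -/
def opp (d : D) : D := X.rot (X.rot d)

theorem rot_injective : Function.Injective X.rot := fun a b h => by
  rw [← X.rot_four a, h, X.rot_four]

theorem rot_ne (d : D) : X.rot d ≠ d := fun h => X.rot_two_ne d (by rw [h, h])

theorem rot_three_ne (d : D) : X.rot (X.rot (X.rot d)) ≠ d := fun h =>
  X.rot_ne d (by conv_lhs => rw [← h]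
                 exact X.rot_four d)

theorem mate_ne (d : D) : X.mate d ≠ d := by
  rcases X.consecutive d with h | h <;> rw [h]
  exacts [X.rot_ne d, X.rot_three_ne d]

theorem opp_ne (d : D) : X.opp d ≠ d := X.rot_two_ne d

theorem opp_opp (d : D) : X.opp (X.opp d) = d := X.rot_four d

theorem mate_opp (d : D) : X.mate (X.opp d) = X.opp (X.mate d) := by
  have h1 := X.rot_four d
  have h2 := X.mate_mate d
  have h3 := X.mate_mate (X.rot (X.rot d))
  have h4 := X.rot_two_ne d
  unfold opp
  rcases X.consecutive d with h | h <;>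
    rcases X.consecutive (X.rot (X.rot d)) with h' | h' <;> grind

theorem mate_opp_ne (d : D) : X.mate (X.opp d) ≠ d := fun h => by
  have h1 := X.mate_mate (X.opp d)
  rw [h] at h1
  rcases X.consecutive d with h2 | h2
  · exact X.rot_ne (X.rot d) (h1.symm.trans h2)
  · exact X.rot_ne (X.rot (X.rot d)) (h2.symm.trans h1)

theorem mate_ne_opp (d : D) : X.mate d ≠ X.opp d := fun h =>
  X.mate_opp_ne d (by rw [← h, X.mate_mate])

/-- Two darts at the same vertex. -/
def Near (a b : D) : Prop := b = a ∨ b = X.mate a ∨ b = X.opp a ∨ b = X.mate (X.opp a)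

instance [DecidableEq D] (a b : D) : Decidable (X.Near a b) := by unfold Near; infer_instance

theorem near_iff_rot {a b : D} : X.Near a b ↔
    b = a ∨ b = X.rot a ∨ b = X.rot (X.rot a) ∨ b = X.rot (X.rot (X.rot a)) := by
  have h := X.mate_opp a
  have h4 := X.rot_four a
  unfold Near opp at *
  rcases X.consecutive a with h' | h' <;> grind

theorem Near.refl (a : D) : X.Near a a := Or.inl rfl

variable {X}

theorem Near.mate {a b : D} (h : X.Near a b) : X.Near a (X.mate b) := by
  have := X.mate_mate; have := X.opp_opp; have := X.mate_opp; unfold Near at *; grind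

theorem Near.opp {a b : D} (h : X.Near a b) : X.Near a (X.opp b) := by
  have := X.mate_mate; have := X.opp_opp; have := X.mate_opp; unfold Near at *; grind

theorem Near.rot {a b : D} (h : X.Near a b) : X.Near a (X.rot b) := by
  have := X.rot_four; rw [near_iff_rot] at *; grind

theorem Near.symm {a b : D} (h : X.Near a b) : X.Near b a := by
  have := X.mate_mate; have := X.opp_opp; have := X.mate_opp; unfold Near at *; grind

theorem Near.trans {a b c : D} (h : X.Near a b) (h' : X.Near b c) : X.Near a c := by
  rcases h' with rfl | rfl | rfl | rfl
  exacts [h, h.mate, h.opp, h.opp.mate]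

theorem near_mate (a : D) : X.Near a (X.mate a) := (Near.refl X a).mate
theorem near_opp (a : D) : X.Near a (X.opp a) := (Near.refl X a).opp
theorem near_rot (a : D) : X.Near a (X.rot a) := (Near.refl X a).rot

end CellSystem

/-! ### Matchings, wirings and their reductions -/

/-- `τ` is a perfect matching of the set `S`. -/
def IsMatching {D : Type*} (S : Finset D) (τ : D → D) : Prop :=
  ∀ d ∈ S, τ d ∈ S ∧ τ (τ d) = d ∧ τ d ≠ d

/-- Replacing the matching `τ` of `S` by the one obtained by following alternately the edges of `τ`
and of a matching `θ` of a subset `U` until the complement of `U` is reached again. -/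
theorem IsMatching.exists_resolution {D : Type*} [DecidableEq D] {S : Finset D} {τ : D → D}
    (hτ : IsMatching S τ) {U : Finset D} {θ : D → D} (hθ : IsMatching U θ) (hU : U ⊆ S) :
    ∃ τ' : D → D, IsMatching (S \ U) τ' ∧
      (∀ (β : Type) (f g : D → β), (∀ d ∈ S, f (τ d) = g d) → (∀ d ∈ U, f d = g (θ d)) →
        ∀ d ∈ S \ U, f (τ' d) = g d) ∧
      (∀ (β : Type) (Z' : D → β), (∀ d ∈ S \ U, Z' (τ' d) = Z' d) →
        ∃ Z : D → β, (∀ d ∈ S, Z (τ d) = Z d) ∧ (∀ d ∈ U, Z (θ d) = Z d) ∧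
          ∀ d, d ∉ U → Z d = Z' d) := by
  induction hn : U.card using Nat.strong_induction_on generalizing S U τ with
  | _ n ih =>
  rcases U.eq_empty_or_nonempty with rfl | ⟨e, he⟩
  · refine ⟨τ, by simpa using hτ, fun β f g h _ d hd => h d (by simpa using hd), ?_⟩
    intro β Z' h
    exact ⟨Z', by simpa using h, by simp, by simp⟩
  obtain ⟨he', hee, hne⟩ := hθ e he
  set e' := θ e with he'_def
  set σ : D → D := fun d => if τ d = e then τ e' else if τ d = e' then τ e else τ d with hσ_def
  have hS' : IsMatching (S \ {e, e'}) σ := by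
    intro d hd
    have h1 := hτ d (by grind)
    have h2 := hτ e (hU he)
    have h3 := hτ e' (hU he')
    grind
  have hU' : IsMatching (U \ {e, e'}) θ := by
    intro d hd
    have h1 := hθ d (by grind)
    have h2 := hθ e he
    have h3 := hθ e' he'
    grind
  obtain ⟨τ', h1, h2, h3⟩ := ih (U \ {e, e'}).card
    (by rw [← hn]; exact Finset.card_lt_card (Finset.ssubset_iff_subset_ne.2
          ⟨Finset.sdiff_subset, fun h => by have := h ▸ he; simp at this⟩))
    hS' hU' (Finset.sdiff_subset_sdiff hU le_rfl) rfl
  have hSU : (S \ {e, e'}) \ (U \ {e, e'}) = S \ U := by grind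
  rw [hSU] at h1 h2 h3
  refine ⟨τ', h1, ?_, ?_⟩
  · intro β f g hf hg
    refine h2 β f g ?_ (fun d hd => hg d (by grind))
    intro d hd
    have a1 := hf d (by grind)
    have a2 := hf e (hU he)
    have a3 := hf e' (hU he')
    have a4 := hg e he
    have a5 := hg e' he'
    simp only [hσ_def]
    split_ifs <;> grind
  · intro β Z' hZ'
    obtain ⟨Z₁, hz1, hz2, hz3⟩ := h3 β Z' hZ'
    have q1 := hτ e (hU he)
    have q2 := hτ e' (hU he')
    -- The removed pair takes the value of the strand that runs through it; for `τ e = e'` any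
    -- common value would do.
    refine ⟨fun d => if d = e ∨ d = e' then Z₁ (τ e) else Z₁ d, ?_, ?_, ?_⟩
    · intro d hd
      have q3 := hτ d hd
      by_cases hc : τ e = e'
      · by_cases hd' : d = e ∨ d = e'
        · grind
        · have := hz1 d (by grind)
          grind
      · have q4 := hz1 (τ e) (by grind)
        have q5 : σ (τ e) = τ e' := by simp [hσ_def, q1.2.1]
        rw [q5] at q4
        by_cases hd' : d = e ∨ d = e'
        · grind
        · have := hz1 d (by grind)
          grind
    · intro d hd
      have := hθ d hd
      by_cases hd' : d = e ∨ d = e'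
      · grind
      · have := hz2 d (by grind)
        grind
    · intro d hd
      have := hz3 d (by grind)
      grind

/-- A 4-regular multigraph on a set of darts that is a union of vertices: `τ` exchanges the two
darts of each edge. -/
structure Wiring {D : Type*} (X : CellSystem D) where
  S : Finset D
  τ : D → D
  near_mem : ∀ d ∈ S, ∀ e, X.Near d e → e ∈ S
  matching : IsMatching S τ

namespace Wiring

variable {D : Type*} {X : CellSystem D} (W : Wiring X)

theorem τ_mem {d : D} (h : d ∈ W.S) : W.τ d ∈ W.S := (W.matching d h).1
theorem τ_τ {d : D} (h : d ∈ W.S) : W.τ (W.τ d) = d := (W.matching d h).2.1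
theorem τ_ne {d : D} (h : d ∈ W.S) : W.τ d ≠ d := (W.matching d h).2.2
theorem mate_mem {d : D} (h : d ∈ W.S) : X.mate d ∈ W.S := W.near_mem d h _ (X.near_mate d)
theorem opp_mem {d : D} (h : d ∈ W.S) : X.opp d ∈ W.S := W.near_mem d h _ (X.near_opp d)
theorem rot_mem {d : D} (h : d ∈ W.S) : X.rot d ∈ W.S := W.near_mem d h _ (X.near_rot d)

/-- An even edge set, as a function on darts. -/
structure Even (Z : D → ZMod 2) : Prop where
  edge : ∀ d ∈ W.S, Z (W.τ d) = Z d
  vertex : ∀ d ∈ W.S, Z d + Z (X.mate d) + Z (X.opp d) + Z (X.mate (X.opp d)) = 0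

/-- A two-colouring of the faces, with boundary `Z`. Here `φ d` is the colour of the face at the
corner preceding `d`. -/
def IsFaceColouring (Z φ : D → ZMod 2) : Prop :=
  ∀ d ∈ W.S, φ (X.rot d) = φ d + Z d ∧ φ (W.τ d) = φ (X.rot d)

/-- Every even edge set bounds. -/
def Planar : Prop := ∀ Z, W.Even Z → ∃ φ, W.IsFaceColouring Z φ

/-- No vertex separates the graph into the parts at its two cells. -/
def Bridgeless : Prop := ∀ d ∈ W.S, ∃ Z, W.Even Z ∧ Z d + Z (X.mate d) = 1

/-- The colour condition at a vertex. -/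
structure Proper (X : CellSystem D) (c : D → ℕ) (d : D) : Prop where
  ne : c (X.mate d) ≠ c d
  eq : c (X.opp d) = c d ∨ c (X.mate (X.opp d)) = c d

/-- `W` has a colouring in which both cells of a vertex carry the same two colours. -/
def Colourable : Prop := ∃ c : D → ℕ, ∀ d ∈ W.S, c (W.τ d) = c d ∧ Proper X c d

variable {W}

theorem Even.add {Z Z' : D → ZMod 2} (h : W.Even Z) (h' : W.Even Z') : W.Even (Z + Z') where
  edge d hd := by simp [h.edge d hd, h'.edge d hd]
  vertex d hd := by
    have := h.vertex d hd; have := h'.vertex d hd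
    simp only [Pi.add_apply]; grind

/-- All degrees are 4, so the whole edge set is even; in the plane this makes the faces properly
two-colourable. -/
theorem even_one : W.Even 1 where
  edge d hd := rfl
  vertex d hd := by simp only [Pi.one_apply]; decide

theorem Even.rot {Z : D → ZMod 2} (h : W.Even Z) {d : D} (hd : d ∈ W.S) :
    Z d + Z (X.rot d) + Z (X.rot (X.rot d)) + Z (X.rot (X.rot (X.rot d))) = 0 := by
  have h1 := h.vertex d hd
  have h2 := X.mate_opp d
  have h3 := X.rot_four d
  unfold CellSystem.opp at *
  rcases X.consecutive d with h' | h' <;> grind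

/-- A matching inside the vertices pairs off the remaining two darts with each other. -/
theorem vertex_sum_of_matching {V : Finset D} (hV : ∀ d ∈ V, ∀ e, X.Near d e → e ∈ V) {θ : D → D}
    (hθ : IsMatching V θ) (hn : ∀ d ∈ V, X.Near d (θ d)) {Z : D → ZMod 2}
    (hZ : ∀ d ∈ V, Z (θ d) = Z d) {d : D} (hd : d ∈ V) :
    Z d + Z (X.mate d) + Z (X.opp d) + Z (X.mate (X.opp d)) = 0 := by
  have m1 := hV d hd _ (X.near_mate d)
  have m2 := hV d hd _ (X.near_opp d)
  have m3 := hV d hd _ (X.near_opp d).mate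
  have a0 := hn d hd
  have a1 := hn _ m1
  have a2 := hn _ m2
  have a3 := hn _ m3
  have b0 := hθ d hd
  have b1 := hθ _ m1
  have b2 := hθ _ m2
  have b3 := hθ _ m3
  have c0 := hZ d hd
  have c1 := hZ _ m1
  have c2 := hZ _ m2
  have c3 := hZ _ m3
  have e1 := X.mate_mate d
  have e2 := X.opp_opp d
  have e3 := X.mate_opp d
  have e4 := X.mate_mate (X.opp d)
  have e5 := X.mate_opp (X.mate d)
  have e6 := X.opp_opp (X.mate d)
  unfold CellSystem.Near at a0 a1 a2 a3
  rcases a0 with a0 | a0 | a0 | a0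
  · grind
  · rcases a2 with a2 | a2 | a2 | a2 <;> grind
  · rcases a1 with a1 | a1 | a1 | a1 <;> grind
  · rcases a1 with a1 | a1 | a1 | a1 <;> grind

/-- Removing a set `V` of vertices, where the edges in `K` are deleted and the others are joined
according to `θ`. -/
theorem exists_reduction [DecidableEq D] (W : Wiring X) {V K : Finset D} {θ : D → D} (hVS : V ⊆ W.S)
    (hV : ∀ d ∈ V, ∀ e, X.Near d e → e ∈ V) (hKV : K ⊆ V) (hKτ : ∀ d ∈ K, W.τ d ∈ K)
    (hθ : IsMatching V θ) (hθK : ∀ d ∈ K, θ d ∈ K) (hn : ∀ d ∈ V, X.Near d (θ d))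
    (hcross : ∀ d ∈ V, d ∉ K → θ d = X.opp d → X.rot d ∈ K) :
    ∃ W' : Wiring X, W'.S = W.S \ V ∧ (W.Planar → W'.Planar) ∧
      (∀ Z, W.Even Z → (∀ d ∈ V, d ∉ K → Z (θ d) = Z d) → W'.Even Z) ∧
      (∀ (β : Type) (Z' : D → β), (∀ d ∈ W'.S, Z' (W'.τ d) = Z' d) →
        ∃ Z : D → β, (∀ d ∈ W.S, d ∉ K → Z (W.τ d) = Z d) ∧
          (∀ d ∈ V, d ∉ K → Z (θ d) = Z d) ∧ ∀ d, d ∉ V → Z d = Z' d) := by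
  have hτ' : IsMatching (W.S \ K) W.τ := fun d hd => by
    have h1 := W.matching d (by grind)
    have h2 : W.τ d ∈ K → d ∈ K := fun h => h1.2.1 ▸ hKτ _ h
    grind
  have hθ' : IsMatching (V \ K) θ := fun d hd => by
    have h1 := hθ d (by grind)
    have h2 : θ d ∈ K → d ∈ K := fun h => h1.2.1 ▸ hθK _ h
    grind
  obtain ⟨τ', h1, h2, h3⟩ := hτ'.exists_resolution hθ' (Finset.sdiff_subset_sdiff hVS le_rfl)
  have hSV : (W.S \ K) \ (V \ K) = W.S \ V := by grind
  rw [hSV] at h1 h2 h3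
  let W' : Wiring X := ⟨W.S \ V, τ', fun d hd e he => by
    have := W.near_mem d (by grind) e he
    have := hV e
    have := he.symm
    grind, h1⟩
  have hext : ∀ (β : Type) (Z' : D → β), (∀ d ∈ W'.S, Z' (W'.τ d) = Z' d) →
        ∃ Z : D → β, (∀ d ∈ W.S, d ∉ K → Z (W.τ d) = Z d) ∧
          (∀ d ∈ V, d ∉ K → Z (θ d) = Z d) ∧ ∀ d, d ∉ V → Z d = Z' d := by
    intro β Z' hZ'
    obtain ⟨Z, z1, z2, z3⟩ := h3 β Z' hZ'
    exact ⟨Z, fun d hd hK => z1 d (by grind), fun d hd hK => z2 d (by grind),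
      fun d hd => z3 d (by grind)⟩
  refine ⟨W', rfl, ?_, ?_, hext⟩
  · intro hP Z' hZ'
    obtain ⟨Z₀, z1, z2, z3⟩ := hext _ Z' hZ'.edge
    -- Deleted edges get 0, so the extension is even in the larger graph.
    set Z : D → ZMod 2 := fun d => if d ∈ K then 0 else Z₀ d with hZdef
    have hZθ : ∀ d ∈ V, Z (θ d) = Z d := fun d hd => by
      have := hθ' d
      have := hθK d
      have := z2 d hd
      grind
    have hZ : W.Even Z := by
      constructor
      · intro d hd
        have := hKτ d
        have := hτ' d
        have := z1 d hd
        grind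
      · intro d hd
        by_cases hdV : d ∈ V
        · exact vertex_sum_of_matching hV hθ hn hZθ hdV
        · have k1 : ∀ e, X.Near d e → Z e = Z' e := fun e he => by
            have q : e ∉ V := fun h => hdV (hV e h d he.symm)
            have := z3 e q
            grind
          rw [k1 _ (.refl X d), k1 _ (X.near_mate d), k1 _ (X.near_opp d), k1 _ (X.near_opp d).mate]
          exact hZ'.vertex d (by simp [W', hd, hdV])
    obtain ⟨φ, hφ⟩ := hP Z hZ
    refine ⟨φ, fun d hd => ?_⟩
    have hd' : d ∈ W.S \ V := hd
    have e1 := hφ d (by grind)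
    have e2 : Z d = Z' d := by
      have := z3 d (by grind)
      grind
    refine ⟨by rw [e1.1, e2], ?_⟩
    -- The colours `φ d` and `φ (X.rot d)` on the two sides of a strand are carried along it. At a
    -- removed vertex the colours fit when the joined darts are consecutive; when they are opposite,
    -- the strand between them belongs to `K` and carries 0, so the colour does not change across
    -- it.
    refine h2 _ φ (fun d => φ (X.rot d)) (fun d hd => (hφ d (by grind)).2) ?_ d hd'
    intro e he
    have heV : e ∈ V := by grind
    have f0 := hφ e (hVS heV)
    have f1 := hφ _ (W.rot_mem (hVS heV))
    have f2 := hφ _ (W.rot_mem (W.rot_mem (hVS heV)))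
    have g0 := hZθ e heV
    have g1 := X.rot_four e
    have g2 := (hθ e heV).2.2
    rcases X.near_iff_rot.1 (hn e heV) with h | h | h | h
    · exact absurd h g2
    · grind
    · have g3 := hcross e heV (by grind) h
      have g4 : Z (X.rot e) = 0 := by simp [hZdef, g3]
      grind
    · grind
  · intro Z hZ hZθ
    refine ⟨fun d hd => ?_, fun d hd => hZ.vertex d (Finset.mem_sdiff.1 hd).1⟩
    exact h2 _ Z Z (fun d hd => hZ.edge d (by grind)) (fun d hd => (hZθ d (by grind) (by grind)).symm)
      d hd

end Wiring

/-! ### Walks, even sets and parallel vertices -/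

namespace Wiring

variable {D : Type*} {X : CellSystem D} {W : Wiring X}

variable (W) in
/-- Reachability along the edges satisfying `T`, inside cells, and from one cell to the other at the
vertices satisfying `O`. -/
inductive Conn (T O : D → Prop) (a : D) : D → Prop
  | refl : Conn T O a a
  | edge {d : D} : Conn T O a d → d ∈ W.S → T d → Conn T O a (W.τ d)
  | mate {d : D} : Conn T O a d → Conn T O a (X.mate d)
  | opp {d : D} : Conn T O a d → O d → Conn T O a (X.opp d)

theorem Conn.mem {T O : D → Prop} {a b : D} (h : W.Conn T O a b) (ha : a ∈ W.S) : b ∈ W.S := by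
  induction h with
  | refl => exact ha
  | edge _ h1 _ _ => exact W.τ_mem h1
  | mate _ ih => exact W.mate_mem ih
  | opp _ _ ih => exact W.opp_mem ih

theorem Conn.trans {T O : D → Prop} {a b c : D} (h : W.Conn T O a b) (h' : W.Conn T O b c) :
    W.Conn T O a c := by
  induction h' with
  | refl => exact h
  | edge _ h1 h2 ih => exact ih.edge h1 h2
  | mate _ ih => exact ih.mate
  | opp _ h1 ih => exact ih.opp h1

theorem Conn.mono {T O T' O' : D → Prop} {a b : D} (h : W.Conn T O a b) (hT : ∀ d, T d → T' d)
    (hO : ∀ d, O d → O' d) : W.Conn T' O' a b := by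
  induction h with
  | refl => exact .refl
  | edge _ h1 h2 ih => exact ih.edge h1 (hT _ h2)
  | mate _ ih => exact ih.mate
  | opp _ h1 ih => exact ih.opp (hO _ h1)

theorem Conn.symm {T O : D → Prop} {a b : D} (h : W.Conn T O a b)
    (hT : ∀ d ∈ W.S, T d → T (W.τ d)) (hO : ∀ d, O d → O (X.opp d)) : W.Conn T O b a := by
  induction h with
  | refl => exact .refl
  | @edge d _ h1 h2 ih =>
    have := (Conn.refl (W := W) (T := T) (O := O) (a := W.τ d)).edge (W.τ_mem h1) (hT _ h1 h2)
    rw [W.τ_τ h1] at this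
    exact this.trans ih
  | @mate d h ih =>
    have := (Conn.refl (W := W) (T := T) (O := O) (a := X.mate d)).mate
    rw [X.mate_mate] at this
    exact this.trans ih
  | @opp d _ h1 ih =>
    have := (Conn.refl (W := W) (T := T) (O := O) (a := X.opp d)).opp (hO _ h1)
    rw [X.opp_opp] at this
    exact this.trans ih

-- A walk is recorded modulo 2: `Z` counts its passages along edges and `m` its passages between the
-- two cells of a vertex. Taking cells as nodes, the boundary of this chain consists of the cells of
-- its two ends.
open Classical in
theorem Conn.exists_chain {T O : D → Prop} {a b : D} (h : W.Conn T O a b)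
    (hT : ∀ d ∈ W.S, T d → T (W.τ d)) (hO : ∀ d e, O d → X.Near d e → O e) :
    ∃ Z m : D → ZMod 2, (∀ d ∈ W.S, Z (W.τ d) = Z d) ∧ (∀ d ∈ W.S, ¬ T d → Z d = 0) ∧
      (∀ d e, X.Near d e → m d = m e) ∧ (∀ d, ¬ O d → m d = 0) ∧
      ∀ d ∈ W.S, Z d + Z (X.mate d) + m d =
        (if d = a ∨ d = X.mate a then 1 else 0) + (if d = b ∨ d = X.mate b then 1 else 0) := by
  induction h with
  | refl => exact ⟨0, 0, by simp, by simp, by simp, by simp, fun d _ => by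
      split_ifs <;> simp; decide⟩
  | @edge b h1 h2 h3 ih =>
    obtain ⟨Z, m, i1, i2, i3, i4, i5⟩ := ih
    refine ⟨fun d => Z d + (if d = b ∨ d = W.τ b then 1 else 0), m, ?_, ?_, i3, i4, ?_⟩
    · intro d hd
      have := i1 d hd
      have := W.τ_τ hd
      have := W.τ_τ h2
      grind
    · intro d hd hn
      have := i2 d hd hn
      have := hT b h2 h3
      grind
    · intro d hd
      have := i5 d hd
      have := X.mate_mate d
      have := X.mate_mate b
      have := X.mate_mate (W.τ b)
      have := X.mate_ne b
      have := X.mate_ne (W.τ b)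
      have := W.τ_ne h2
      by_cases h : d = b ∨ d = X.mate b <;> by_cases h' : d = W.τ b ∨ d = X.mate (W.τ b) <;> grind
  | @mate b h ih =>
    obtain ⟨Z, m, i1, i2, i3, i4, i5⟩ := ih
    refine ⟨Z, m, i1, i2, i3, i4, fun d hd => ?_⟩
    rw [i5 d hd, X.mate_mate]
    grind
  | @opp b h1 h2 ih =>
    obtain ⟨Z, m, i1, i2, i3, i4, i5⟩ := ih
    refine ⟨Z, fun d => m d + (if X.Near b d then 1 else 0), i1, i2, ?_, ?_, ?_⟩
    · intro d e hde
      have := i3 d e hde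
      have h1 : X.Near b d ↔ X.Near b e := ⟨fun h => h.trans hde, fun h => h.trans hde.symm⟩
      simp only [h1, this]
    · intro d hd
      have := i4 d hd
      have h1 : ¬ X.Near b d := fun h => hd (hO _ _ h2 h)
      simp [h1, this]
    · intro d hd
      have := i5 d hd
      have := X.mate_ne_opp b
      have := X.mate_opp_ne b
      have := X.mate_mate b
      have := X.opp_ne b
      have := X.mate_ne b
      have h3 : X.Near b d ↔ (d = b ∨ d = X.mate b) ∨ (d = X.opp b ∨ d = X.mate (X.opp b)) := by
        unfold CellSystem.Near; tauto
      have := X.mate_mate (X.opp b)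
      by_cases h : d = b ∨ d = X.mate b <;> by_cases h' : d = X.opp b ∨ d = X.mate (X.opp b) <;>
        grind

open Classical in
/-- A walk joining the two cells of a vertex that avoids the vertex yields an even set. -/
theorem Conn.exists_even {T O : D → Prop} {a : D} (h : W.Conn T O a (X.opp a))
    (hT : ∀ d ∈ W.S, T d → T (W.τ d)) (hO : ∀ d e, O d → X.Near d e → O e) :
    ∃ Z, W.Even Z ∧ (∀ d ∈ W.S, ¬ T d → Z d = 0) ∧
      ∀ d ∈ W.S, ¬ O d → Z d + Z (X.mate d) = if X.Near a d then 1 else 0 := by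
  obtain ⟨Z, m, i1, i2, i3, i4, i5⟩ := h.exists_chain hT hO
  have key : ∀ d ∈ W.S, Z d + Z (X.mate d) + m d = if X.Near a d then 1 else 0 := by
    intro d hd
    rw [i5 d hd]
    have := X.mate_ne_opp a
    have := X.mate_opp_ne a
    have := X.mate_mate a
    have := X.opp_ne a
    have := X.mate_mate (X.opp a)
    unfold CellSystem.Near
    by_cases h : d = a ∨ d = X.mate a <;> by_cases h' : d = X.opp a ∨ d = X.mate (X.opp a) <;> grind
  refine ⟨Z, ⟨i1, fun d hd => ?_⟩, i2, fun d hd hn => by rw [← key d hd, i4 d hn, add_zero]⟩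
  have h1 := key d hd
  have h2 := key _ (W.opp_mem hd)
  have h3 := i3 d _ (X.near_opp d)
  have h4 : X.Near a d ↔ X.Near a (X.opp d) := ⟨fun h => h.opp, fun h => h.trans (X.near_opp d).symm⟩
  simp only [h4] at h1
  grind

/-- The colours at a vertex form two pairs. -/
theorem Proper.sum_eq_zero {c : D → ℕ} {d : D} (h : Proper X c d) (h' : Proper X c (X.mate d))
    (f : ℕ → ZMod 2) :
    f (c d) + f (c (X.mate d)) + f (c (X.opp d)) + f (c (X.mate (X.opp d))) = 0 := by
  have h1 := X.mate_mate d
  have h2 := X.mate_opp d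
  have h3 := X.mate_opp (X.mate d)
  obtain ⟨a, b⟩ := h
  obtain ⟨a', b'⟩ := h'
  rw [h3, h1, ← h2] at b'
  rcases b with b | b <;> rcases b' with b' | b' <;> grind

theorem Proper.cases {c : D → ℕ} {d : D} (h : Proper X c d) (h' : Proper X c (X.mate d)) :
    c (X.opp d) = c d ∧ c (X.mate (X.opp d)) = c (X.mate d) ∨
      c (X.mate (X.opp d)) = c d ∧ c (X.opp d) = c (X.mate d) := by
  have h2 := X.mate_opp d
  have h3 := X.mate_opp (X.mate d)
  obtain ⟨a, b⟩ := h
  obtain ⟨a', b'⟩ := h'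
  rw [h3, X.mate_mate, ← h2] at b'
  rcases b with b | b <;> rcases b' with b' | b' <;> grind

theorem proper_congr {c c' : D → ℕ} {d : D} (h : ∀ e, X.Near d e → c e = c' e) (hc : Proper X c' d) :
    Proper X c d := by
  obtain ⟨h1, h2⟩ := hc
  constructor
  · rwa [h _ (.refl X d), h _ (X.near_mate d)]
  · rwa [h _ (.refl X d), h _ (X.near_opp d), h _ (X.near_opp d).mate]

/-- The sum over all four darts vanishes, so an even set splits both cells of a vertex or neither.
-/
theorem Even.add_mate {Z : D → ZMod 2} (h : W.Even Z) {d e : D} (hd : d ∈ W.S) (hn : X.Near d e) :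
    Z e + Z (X.mate e) = Z d + Z (X.mate d) := by
  have h1 := h.vertex d hd
  have h2 := X.mate_mate d
  have h3 := X.mate_mate (X.opp d)
  rcases hn with rfl | rfl | rfl | rfl <;> grind

variable (W) in
/-- All smaller plane bridgeless graphs are colourable. -/
def SmallerColourable : Prop := ∀ W' : Wiring X, W'.S.card < W.S.card → W'.Planar →
  W'.Bridgeless → W'.Colourable

variable [DecidableEq D]

theorem card_sdiff_lt {V : Finset D} (hV : V ⊆ W.S) {x : D} (hx : x ∈ V) :
    (W.S \ V).card < W.S.card :=
  Finset.card_lt_card ⟨Finset.sdiff_subset, fun h => by have := h (hV hx); grind⟩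

variable (W) in
/-- The four darts at the vertex of `x`. -/
def star (x : D) : Finset D := W.S.filter (X.Near x)

theorem mem_star {x d : D} : d ∈ W.star x ↔ d ∈ W.S ∧ X.Near x d := by simp [star]

theorem star_closed (x : D) : ∀ d ∈ W.star x, ∀ e, X.Near d e → e ∈ W.star x := fun d hd e he => by
  rw [mem_star] at *
  exact ⟨W.near_mem d hd.1 e he, hd.2.trans he⟩

/-- If two vertices are separated by the same even sets, then smoothing one of them
gives a colouring. -/
theorem colourable_of_parallel (hP : W.Planar) (hB : W.Bridgeless) (ih : W.SmallerColourable)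
    {x e : D} (hx : x ∈ W.S) (he : e ∈ W.S) (hxe : ¬ X.Near x e)
    (hpar : ∀ Z, W.Even Z → Z x + Z (X.mate x) = Z e + Z (X.mate e)) : W.Colourable := by
  classical
  set O : D → Prop := fun d => ¬ X.Near x d ∧ ¬ X.Near e d with hO
  have hOc : ∀ d e, O d → X.Near d e → O e := fun d e h h' =>
    ⟨fun h1 => h.1 (h1.trans h'.symm), fun h1 => h.2 (h1.trans h'.symm)⟩
  -- A walk avoiding both vertices would give an even set that splits the cells at `x` but not those
  -- at `e`.
  have hsep : ¬ W.Conn (fun _ => True) O x (X.opp x) := fun h => by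
    obtain ⟨Z, z1, -, z3⟩ := h.exists_even (by simp) hOc
    have h1 := z3 x hx (fun h => h.1 (.refl X x))
    have h2 := z3 e he (fun h => h.2 (.refl X e))
    have h3 := hpar Z z1
    simp [CellSystem.Near.refl, hxe, h1, h2] at h3
  -- An even set that splits no cell, but takes different values on the two cells of `x`. Adding it
  -- repairs other even sets at `x` without changing which cells they split.
  set Y : D → ZMod 2 := fun d => if W.Conn (fun _ => True) O x d then 0 else 1 with hY
  have hYm : ∀ d, Y (X.mate d) = Y d := fun d => by
    have h1 : W.Conn (fun _ => True) O x d → W.Conn (fun _ => True) O x (X.mate d) := .mate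
    have h2 : W.Conn (fun _ => True) O x (X.mate d) → W.Conn (fun _ => True) O x d := fun h => by
      simpa [X.mate_mate] using h.mate
    simp only [hY, iff_def.2 ⟨h1, h2⟩]
  have hYe : W.Even Y := by
    refine ⟨fun d hd => ?_, fun d hd => ?_⟩
    · have h1 : W.Conn (fun _ => True) O x d → W.Conn (fun _ => True) O x (W.τ d) := fun h =>
        .edge h hd trivial
      have h2 : W.Conn (fun _ => True) O x (W.τ d) → W.Conn (fun _ => True) O x d := fun h => by
        simpa [W.τ_τ hd] using h.edge (W.τ_mem hd) trivial
      simp only [hY, iff_def.2 ⟨h1, h2⟩]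
    · have h1 := hYm d
      have h2 := hYm (X.opp d)
      grind
  have hYx : Y x = 0 := by simp [hY, Conn.refl]
  have hYo : Y (X.opp x) = 1 := by simp [hY, hsep]
  have hxV : x ∈ W.star x := mem_star.2 ⟨hx, .refl X x⟩
  have hVS : W.star x ⊆ W.S := Finset.filter_subset _ _
  have hθ : IsMatching (W.star x) (fun d => X.mate (X.opp d)) := fun d hd =>
    ⟨star_closed x d hd _ (X.near_opp d).mate,
      by simp only [X.mate_opp, X.opp_opp, X.mate_mate], X.mate_opp_ne d⟩
  -- The noncrossing smoothing of `x` that joins darts of different cells.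
  obtain ⟨W', hS', hP', hE', hC'⟩ := W.exists_reduction (K := ∅) hVS (star_closed x) (by simp)
    (by simp) hθ (by simp) (fun d _ => (X.near_opp d).mate)
    (fun d _ _ h => absurd h (X.mate_ne _))
  have hB' : W'.Bridgeless := by
    intro d hd
    have hdS : d ∈ W.S := by grind
    obtain ⟨Z, z1, z2⟩ := hB d hdS
    have hYd := hYm d
    have key : ∀ Z, W.Even Z → Z x = Z (X.mate (X.opp x)) → W'.Even Z := fun Z hZ h => by
      refine hE' Z hZ fun d hd _ => ?_
      have h1 := hZ.vertex x hx
      have h2 := X.mate_mate x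
      have h3 := X.opp_opp x
      have h4 := X.mate_opp x
      have h5 := X.mate_mate (X.opp x)
      have h6 := X.opp_opp (X.mate x)
      have h7 := X.mate_opp (X.mate x)
      rcases (mem_star.1 hd).2 with rfl | rfl | rfl | rfl <;> grind
    by_cases hc : Z x = Z (X.mate (X.opp x))
    · exact ⟨Z, key Z z1 hc, z2⟩
    · refine ⟨Z + Y, key _ (z1.add hYe) ?_, ?_⟩
      · simp only [Pi.add_apply, hYm, hYx, hYo]
        revert hc; generalize Z x = a; generalize Z (X.mate (X.opp x)) = b; revert a b; decide
      · simp only [Pi.add_apply, hYd]; grind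
  obtain ⟨c', hc'⟩ := ih W' (by rw [hS']; exact card_sdiff_lt hVS hxV) (hP' hP) hB'
  obtain ⟨c, c1, c2, c3⟩ := hC' ℕ c' (fun d hd => (hc' d hd).1)
  have hgood : ∀ d ∈ W.S, ¬ X.Near x d → Proper X c d := fun d hd hn => by
    refine proper_congr (fun f hf => c3 f ?_) (hc' d (by rw [hS']; grind [mem_star])).2
    exact fun h => hn ((mem_star.1 h).2.trans hf.symm)
  have hcV : ∀ d ∈ W.S, X.Near x d → c (X.mate (X.opp d)) = c d := fun d hd hn =>
    c2 d (mem_star.2 ⟨hd, hn⟩) (by simp)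
  -- The colour class of `e` splits the cells at `e`, hence also those at `x`: the smoothing strands
  -- at `x` have different colours.
  have hZA : W.Even (fun d => if c d = c e then 1 else 0) := by
    refine ⟨fun d hd => by simp [c1 d hd], fun d hd => ?_⟩
    by_cases hn : X.Near x d
    · have h1 := hcV d hd hn
      have h2 := hcV _ (W.mate_mem hd) hn.mate
      rw [X.mate_opp, X.mate_mate] at h2
      simp only [h1, ← h2]
      grind
    · exact (hgood d hd hn).sum_eq_zero (hgood _ (W.mate_mem hd) fun h =>
        hn (h.trans (X.near_mate d).symm)) (fun a => if a = c e then 1 else 0)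
  have hxx := hpar _ hZA
  have hne := (hgood e he hxe).ne
  refine ⟨c, fun d hd => ⟨c1 d hd (by simp), ?_⟩⟩
  by_cases hn : X.Near x d
  · refine ⟨?_, Or.inr (hcV d hd hn)⟩
    have := hZA.add_mate hx hn
    simp only [hne, if_false, if_true] at hxx this
    intro h
    rw [hxx, h] at this
    split_ifs at this <;> revert this <;> decide
  · exact hgood d hd hn

end Wiring

/-! ### Faces, and splitting along three faces -/

namespace Wiring

variable {D : Type*} {X : CellSystem D}

variable (W : Wiring X) in
open Classical in
/-- The successor of a corner along the boundary of its face, a corner being represented by its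
second dart. -/
noncomputable def facePerm : Equiv.Perm D where
  toFun d := if d ∈ W.S then W.τ (X.rot (X.rot (X.rot d))) else d
  invFun d := if d ∈ W.S then X.rot (W.τ d) else d
  left_inv d := by
    by_cases h : d ∈ W.S
    · have h1 := W.rot_mem (W.rot_mem (W.rot_mem h))
      simp only [h, if_true, W.τ_mem h1, W.τ_τ h1, X.rot_four]
    · simp [h]
  right_inv d := by
    by_cases h : d ∈ W.S
    · have h1 := W.τ_mem h
      simp only [h, if_true, W.rot_mem h1, X.rot_four, W.τ_τ h]
    · simp [h]

variable {W : Wiring X}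

theorem facePerm_apply {d : D} (h : d ∈ W.S) : W.facePerm d = W.τ (X.rot (X.rot (X.rot d))) :=
  if_pos h

theorem facePerm_rot {d : D} (h : d ∈ W.S) : W.facePerm (X.rot d) = W.τ d := by
  rw [facePerm_apply (W.rot_mem h), X.rot_four]

theorem facePerm_mem {d : D} (h : d ∈ W.S) : W.facePerm d ∈ W.S := by
  rw [facePerm_apply h]; exact W.τ_mem (W.rot_mem (W.rot_mem (W.rot_mem h)))

variable (W) in
/-- Two corners of the same face. -/
def SameFace (a b : D) : Prop := W.facePerm.SameCycle a b

theorem SameFace.symm {a b : D} (h : W.SameFace a b) : W.SameFace b a := Equiv.Perm.SameCycle.symm h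

theorem SameFace.trans {a b c : D} (h : W.SameFace a b) (h' : W.SameFace b c) : W.SameFace a c :=
  Equiv.Perm.SameCycle.trans h h'

theorem SameFace.refl (a : D) : W.SameFace a a := Equiv.Perm.SameCycle.refl _ a

theorem sameFace_facePerm (a : D) : W.SameFace a (W.facePerm a) :=
  Equiv.Perm.sameCycle_apply_right.2 (.refl _ a)

theorem sameFace_rot_τ {d : D} (h : d ∈ W.S) : W.SameFace (X.rot d) (W.τ d) :=
  facePerm_rot h ▸ sameFace_facePerm _

theorem sameFace_τ_rot {d : D} (h : d ∈ W.S) : W.SameFace (X.rot (W.τ d)) d := by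
  have := sameFace_rot_τ (W.τ_mem h)
  rwa [W.τ_τ h] at this

theorem SameFace.induction [Finite D] {a b : D} (h : W.SameFace a b) {p : D → Prop} (ha : p a)
    (hp : ∀ d, W.SameFace a d → p d → p (W.facePerm d)) : p b := by
  obtain ⟨n, rfl⟩ := Equiv.Perm.SameCycle.exists_nat_pow_eq h
  induction n with
  | zero => simpa
  | succ n ih =>
    have h1 : W.SameFace a ((W.facePerm ^ n) a) := ⟨n, by simp⟩
    rw [pow_succ', Equiv.Perm.mul_apply]
    exact hp _ h1 (ih h1)

theorem SameFace.mem [Finite D] {a b : D} (h : W.SameFace a b) (ha : a ∈ W.S) : b ∈ W.S :=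
  h.induction ha fun _ _ hd => facePerm_mem hd

theorem IsFaceColouring.eq [Finite D] {Z φ : D → ZMod 2} (hφ : W.IsFaceColouring Z φ) {a b : D}
    (h : W.SameFace a b) (ha : a ∈ W.S) : φ a = φ b := by
  refine (h.induction (p := fun d => d ∈ W.S ∧ φ a = φ d) ⟨ha, rfl⟩ ?_).2
  intro d _ ⟨hd, hd'⟩
  refine ⟨facePerm_mem hd, ?_⟩
  rw [facePerm_apply hd, (hφ _ (W.rot_mem (W.rot_mem (W.rot_mem hd)))).2, X.rot_four, hd']

/-- The boundary of a set of faces. -/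
theorem even_boundary {φ : D → ZMod 2} (hφ : ∀ a b, W.SameFace a b → φ a = φ b) :
    W.Even (fun d => φ d + φ (X.rot d)) ∧ W.IsFaceColouring (fun d => φ d + φ (X.rot d)) φ := by
  refine ⟨⟨fun d hd => ?_, fun d hd => ?_⟩, fun d hd => ?_⟩
  · rw [← hφ _ _ (sameFace_rot_τ hd), hφ _ _ (sameFace_τ_rot hd), add_comm]
  · have h1 := X.rot_four d
    have h2 := X.mate_opp d
    unfold CellSystem.opp at *
    rcases X.consecutive d with h | h <;> grind
  · refine ⟨?_, (hφ _ _ (sameFace_rot_τ hd)).symm⟩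
    grind

/-- The two sides of an edge differ in the two-colouring of the faces bounded by the set of all
edges. -/
theorem Planar.not_sameFace_rot [Finite D] (hP : W.Planar) {d : D} (hd : d ∈ W.S) :
    ¬ W.SameFace d (X.rot d) := fun h => by
  obtain ⟨φ, hφ⟩ := hP 1 even_one
  have h1 := hφ.eq h hd
  have h2 := (hφ d hd).1
  rw [← h1] at h2
  simp at h2

/-- The corners of `d` and `X.opp d` lie between the cells. An even set that splits the cell of `d`
bounds a set of faces containing just one of them. -/
theorem Planar.not_sameFace_opp [Finite D] (hP : W.Planar) (hB : W.Bridgeless) {d : D}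
    (hd : d ∈ W.S) (h : X.mate d = X.rot d) : ¬ W.SameFace d (X.opp d) := fun h' => by
  obtain ⟨Z, z1, z2⟩ := hB d hd
  obtain ⟨φ, hφ⟩ := hP Z z1
  have h1 := hφ.eq h' hd
  have h2 := (hφ d hd).1
  have h3 := (hφ _ (W.rot_mem hd)).1
  unfold CellSystem.opp at h1
  grind

variable (W) in
/-- The part `K` of the graph is attached to the rest only by the vertex of `e` and by the edges of
`h` and `h'`, these three being cyclically linked by faces. -/
structure IsSplit (K : D → Prop) (e h h' : D) : Prop where
  he : e ∈ W.S
  hh : h ∈ W.S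
  hh' : h' ∈ W.S
  mate_e : X.mate e = X.rot e
  face : W.SameFace h e
  face' : W.SameFace h' (X.opp e)
  face_rot : W.SameFace (X.rot h) (X.rot h')
  near : ¬ X.Near e h
  near_τ : ¬ X.Near e (W.τ h)
  near' : ¬ X.Near e h'
  near_τ' : ¬ X.Near e (W.τ h')
  mate : ∀ d ∈ W.S, K (X.mate d) ↔ K d
  opp : ∀ d ∈ W.S, ¬ X.Near e d → (K (X.opp d) ↔ K d)
  edge : ∀ d ∈ W.S, d ≠ h → d ≠ W.τ h → d ≠ h' → d ≠ W.τ h' → (K (W.τ d) ↔ K d)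
  mem : K e
  not_mem : ¬ K (X.opp e)

theorem mate_opp_of_mate {d : D} (h : X.mate d = X.rot d) :
    X.mate (X.opp d) = X.rot (X.opp d) := by
  rw [X.mate_opp, h]; rfl

theorem near_opp_left {a b : D} : X.Near (X.opp a) b ↔ X.Near a b :=
  ⟨fun h => (X.near_opp a).trans h, fun h => (X.near_opp a).symm.trans h⟩

/-- Makes every statement about the part `K` available for its complement. -/
theorem IsSplit.symm {K : D → Prop} {e h h' : D} (H : W.IsSplit K e h h') :
    W.IsSplit (fun d => ¬ K d) (X.opp e) h' h where
  he := W.opp_mem H.he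
  hh := H.hh'
  hh' := H.hh
  mate_e := mate_opp_of_mate H.mate_e
  face := H.face'
  face' := by rw [X.opp_opp]; exact H.face
  face_rot := H.face_rot.symm
  near := by rw [near_opp_left]; exact H.near'
  near_τ := by rw [near_opp_left]; exact H.near_τ'
  near' := by rw [near_opp_left]; exact H.near
  near_τ' := by rw [near_opp_left]; exact H.near_τ
  mate d hd := not_congr (H.mate d hd)
  opp d hd h := not_congr (H.opp d hd (by rwa [near_opp_left] at h))
  edge d hd h1 h2 h3 h4 := not_congr (H.edge d hd h3 h4 h1 h2)
  mem := H.not_mem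
  not_mem := by rw [X.opp_opp]; exact not_not.2 H.mem

/-- Going round the face of `e`, one has to return to `K` through the edge of `h`. -/
theorem IsSplit.orientation [Finite D] {K : D → Prop} {e h h' : D} (H : W.IsSplit K e h h')
    (hP : W.Planar) (hB : W.Bridgeless) : K h ∧ ¬ K (W.τ h) := by
  by_contra hcon
  have hcon : K h → K (W.τ h) := fun a => by_contra fun b => hcon ⟨a, b⟩
  have hF12 := hP.not_sameFace_opp hB H.he H.mate_e
  have hr : ∀ d, W.SameFace e d → ¬ W.SameFace d (X.rot h) := fun d h1 h2 =>
    hP.not_sameFace_rot H.hh (H.face.trans (h1.trans h2))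
  have h3 : X.rot (X.rot (X.rot e)) = X.mate (X.opp e) := by
    rw [mate_opp_of_mate H.mate_e]; rfl
  have hKrot : ∀ c ∈ W.S, ¬ X.Near e c → (K (X.rot (X.rot (X.rot c))) ↔ K c) := by
    intro c hc hn
    have h1 := H.mate c hc
    have h2 := H.opp c hc hn
    have h3 := H.mate _ (W.opp_mem hc)
    rcases X.near_iff_rot.1 (X.near_rot c).rot.rot with q | q | q | q
    · exact absurd q (X.rot_three_ne c)
    · exact absurd q (X.rot_two_ne (X.rot c))
    · exact absurd q (X.rot_ne _)
    · rcases X.consecutive c with h | h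
      · have : X.mate (X.opp c) = X.rot (X.rot (X.rot c)) := by rw [mate_opp_of_mate h]; rfl
        rw [← this, h3, h2]
      · rw [← h, h1]
  have hstart : ¬ K (W.facePerm e) := by
    rw [facePerm_apply H.he, h3]
    have hn : X.Near e (X.mate (X.opp e)) := (X.near_opp e).mate
    rw [H.edge _ (W.mate_mem (W.opp_mem H.he)) (fun q => H.near (q ▸ hn))
      (fun q => H.near_τ (q ▸ hn)) (fun q => H.near' (q ▸ hn)) (fun q => H.near_τ' (q ▸ hn)),
      H.mate _ (W.opp_mem H.he)]
    exact H.not_mem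
  -- The face leaves the vertex of `e` outside `K` and must come back to `K`. It can change sides
  -- only at the edges of `h` and `h'`; three of the four directed passages would identify two of
  -- the three distinct faces, and the passage from `W.τ h` to `h` remains.
  refine (sameFace_facePerm e).symm.induction (p := fun d => ¬ K d) hstart ?_ H.mem
  intro c hc hKc hKF
  have hec : W.SameFace e c := (sameFace_facePerm e).trans hc
  have hcS : c ∈ W.S := hec.mem H.he
  have hcn : ¬ X.Near e c := by
    intro hn
    rcases X.near_iff_rot.1 hn with q | q | q | q
    · exact hKc (q ▸ H.mem)
    · exact hP.not_sameFace_rot H.he (q ▸ hec)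
    · exact hF12 ((show c = X.opp e from q) ▸ hec)
    · have := hP.not_sameFace_rot hcS
      rw [q, X.rot_four] at this
      exact this (q ▸ hec.symm)
  have h3S := W.rot_mem (W.rot_mem (W.rot_mem hcS))
  rw [facePerm_apply hcS] at hKF
  have hbad : ∀ g, W.SameFace (X.rot h) (X.rot g) → X.rot (X.rot (X.rot c)) ≠ g := fun g h1 h2 => by
    rw [← h2, X.rot_four] at h1
    exact hr c hec h1.symm
  by_cases c1 : X.rot (X.rot (X.rot c)) = W.τ h
  · rw [c1, W.τ_τ H.hh] at hKF
    have := hcon hKF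
    rw [← c1, hKrot c hcS hcn] at this
    exact hKc this
  · rw [H.edge _ h3S (hbad h (.refl _)) c1 (hbad h' H.face_rot) ?_, hKrot c hcS hcn] at hKF
    · exact hKc hKF
    · intro c2
      have q : c = X.rot (W.τ h') := by rw [← c2, X.rot_four]
      have := sameFace_τ_rot H.hh'
      rw [← q] at this
      exact hF12 (hec.trans (this.trans H.face'))

end Wiring

/-! ### Colouring and gluing the two parts of a splitting -/

namespace Wiring

variable {D : Type*} {X : CellSystem D} {W : Wiring X}

/-- Keep `K` and the vertex of `e`, and attach the two loose edges of `h` and `h'` to the other cell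
of this vertex. The result is smaller and inherits both hypotheses. The cell forces different
colours on the two loose edges, and the cell of `e` shows the same two colours. -/
theorem IsSplit.exists_side [Fintype D] {K : D → Prop} {e h h' : D} (H : W.IsSplit K e h h')
    (hP : W.Planar) (hB : W.Bridgeless) (ih : W.SmallerColourable) :
    ∃ c : D → ℕ, (∀ d ∈ W.S, K d → d ≠ h → d ≠ W.τ h' → c (W.τ d) = c d) ∧
      (∀ d ∈ W.S, K d → ¬ X.Near e d → Proper X c d) ∧ c h ≠ c (W.τ h') ∧
      (c e = c h ∧ c (X.mate e) = c (W.τ h') ∨ c e = c (W.τ h') ∧ c (X.mate e) = c h) := by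
  classical
  obtain ⟨hKh, hKτh⟩ := H.orientation hP hB
  obtain ⟨hKh', hKτh'⟩ := H.symm.orientation hP hB
  have hKτh' : K (W.τ h') := not_not.1 hKτh'
  obtain ⟨he, hh, hh', hme, F1, F2, Fr, n1, n2, n3, n4, kmate, kopp, kedge, Ke, Ko⟩ := H
  have hF12 := hP.not_sameFace_opp hB he hme
  have hKnear : ∀ d ∈ W.S, ¬ X.Near e d → ∀ f, X.Near d f → (K f ↔ K d) := by
    intro d hd hn f hf
    have := kmate d hd
    have := kopp d hd hn
    have := kmate _ (W.opp_mem hd)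
    rcases hf with rfl | rfl | rfl | rfl <;> grind
  -- the two darts of the other cell at the vertex of `e`
  set a := X.mate (X.opp e) with ha
  set b := X.opp e with hb
  have ha3 : a = X.rot (X.rot (X.rot e)) := mate_opp_of_mate hme
  have hab : a ≠ b := X.mate_ne b
  have hbS : b ∈ W.S := W.opp_mem he
  have haS : a ∈ W.S := W.mate_mem hbS
  have hKa : ¬ K a := fun q => Ko ((kmate b hbS).1 q)
  have hna : X.Near e a := (X.near_opp e).mate
  have hnb : X.Near e b := X.near_opp e
  have hKme : K (X.mate e) := (kmate e he).2 Ke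
  have hKe : ∀ d ∈ W.S, X.Near e d → ¬ K d → d = a ∨ d = b := by
    intro d hd hn hk
    rcases hn with rfl | rfl | rfl | rfl
    · exact absurd Ke hk
    · exact absurd hKme hk
    · exact Or.inr rfl
    · exact Or.inl rfl
  have hhh' : h ≠ W.τ h' := fun q => by
    have := sameFace_rot_τ hh'
    rw [← q] at this
    exact hP.not_sameFace_rot hh ((Fr.trans this).symm)
  have hS1closed : ∀ d ∈ W.S.filter (fun d => K d ∨ X.Near e d), ∀ f, X.Near d f →
      f ∈ W.S.filter (fun d => K d ∨ X.Near e d) := by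
    intro d hd f hf
    rw [Finset.mem_filter] at hd ⊢
    refine ⟨W.near_mem d hd.1 f hf, ?_⟩
    by_cases hn : X.Near e d
    · exact Or.inr (hn.trans hf)
    · exact Or.inl ((hKnear d hd.1 hn f hf).2 (by tauto))
  set τ₁ : D → D := fun d => if d = h then a else if d = W.τ h' then b else if d = a then h else
    if d = b then W.τ h' else W.τ d with hτ₁
  have hmatch : IsMatching (W.S.filter (fun d => K d ∨ X.Near e d)) τ₁ := by
    intro d hd
    rw [Finset.mem_filter] at hd
    have q1 := W.matching d hd.1
    have q2 := W.τ_τ hh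
    have q3 := W.τ_τ hh'
    have q4 := W.τ_mem hh'
    by_cases d1 : d = h ∨ d = W.τ h' ∨ d = a ∨ d = b
    · have : h ≠ a := fun q => n1 (q ▸ hna)
      have : h ≠ b := fun q => n1 (q ▸ hnb)
      have : W.τ h' ≠ a := fun q => n4 (q ▸ hna)
      have : W.τ h' ≠ b := fun q => n4 (q ▸ hnb)
      simp only [Finset.mem_filter]
      grind
    · have q5 := kedge d hd.1
      have q6 := hKe d hd.1
      have q7 : K d := by grind
      have q8 : d ≠ W.τ h := fun q => hKτh (q ▸ q7)
      have q9 : d ≠ h' := fun q => hKh' (q ▸ q7)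
      have q10 : K (W.τ d) := by grind
      have q11 : W.τ d ≠ h := fun q => q8 (by rw [← q, q1.2.1])
      have q12 : W.τ d ≠ W.τ h' := fun q => q9 (by rw [← q1.2.1, q, q3])
      have q13 : W.τ d ≠ a := fun q => hKa (q ▸ q10)
      have q14 : W.τ d ≠ b := fun q => Ko (q ▸ q10)
      simp only [Finset.mem_filter]
      grind
  let W₁ : Wiring X := ⟨W.S.filter (fun d => K d ∨ X.Near e d), τ₁, hS1closed, hmatch⟩
  have hS1 : ∀ d, d ∈ W₁.S ↔ d ∈ W.S ∧ (K d ∨ X.Near e d) := fun d => Finset.mem_filter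
  have t1 : τ₁ h = a := by simp [hτ₁]
  have t2 : τ₁ (W.τ h') = b := by simp [hτ₁, hhh'.symm]
  have t3 : τ₁ a = h := by
    rw [← t1]; exact (hmatch h (by simp [hh, hKh])).2.1
  have t4 : τ₁ b = W.τ h' := by
    rw [← t2]; exact (hmatch _ (by simp [W.τ_mem hh', hKτh'])).2.1
  have t5 : ∀ d ∈ W.S, K d → d ≠ h → d ≠ W.τ h' → τ₁ d = W.τ d := fun d _ hk d1 d2 => by
    have q13 : d ≠ a := fun q => hKa (q ▸ hk)
    have q14 : d ≠ b := fun q => Ko (q ▸ hk)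
    simp [hτ₁, d1, d2, q13, q14]
  have t6 : ∀ d ∈ W.S, K d → d ≠ h → d ≠ W.τ h' → K (W.τ d) := fun d hd hk d1 d2 =>
    (kedge d hd d1 (fun q => hKτh (q ▸ hk)) (fun q => hKh' (q ▸ hk)) d2).2 hk
  have hcard : W₁.S.card < W.S.card := by
    refine Finset.card_lt_card ⟨Finset.filter_subset _ _, fun q => ?_⟩
    have := q (W.τ_mem hh)
    rw [Finset.mem_filter] at this
    rcases this.2 with r | r
    exacts [hKτh r, n2 r]
  have ra : X.rot a = e := by rw [ha3, X.rot_four]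
  have rb : X.rot b = a := by rw [ha3]; rfl
  have hP₁ : W₁.Planar := by
    intro Z₁ hZ₁
    -- The boundary `Y` of the face of `e` takes the value 1 on `a` and `W.τ h`, and 0 on `b` and
    -- `h'`. So outside `K` the set `β + (α + β) * Y` matches the prescribed values `α` and `β` at
    -- both attachments.
    set φ₀ : D → ZMod 2 := fun d => if W.SameFace e d then 1 else 0
    have hφ₀ : ∀ x y, W.SameFace x y → φ₀ x = φ₀ y := fun x y q => by
      have : W.SameFace e x ↔ W.SameFace e y := ⟨fun r => r.trans q, fun r => r.trans q.symm⟩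
      simp only [φ₀, this]
    obtain ⟨hY, -⟩ := even_boundary hφ₀
    set Y : D → ZMod 2 := fun d => φ₀ d + φ₀ (X.rot d) with hYdef
    have y1 : φ₀ e = 1 := if_pos (.refl e)
    have y2 : φ₀ b = 0 := if_neg hF12
    have y3 : φ₀ a = 0 := if_neg fun q => by
      have := hP.not_sameFace_rot haS
      rw [ra] at this
      exact this q.symm
    have y4 : φ₀ h = 1 := by rw [hφ₀ _ _ F1, y1]
    have y5 : φ₀ (X.rot h) = 0 := if_neg fun q => hP.not_sameFace_rot hh (F1.trans q)
    have y6 : φ₀ h' = 0 := by rw [hφ₀ _ _ F2, y2]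
    have y7 : φ₀ (X.rot h') = 0 := by rw [← hφ₀ _ _ Fr, y5]
    set α := Z₁ a
    set β := Z₁ b
    have hαβ : Z₁ h = α := by have := hZ₁.edge h (by simp [hS1, hh, hKh]); rw [← this]; exact congrArg Z₁ t1
    have hβα : Z₁ (W.τ h') = β := by
      have := hZ₁.edge (W.τ h') (by simp [hS1, W.τ_mem hh', hKτh']); rw [← this]; exact congrArg Z₁ t2
    set Z : D → ZMod 2 := fun d => if K d then Z₁ d else β + (α + β) * Y d with hZdef
    have Za : Z a = α := by
      simp only [hZdef, hKa, if_false, hYdef, ra, y1, y3]; grind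
    have Zb : Z b = β := by
      simp only [hZdef, Ko, if_false, hYdef, rb, y2, y3]; grind
    have ZS : ∀ d ∈ W₁.S, Z d = Z₁ d := by
      intro d hd
      rw [hS1] at hd
      by_cases hk : K d
      · simp [hZdef, hk]
      · rcases hKe d hd.1 (hd.2.resolve_left hk) hk with rfl | rfl
        exacts [Za, Zb]
    have Zh : Z h = α := by simp [hZdef, hKh, hαβ]
    have Zτh' : Z (W.τ h') = β := by simp [hZdef, hKτh', hβα]
    have Zτh : Z (W.τ h) = α := by
      simp only [hZdef, hKτh, if_false, hY.edge h hh]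
      simp only [hYdef, y4, y5]; grind
    have Zh' : Z h' = β := by
      simp only [hZdef, hKh', if_false]
      simp only [hYdef, y6, y7]; grind
    have hZ : W.Even Z := by
      constructor
      · intro d hd
        by_cases d1 : d = h
        · rw [d1, Zh, Zτh]
        by_cases d2 : d = W.τ h
        · rw [d2, W.τ_τ hh, Zh, Zτh]
        by_cases d3 : d = h'
        · rw [d3, Zh', Zτh']
        by_cases d4 : d = W.τ h'
        · rw [d4, W.τ_τ hh', Zh', Zτh']
        have d5 := kedge d hd d1 d2 d3 d4
        by_cases hk : K d
        · have := hZ₁.edge d (by simp [hS1, hd, hk])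
          have d6 : W₁.τ d = W.τ d := t5 d hd hk d1 d4
          rw [d6] at this
          simp [hZdef, d5, hk, this]
        · simp [hZdef, d5, hk, hY.edge d hd]
      · intro d hd
        by_cases hd1 : d ∈ W₁.S
        · have := hZ₁.vertex d hd1
          rwa [← ZS _ hd1, ← ZS _ (W₁.mate_mem hd1), ← ZS _ (W₁.opp_mem hd1),
            ← ZS _ (W₁.mate_mem (W₁.opp_mem hd1))] at this
        · rw [hS1] at hd1
          have hk : ¬ K d := by tauto
          have hn : ¬ X.Near e d := by tauto
          have q := hKnear d hd hn
          have := hY.vertex d hd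
          simp only [hZdef, q _ (X.near_mate d), q _ (X.near_opp d),
            q _ (X.near_opp d).mate, hk, if_false]
          grind
    obtain ⟨φ, hφ⟩ := hP Z hZ
    have p1 := hφ h hh
    have p2 := hφ h' hh'
    have p3 := hφ.eq F1 hh
    have p4 := hφ.eq F2 hh'
    have p5 := hφ.eq Fr (W.rot_mem hh)
    have p6 := hφ.eq (sameFace_τ_rot hh') (W.rot_mem (W.τ_mem hh'))
    rw [Zh] at p1
    rw [Zh'] at p2
    -- Only the corner between `b` and `a` changes its face: it now belongs to the face common to
    -- `X.rot h` and `X.rot h'`.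
    set φ₁ : D → ZMod 2 := fun d => if d = a then φ (X.rot h) else φ d with hφ₁
    have hne : e ≠ a := (X.mate_opp_ne e).symm
    refine ⟨φ₁, fun d hd => ⟨?_, ?_⟩⟩
    · rw [← ZS d hd]
      have q := (hφ d ((hS1 d).1 hd).1).1
      by_cases d1 : d = a
      · rw [d1] at q ⊢
        rw [ra, Za]
        simp only [hφ₁, hne, if_false, if_true]
        grind
      · by_cases d2 : d = b
        · rw [d2] at q ⊢
          rw [rb, Zb]
          simp only [hφ₁, hab.symm, if_false, if_true]
          grind
        · have d3 : X.rot d ≠ a := fun q => d2 (X.rot_injective (q.trans rb.symm))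
          simp only [hφ₁, d1, d3, if_false, q]
    · change φ₁ (τ₁ d) = φ₁ (X.rot d)
      have hd' := (hS1 d).1 hd
      by_cases d1 : d = a
      · rw [d1, t3, ra]
        have : h ≠ a := fun q => n1 (q ▸ hna)
        simp [hφ₁, this, hne, p3]
      by_cases d2 : d = b
      · rw [d2, t4, rb]
        have : W.τ h' ≠ a := fun q => n4 (q ▸ hna)
        simp only [hφ₁, this, if_false, if_true, p5, p2.2]
      have hk : K d := by_contra fun hk => by
        rcases hKe d hd'.1 (hd'.2.resolve_left hk) hk with q | q
        exacts [d1 q, d2 q]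
      have d3 : X.rot d ≠ a := fun q => d2 (X.rot_injective (q.trans rb.symm))
      by_cases d4 : d = h
      · simp [d4, t1, hφ₁]
      by_cases d5 : d = W.τ h'
      · rw [d5] at d3
        simp only [d5, t2, hφ₁, d3, hab.symm, if_false]
        rw [p6, p4]
      rw [t5 d hd'.1 hk d4 d5]
      have d6 : W.τ d ≠ a := fun q => hKa (q ▸ t6 d hd'.1 hk d4 d5)
      simp only [hφ₁, d3, d6, if_false]
      exact (hφ d hd'.1).2
  have hB₁ : W₁.Bridgeless := by
    intro d hd
    have hd' := (hS1 d).1 hd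
    obtain ⟨Z, z1, z2⟩ := hB d hd'.1
    obtain ⟨φ, hφ⟩ := hP Z z1
    have p1 := hφ h hh
    have p2 := hφ h' hh'
    have p3 := hφ.eq F1 hh
    have p4 := hφ.eq F2 hh'
    have p5 := hφ.eq Fr (W.rot_mem hh)
    have p6 := hφ e he
    have p7 := hφ _ (W.rot_mem he)
    have hme2 := X.mate_mate e
    -- Add up the changes of `φ` around the three cyclically adjacent faces. This makes `Z₁` below
    -- even at the vertex of `e`.
    have key : Z e + Z (X.mate e) = Z h + Z h' := by
      rw [hme]
      have : X.opp e = X.rot (X.rot e) := rfl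
      grind
    set Z₁ : D → ZMod 2 := fun d => if d = a then Z h else if d = b then Z h' else Z d with hZ₁
    have e1 : ∀ f, K f → Z₁ f = Z f := fun f hf => by
      have q13 : f ≠ a := fun q => hKa (q ▸ hf)
      have q14 : f ≠ b := fun q => Ko (q ▸ hf)
      simp [hZ₁, q13, q14]
    have e2 : Z₁ a = Z h := by simp [hZ₁]
    have e3 : Z₁ b = Z h' := by simp [hZ₁, hab.symm]
    have he1 : Z₁ e + Z₁ (X.mate e) + Z₁ (X.opp e) + Z₁ (X.mate (X.opp e)) = 0 := by
      rw [← ha, ← hb, e2, e3, e1 _ Ke, e1 _ hKme]; grind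
    have hev : W₁.Even Z₁ := by
      constructor
      · intro f hf
        have hf' := (hS1 f).1 hf
        change Z₁ (τ₁ f) = Z₁ f
        by_cases d1 : f = a
        · rw [d1, t3, e2, e1 _ hKh]
        by_cases d2 : f = b
        · rw [d2, t4, e3, e1 _ hKτh', z1.edge h' hh']
        have hk : K f := by_contra fun hk => by
          rcases hKe f hf'.1 (hf'.2.resolve_left hk) hk with q | q
          exacts [d1 q, d2 q]
        by_cases d4 : f = h
        · rw [d4, t1, e2, e1 _ hKh]
        by_cases d5 : f = W.τ h'
        · rw [d5, t2, e3, e1 _ hKτh', z1.edge h' hh']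
        rw [t5 f hf'.1 hk d4 d5, e1 _ hk, e1 _ (t6 f hf'.1 hk d4 d5), z1.edge f hf'.1]
      · intro f hf
        have hf' := (hS1 f).1 hf
        by_cases hn : X.Near e f
        · have m1 := X.mate_mate e
          have m2 := X.opp_opp e
          have m3 := X.mate_opp e
          have m4 := X.mate_mate (X.opp e)
          have m5 := X.mate_opp (X.mate e)
          have m6 := X.opp_opp (X.mate e)
          rcases hn with rfl | rfl | rfl | rfl <;> grind
        · have q := hKnear f hf'.1 hn
          have hk : K f := by tauto
          rw [e1 _ hk, e1 _ ((q _ (X.near_mate f)).2 hk), e1 _ ((q _ (X.near_opp f)).2 hk),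
            e1 _ ((q _ (X.near_opp f).mate).2 hk)]
          exact z1.vertex f hf'.1
    refine ⟨Z₁, hev, ?_⟩
    by_cases hn : X.Near e d
    · rw [hev.add_mate ((hS1 e).2 ⟨he, Or.inl Ke⟩) hn, e1 _ Ke, e1 _ hKme, ← z1.add_mate he hn, z2]
    · have hk : K d := by tauto
      rw [e1 _ hk, e1 _ ((kmate d hd'.1).2 hk), z2]
  obtain ⟨c, hc⟩ := ih W₁ hcard hP₁ hB₁
  have heS : e ∈ W₁.S := (hS1 e).2 ⟨he, Or.inl Ke⟩
  have hc1 : c h = c a := by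
    have := (hc a ((hS1 a).2 ⟨haS, Or.inr hna⟩)).1
    rw [show W₁.τ a = h from t3] at this
    exact this
  have hc2 : c (W.τ h') = c b := by
    have := (hc b ((hS1 b).2 ⟨hbS, Or.inr hnb⟩)).1
    rw [show W₁.τ b = W.τ h' from t4] at this
    exact this
  refine ⟨c, fun d hd hk d1 d2 => ?_, fun d hd hk hn => (hc d ((hS1 d).2 ⟨hd, Or.inl hk⟩)).2, ?_, ?_⟩
  · have := (hc d ((hS1 d).2 ⟨hd, Or.inl hk⟩)).1
    rwa [show W₁.τ d = W.τ d from t5 d hd hk d1 d2] at this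
  · rw [hc1, hc2]
    exact (hc b ((hS1 b).2 ⟨hbS, Or.inr hnb⟩)).2.ne
  · rw [hc1, hc2]
    rcases (hc e heS).2.cases (hc _ (W₁.mate_mem heS)).2 with ⟨q1, q2⟩ | ⟨q1, q2⟩
    · exact Or.inr ⟨q1.symm, q2.symm⟩
    · exact Or.inl ⟨q1.symm, q2.symm⟩

/-- Two distinct colours can be renamed to two given distinct colours. -/
theorem exists_perm_of_ne {a b a' b' : ℕ} (h : a ≠ b) (h' : a' ≠ b') :
    ∃ π : Equiv.Perm ℕ, π a = a' ∧ π b = b' := by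
  refine ⟨(Equiv.swap a a').trans (Equiv.swap (Equiv.swap a a' b) b'), ?_, by simp⟩
  have h1 : Equiv.swap a a' b ≠ a' := fun q => h ((Equiv.swap a a').injective
    (by rw [q, Equiv.swap_apply_left]))
  simp [Equiv.swap_apply_of_ne_of_ne h1.symm h']

/-- On each side the loose edges have two different colours, which are also the colours of the cell
kept on that side. One renaming of colours therefore matches the sides along both edges and at the
vertex of `e`. -/
theorem IsSplit.colourable [Fintype D] {K : D → Prop} {e h h' : D} (H : W.IsSplit K e h h')
    (hP : W.Planar) (hB : W.Bridgeless) (ih : W.SmallerColourable) : W.Colourable := by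
  classical
  obtain ⟨c₁, a1, a2, a3, a4⟩ := H.exists_side hP hB ih
  obtain ⟨c₂, b1, b2, b3, b4⟩ := H.symm.exists_side hP hB ih
  obtain ⟨hKh, hKτh⟩ := H.orientation hP hB
  obtain ⟨hKh', hKτh'⟩ := H.symm.orientation hP hB
  have hKτh' : K (W.τ h') := not_not.1 hKτh'
  obtain ⟨he, hh, hh', hme, F1, F2, Fr, n1, n2, n3, n4, kmate, kopp, kedge, Ke, Ko⟩ := H
  obtain ⟨π, p1, p2⟩ := exists_perm_of_ne b3 a3.symm
  have hKme : K (X.mate e) := (kmate e he).2 Ke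
  have hKmo : ¬ K (X.mate (X.opp e)) := fun q => Ko ((kmate _ (W.opp_mem he)).1 q)
  set c : D → ℕ := fun d => if K d then c₁ d else π (c₂ d) with hc
  have hτh := W.τ_τ hh
  have hτh' := W.τ_τ hh'
  refine ⟨c, fun d hd => ⟨?_, ?_⟩⟩
  · by_cases d1 : d = h
    · simp [hc, d1, hKh, hKτh, p2]
    by_cases d2 : d = W.τ h
    · simp [hc, d2, hKh, hKτh, p2, hτh]
    by_cases d3 : d = h'
    · simp [hc, d3, hKh', hKτh', p1]
    by_cases d4 : d = W.τ h'
    · simp [hc, d4, hKh', hKτh', p1, hτh']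
    have d5 := kedge d hd d1 d2 d3 d4
    by_cases hk : K d
    · simp [hc, d5, hk, a1 d hd hk d1 d4]
    · simp [hc, d5, hk, b1 d hd hk d3 d2]
  · by_cases hn : X.Near e d
    · have m1 := X.mate_mate e
      have m2 := X.opp_opp e
      have m3 := X.mate_opp e
      have m4 := X.mate_mate (X.opp e)
      have m5 := X.mate_opp (X.mate e)
      have m6 := X.opp_opp (X.mate e)
      have e1 : c e = c₁ e := if_pos Ke
      have e2 : c (X.mate e) = c₁ (X.mate e) := if_pos hKme
      have e3 : c (X.opp e) = π (c₂ (X.opp e)) := if_neg Ko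
      have e4 : c (X.mate (X.opp e)) = π (c₂ (X.mate (X.opp e))) := if_neg hKmo
      have e5 : π (c₂ (X.opp e)) = c₁ (W.τ h') ∧ π (c₂ (X.mate (X.opp e))) = c₁ h ∨
          π (c₂ (X.opp e)) = c₁ h ∧ π (c₂ (X.mate (X.opp e))) = c₁ (W.τ h') := by
        rcases b4 with ⟨q1, q2⟩ | ⟨q1, q2⟩
        · left; rw [q1, q2, p1, p2]; exact ⟨rfl, rfl⟩
        · right; rw [q1, q2, p1, p2]; exact ⟨rfl, rfl⟩
      rw [← e1, ← e2] at a4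
      rw [← e3, ← e4] at e5
      clear_value c
      rcases hn with rfl | rfl | rfl | rfl <;> constructor <;> grind
    · have kn : ∀ f, X.Near d f → (K f ↔ K d) := by
        intro f hf
        have := kmate d hd
        have := kopp d hd hn
        have := kmate _ (W.opp_mem hd)
        rcases hf with rfl | rfl | rfl | rfl <;> grind
      by_cases hk : K d
      · refine proper_congr (c' := c₁) (fun f hf => if_pos ((kn f hf).2 hk)) (a2 d hd hk hn)
      · obtain ⟨r1, r2⟩ := b2 d hd hk (by rwa [near_opp_left])
        refine proper_congr (c' := fun d => π (c₂ d))
          (fun f hf => if_neg (fun q => hk ((kn f hf).1 q))) ⟨fun q => r1 (π.injective q), ?_⟩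
        exact r2.imp (congrArg π) (congrArg π)

/-- The two faces at a vertex between its cells, if both adjacent to a further face along edges not
incident with the vertex, give a splitting. -/
theorem colourable_of_triangle [Fintype D] (hP : W.Planar) (hB : W.Bridgeless)
    (ih : W.SmallerColourable) {e h h' : D} (he : e ∈ W.S) (hh : h ∈ W.S) (hh' : h' ∈ W.S)
    (hme : X.mate e = X.rot e) (F1 : W.SameFace h e) (F2 : W.SameFace h' (X.opp e))
    (Fr : W.SameFace (X.rot h) (X.rot h')) (n1 : ¬ X.Near e h) (n2 : ¬ X.Near e (W.τ h))
    (n3 : ¬ X.Near e h') (n4 : ¬ X.Near e (W.τ h')) : W.Colourable := by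
  classical
  set T : D → Prop := fun d => d ≠ h ∧ d ≠ W.τ h ∧ d ≠ h' ∧ d ≠ W.τ h' with hT
  set O : D → Prop := fun d => ¬ X.Near e d with hO
  have hTτ : ∀ d ∈ W.S, T d → T (W.τ d) := by
    intro d hd hTd
    have := W.τ_τ hd
    have := W.τ_τ hh
    have := W.τ_τ hh'
    grind
  have hOc : ∀ d f, O d → X.Near d f → O f := fun d f h1 h2 h3 => h1 (h3.trans h2.symm)
  -- `K` is what can be reached from `e` without the two edges and without passing between the cells
  -- of `e`. If it reached the other cell, there would be an even set splitting the cells of `e` and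
  -- avoiding both edges; the three faces would then have one colour, although the two faces at `e`
  -- are separated by a split cell.
  refine IsSplit.colourable (K := W.Conn T O e) (e := e) (h := h) (h' := h')
    ⟨he, hh, hh', hme, F1, F2, Fr, n1, n2, n3, n4, ?_, ?_, ?_, .refl, ?_⟩ hP hB ih
  · exact fun d _ => ⟨fun q => by simpa [X.mate_mate] using q.mate, .mate⟩
  · exact fun d _ hn => ⟨fun q => by
      simpa [X.opp_opp] using q.opp (hOc d _ hn (X.near_opp d)), fun q => q.opp hn⟩
  · intro d hd d1 d2 d3 d4
    have hTd : T d := ⟨d1, d2, d3, d4⟩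
    exact ⟨fun q => by simpa [W.τ_τ hd] using q.edge (W.τ_mem hd) (hTτ d hd hTd),
      fun q => q.edge hd hTd⟩
  · intro hc
    obtain ⟨Z, z1, z2, z3⟩ := hc.exists_even hTτ hOc
    obtain ⟨φ, hφ⟩ := hP Z z1
    have q0 := z3 e he (fun q => q (.refl X e))
    rw [if_pos (.refl X e)] at q0
    have p1 := hφ h hh
    have p2 := hφ h' hh'
    have p3 := hφ.eq F1 hh
    have p4 := hφ.eq F2 hh'
    have p5 := hφ.eq Fr (W.rot_mem hh)
    have p6 := hφ e he
    have p7 := hφ _ (W.rot_mem he)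
    have r1 := z2 h hh (fun q => q.1 rfl)
    have r2 := z2 h' hh' (fun q => q.2.2.1 rfl)
    have : X.opp e = X.rot (X.rot e) := rfl
    grind

end Wiring

/-! ### Counting faces and corners -/

/-- Double counting along the fibres of a surjection. -/
theorem card_eq_mul_of_fibres {A Q : Type*} [Fintype A] [Fintype Q] [DecidableEq Q] {q : A → Q}
    (hq : Function.Surjective q) {k : ℕ}
    (hk : ∀ a, (Finset.univ.filter fun b => q b = q a).card = k) :
    Fintype.card A = k * Fintype.card Q := by
  rw [← Finset.card_univ, Finset.card_eq_sum_card_fiberwise (f := q) (t := Finset.univ) (by simp)]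
  rw [Finset.sum_congr rfl (g := fun _ => k)]
  · simp [mul_comm]
  · intro x _
    obtain ⟨a, rfl⟩ := hq x
    exact hk a

namespace Wiring

variable {D : Type*} {X : CellSystem D} {W : Wiring X}

variable (W) in
def edgeSetoid : Setoid W.S where
  r a b := (b : D) = a ∨ (b : D) = W.τ a
  iseqv := ⟨fun _ => Or.inl rfl, fun {a _} h => by have := W.τ_τ a.2; grind,
    fun {a _ _} h h' => by have := W.τ_τ a.2; grind⟩

variable (W) in
def vertexSetoid : Setoid W.S where
  r a b := X.Near a b
  iseqv := ⟨fun _ => .refl X _, fun h => h.symm, fun h h' => h.trans h'⟩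

variable (W) in
def faceSetoid : Setoid W.S where
  r a b := W.SameFace a b
  iseqv := ⟨fun _ => .refl _, fun h => h.symm, fun h h' => h.trans h'⟩

/-- The inequality `F > V` for a nonempty plane 4-regular graph. -/
theorem Planar.card_vertices_lt [Fintype D] (hP : W.Planar) (hS : W.S.Nonempty) :
    W.S.card < 4 * Nat.card (Quotient W.faceSetoid) := by
  classical
  have : Nonempty W.S := hS.to_subtype
  let _ : Fintype (Quotient W.edgeSetoid) := Fintype.ofFinite _
  let _ : Fintype (Quotient W.vertexSetoid) := Fintype.ofFinite _
  let _ : Fintype (Quotient W.faceSetoid) := Fintype.ofFinite _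
  have cE : Fintype.card W.S = 2 * Fintype.card (Quotient W.edgeSetoid) := by
    refine card_eq_mul_of_fibres (q := Quotient.mk W.edgeSetoid) Quotient.mk_surjective fun a => ?_
    have : (Finset.univ.filter fun b => Quotient.mk W.edgeSetoid b = Quotient.mk W.edgeSetoid a) =
        {a, ⟨W.τ a, W.τ_mem a.2⟩} := by
      ext b
      simp only [Finset.mem_filter, Finset.mem_univ, true_and, Finset.mem_insert,
        Finset.mem_singleton, Subtype.ext_iff]
      rw [eq_comm, Quotient.eq]
      rfl
    rw [this, Finset.card_pair]
    intro h
    exact W.τ_ne a.2 (Subtype.ext_iff.1 h).symm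
  have cV : Fintype.card W.S = 4 * Fintype.card (Quotient W.vertexSetoid) := by
    refine card_eq_mul_of_fibres (q := Quotient.mk W.vertexSetoid) Quotient.mk_surjective fun a => ?_
    have : (Finset.univ.filter fun b => Quotient.mk W.vertexSetoid b =
        Quotient.mk W.vertexSetoid a) = {a, ⟨X.mate a, W.mate_mem a.2⟩, ⟨X.opp a, W.opp_mem a.2⟩,
          ⟨X.mate (X.opp a), W.mate_mem (W.opp_mem a.2)⟩} := by
      ext b
      simp only [Finset.mem_filter, Finset.mem_univ, true_and, Finset.mem_insert,
        Finset.mem_singleton, Subtype.ext_iff]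
      rw [eq_comm, Quotient.eq]
      rfl
    rw [this, Finset.card_eq_of_equiv_fin]
    have h1 := X.mate_ne a
    have h2 := X.opp_ne a
    have h3 := X.mate_opp_ne a
    have h4 := X.mate_ne_opp a
    have h5 := X.mate_ne (X.opp a)
    have h6 : X.mate a ≠ X.mate (X.opp a) := fun h => h2 (by
      rw [← X.mate_mate (X.opp a), ← h, X.mate_mate])
    refine Finset.equivFinOfCardEq ?_
    rw [Finset.card_insert_of_notMem, Finset.card_insert_of_notMem, Finset.card_pair] <;>
      simp only [Finset.mem_insert, Finset.mem_singleton, Subtype.ext_iff, ne_eq] <;> grind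
  -- The kernel of `f` is the space of even sets, of dimension at least `E - V`, where `E = 2V`.
  -- Planarity places it in the range of the face boundary map `g`.
  let f : (Quotient W.edgeSetoid → ZMod 2) →ₗ[ZMod 2] (Quotient W.vertexSetoid → ZMod 2) :=
    { toFun := fun Z v => Quotient.lift (s := W.vertexSetoid) (fun a : W.S =>
        ∑ b : W.S, if X.Near a b then Z (Quotient.mk _ b) else 0) (by
          intro a b (h : X.Near a b)
          refine Finset.sum_congr rfl fun c _ => ?_
          have : X.Near a c ↔ X.Near b c := ⟨fun h' => h.symm.trans h', fun h' => h.trans h'⟩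
          simp only [this]) v
      map_add' := by
        intro Z Z'; ext v; induction v using Quotient.inductionOn with | _ a => ?_
        simp only [Quotient.lift_mk, Pi.add_apply, ← Finset.sum_add_distrib]
        exact Finset.sum_congr rfl fun c _ => by split_ifs <;> simp
      map_smul' := by
        intro r Z; ext v; induction v using Quotient.inductionOn with | _ a => ?_
        simp only [Quotient.lift_mk, Pi.smul_apply, smul_eq_mul, RingHom.id_apply, Finset.mul_sum]
        exact Finset.sum_congr rfl fun c _ => by split_ifs <;> simp }
  let r : W.S → W.S := fun a => ⟨X.rot a, W.rot_mem a.2⟩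
  let g : (Quotient W.faceSetoid → ZMod 2) →ₗ[ZMod 2] (W.S → ZMod 2) :=
    LinearMap.funLeft (ZMod 2) (ZMod 2) (Quotient.mk W.faceSetoid) +
      LinearMap.funLeft (ZMod 2) (ZMod 2) (fun a => Quotient.mk W.faceSetoid (r a))
  let i : (Quotient W.edgeSetoid → ZMod 2) →ₗ[ZMod 2] (W.S → ZMod 2) :=
    LinearMap.funLeft (ZMod 2) (ZMod 2) (Quotient.mk W.edgeSetoid)
  have hi : Function.Injective i := LinearMap.funLeft_injective_of_surjective _ _ _ Quotient.mk_surjective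
  have hsub : (LinearMap.ker f).map i ≤ LinearMap.range g := by
    rintro _ ⟨Z, hZ, rfl⟩
    set Z₀ : D → ZMod 2 := fun d => if h : d ∈ W.S then Z (Quotient.mk _ ⟨d, h⟩) else 0
    have hZ₀ : ∀ a : W.S, Z₀ a = Z (Quotient.mk _ a) := fun a => by simp [Z₀]
    have hE : W.Even Z₀ := by
      refine ⟨fun d hd => ?_, fun d hd => ?_⟩
      · have p1 := hZ₀ ⟨W.τ d, W.τ_mem hd⟩
        have p2 := hZ₀ ⟨d, hd⟩
        simp only at p1 p2
        rw [p1, p2]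
        congr 1
        exact Quotient.sound (Or.inr (W.τ_τ hd).symm)
      · have h0 := congrFun (LinearMap.mem_ker.1 hZ) (Quotient.mk _ ⟨d, hd⟩)
        change (∑ b : W.S, if X.Near d b then Z (Quotient.mk _ b) else 0) = 0 at h0
        have h1 : (∑ b : W.S, if X.Near d b then Z (Quotient.mk _ b) else 0) =
            ∑ b ∈ W.S, if X.Near d b then Z₀ b else 0 := by
          rw [← Finset.sum_coe_sort W.S]
          exact Finset.sum_congr rfl fun b _ => by rw [hZ₀]
        rw [h1, ← Finset.sum_filter] at h0
        have h2 : W.S.filter (X.Near d) = {d, X.mate d, X.opp d, X.mate (X.opp d)} := by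
          ext b
          simp only [Finset.mem_filter, Finset.mem_insert, Finset.mem_singleton]
          exact ⟨fun h => h.2, fun h => ⟨W.near_mem d hd b h, h⟩⟩
        have q1 := X.mate_ne d
        have q2 := X.opp_ne d
        have q3 := X.mate_opp_ne d
        have q4 := X.mate_ne_opp d
        have q5 := X.mate_ne (X.opp d)
        have q6 : X.mate d ≠ X.mate (X.opp d) := fun h => q2 (by
          rw [← X.mate_mate (X.opp d), ← h, X.mate_mate])
        rw [h2, Finset.sum_insert (by grind), Finset.sum_insert (by grind),
          Finset.sum_pair (by grind)] at h0
        rw [← h0]; ring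
    obtain ⟨φ, hφ⟩ := hP Z₀ hE
    refine ⟨fun F => Quotient.lift (s := W.faceSetoid) (fun a : W.S => φ a)
      (fun a b h => hφ.eq h a.2) F, ?_⟩
    ext a
    change φ a + φ (X.rot a) = Z (Quotient.mk _ a)
    rw [← hZ₀, (hφ a a.2).1]
    grind
  have d1 := LinearMap.finrank_range_add_finrank_ker f
  have d2 := LinearMap.finrank_range_add_finrank_ker g
  have d3 := Submodule.finrank_mono hsub
  rw [← (Submodule.equivMapOfInjective i hi _).finrank_eq] at d3
  have d4 := Submodule.finrank_le (LinearMap.range f)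
  -- The set of all faces has empty boundary, so the range of `g` has dimension at most `F - 1`.
  -- This makes the inequality strict.
  have d5 : 0 < Module.finrank (ZMod 2) (LinearMap.ker g) := by
    have : (1 : Quotient W.faceSetoid → ZMod 2) ∈ LinearMap.ker g := by
      rw [LinearMap.mem_ker]
      ext a
      change (1 : ZMod 2) + 1 = 0
      decide
    rw [Module.finrank_pos_iff]
    refine ⟨⟨⟨1, this⟩, 0, fun h => ?_⟩⟩
    have h1 := congrFun (Subtype.ext_iff.1 h) (Quotient.mk _ (Classical.arbitrary W.S))
    exact one_ne_zero h1
  rw [Module.finrank_fintype_fun_eq_card] at d1 d2 d4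
  rw [Nat.card_eq_fintype_card]
  rw [Fintype.card_coe] at cE cV
  omega

/-- Some face has at most one corner that lies inside a cell. -/
theorem Planar.exists_face [Fintype D] (hP : W.Planar) (hS : W.S.Nonempty) :
    ∃ d₀ ∈ W.S, ∀ a b, W.SameFace d₀ a → W.SameFace d₀ b → X.mate a = X.rot (X.rot (X.rot a)) →
      X.mate b = X.rot (X.rot (X.rot b)) → a = b := by
  classical
  by_contra! hcon
  have h1 := hP.card_vertices_lt hS
  let _ : Fintype (Quotient W.faceSetoid) := Fintype.ofFinite _
  rw [Nat.card_eq_fintype_card] at h1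
  -- The corners inside cells. Each cell has exactly one, because `X.mate` exchanges the darts of
  -- `C` with the others; so there are `2V` of them, too few for two on every face.
  set C : Finset W.S := Finset.univ.filter fun a : W.S => X.mate (a : D) = X.rot (X.rot (X.rot a))
  have hC : 2 * C.card = W.S.card := by
    have h2 : C.card = Cᶜ.card := by
      refine Finset.card_bij' (fun a _ => ⟨X.mate a, W.mate_mem a.2⟩)
        (fun a _ => ⟨X.mate a, W.mate_mem a.2⟩) ?_ ?_ ?_ ?_
      · intro a ha
        have q : X.mate (a : D) = X.rot (X.rot (X.rot a)) := by simpa [C] using ha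
        have q2 := X.mate_mate a
        have q3 := X.rot_four a
        have q4 := X.rot_two_ne a
        simp only [C, Finset.mem_compl, Finset.mem_filter, Finset.mem_univ, true_and]
        grind
      · intro a ha
        have q : ¬ X.mate (a : D) = X.rot (X.rot (X.rot a)) := by simpa [C] using ha
        have q1 := (X.consecutive a).resolve_right q
        have q2 := X.mate_mate a
        have q3 := X.rot_four a
        simp only [C, Finset.mem_filter, Finset.mem_univ, true_and]
        grind
      · intro a _; exact Subtype.ext (X.mate_mate a)
      · intro a _; exact Subtype.ext (X.mate_mate a)
    have h3 := Finset.card_add_card_compl C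
    rw [← h2, Fintype.card_coe] at h3
    omega
  have h2 : 2 * Fintype.card (Quotient W.faceSetoid) ≤ C.card := by
    rw [Finset.card_eq_sum_card_fiberwise (f := Quotient.mk W.faceSetoid) (t := Finset.univ)
      (by simp), mul_comm, ← smul_eq_mul, ← Finset.card_univ]
    refine Finset.card_nsmul_le_sum _ _ _ fun F _ => ?_
    induction F using Quotient.inductionOn with | _ d => ?_
    obtain ⟨a, b, ha, hb, ha', hb', hne⟩ := hcon d d.2
    have haS := SameFace.mem ha d.2
    have hbS := SameFace.mem hb d.2
    rw [← Finset.card_pair (a := (⟨a, haS⟩ : W.S)) (b := ⟨b, hbS⟩) (fun h => hne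
      (Subtype.ext_iff.1 h))]
    refine Finset.card_le_card fun x hx => ?_
    rw [Finset.mem_insert, Finset.mem_singleton] at hx
    rcases hx with rfl | rfl
    · simp only [C, Finset.mem_filter, Finset.mem_univ, true_and]
      exact ⟨ha', Quotient.sound ha.symm⟩
    · simp only [C, Finset.mem_filter, Finset.mem_univ, true_and]
      exact ⟨hb', Quotient.sound hb.symm⟩
  omega

end Wiring

/-! ### Deleting the boundary of a face -/

namespace Wiring

variable {D : Type*} {X : CellSystem D} {W : Wiring X}

theorem Even.rot_of_mate {Z : D → ZMod 2} (h : W.Even Z) {d e : D} (hd : d ∈ W.S)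
    (hn : X.Near d e) (he : X.mate e = X.rot e) :
    Z d + Z (X.mate d) = Z e + Z (X.rot e) := by
  rw [← he, h.add_mate hd hn]

theorem exists_near_mate_eq_rot (X : CellSystem D) (d : D) : ∃ e, X.Near d e ∧ X.mate e = X.rot e := by
  rcases X.consecutive d with h | h
  · exact ⟨d, .refl X d, h⟩
  · exact ⟨X.mate d, X.near_mate d, by rw [X.mate_mate, h, X.rot_four]⟩

/-- A face with at most one corner inside a cell passes every vertex at most once. -/
theorem Planar.face_corner_unique [Finite D] (hP : W.Planar) (hB : W.Bridgeless) {d₀ : D}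
    (hd₀ : d₀ ∈ W.S)
    (hk : ∀ a b, W.SameFace d₀ a → W.SameFace d₀ b → X.mate a = X.rot (X.rot (X.rot a)) →
      X.mate b = X.rot (X.rot (X.rot b)) → a = b) {a b : D} (ha : W.SameFace d₀ a)
    (hb : W.SameFace d₀ b) (hn : X.Near a b) : b = a := by
  have haS := ha.mem hd₀
  have hab := ha.symm.trans hb
  rcases X.near_iff_rot.1 hn with h | h | h | h
  · exact h
  · exact absurd (h ▸ hab) (hP.not_sameFace_rot haS)
  · rcases X.consecutive a with h' | h'
    · exact absurd ((show b = X.opp a from h) ▸ hab) (hP.not_sameFace_opp hB haS h')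
    · refine (hk a b ha hb h' ?_).symm
      have := X.mate_opp a
      rw [h, show X.rot (X.rot a) = X.opp a from rfl, this, h']
      rfl
  · have := hP.not_sameFace_rot (hb.mem hd₀)
    rw [h, X.rot_four] at this
    exact absurd (h ▸ hab.symm) this

/-- Deletion of the boundary of a face with at most one corner inside a cell. -/
theorem exists_facial_colouring [Fintype D] [DecidableEq D] (hP : W.Planar) (hB : W.Bridgeless)
    (ih : W.SmallerColourable) {d₀ : D} (hd₀ : d₀ ∈ W.S)
    (hk : ∀ a b, W.SameFace d₀ a → W.SameFace d₀ b → X.mate a = X.rot (X.rot (X.rot a)) →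
      X.mate b = X.rot (X.rot (X.rot b)) → a = b) :
    W.Colourable ∨ ∃ c : D → ℕ, (∀ d ∈ W.S, c (W.τ d) = c d) ∧
      (∀ d ∈ W.S, c d = c d₀ ↔ W.SameFace d₀ d ∨ W.SameFace d₀ (X.rot d)) ∧
      (∀ d ∈ W.S, (∀ r, W.SameFace d₀ r → X.Near d r → X.mate r = X.rot r) → Proper X c d) ∧
      ∀ r, W.SameFace d₀ r → c (X.rot r) = c (X.rot (X.rot r)) := by
  classical
  have huniq := fun {a b : D} => hP.face_corner_unique hB hd₀ hk (a := a) (b := b)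
  set R : D → Prop := fun d => W.SameFace d₀ d with hR
  have hRS : ∀ d, R d → d ∈ W.S := fun d h => SameFace.mem h hd₀
  have hRτ : ∀ d ∈ W.S, R (X.rot d) → R (W.τ d) := fun d hd h => h.trans (sameFace_rot_τ hd)
  have hRτ' : ∀ d ∈ W.S, R d → R (X.rot (W.τ d)) := fun d hd h => h.trans (sameFace_τ_rot hd).symm
  have h4 := X.rot_four
  have hRrot : ∀ d, R d → ¬ R (X.rot d) := fun d h h' => X.rot_ne d (huniq h h' (X.near_rot d))
  have hRrot2 : ∀ d, R d → ¬ R (X.rot (X.rot d)) := fun d h h' =>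
    X.rot_two_ne d (huniq h h' (X.near_rot d).rot)
  have hRrot3 : ∀ d, R d → ¬ R (X.rot (X.rot (X.rot d))) := fun d h h' =>
    X.rot_three_ne d (huniq h h' (X.near_rot d).rot.rot)
  set V : Finset D := W.S.filter fun d => ∃ r, R r ∧ X.Near d r with hV
  set K : Finset D := W.S.filter fun d => R d ∨ R (X.rot d) with hK
  have hVm : ∀ d, d ∈ V ↔ R d ∨ R (X.rot d) ∨ R (X.rot (X.rot d)) ∨
      R (X.rot (X.rot (X.rot d))) := by
    intro d
    rw [hV, Finset.mem_filter]
    constructor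
    · rintro ⟨-, r, hr, hn⟩
      rcases X.near_iff_rot.1 hn with rfl | rfl | rfl | rfl <;> tauto
    · intro h
      have aux : ∀ r, R r → X.Near d r → d ∈ W.S ∧ ∃ r, R r ∧ X.Near d r := fun r hr hn =>
        ⟨W.near_mem r (hRS r hr) d hn.symm, r, hr, hn⟩
      rcases h with h | h | h | h
      exacts [aux _ h (.refl X d), aux _ h (X.near_rot d), aux _ h (X.near_rot d).rot,
        aux _ h (X.near_rot d).rot.rot]
  have hKm : ∀ d, d ∈ K ↔ R d ∨ R (X.rot d) := by
    intro d
    rw [hK, Finset.mem_filter, and_iff_right_iff_imp]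
    rintro (h | h)
    · exact hRS d h
    · exact W.near_mem _ (hRS _ h) d (X.near_rot d).symm
  have hVS : V ⊆ W.S := Finset.filter_subset _ _
  have hVc : ∀ d ∈ V, ∀ e, X.Near d e → e ∈ V := by
    intro d hd e he
    rw [hV, Finset.mem_filter] at hd ⊢
    obtain ⟨h1, r, h2, h3⟩ := hd
    exact ⟨W.near_mem d h1 e he, r, h2, he.symm.trans h3⟩
  have hKV : K ⊆ V := fun d hd => by rw [hVm]; rw [hKm] at hd; tauto
  have hKτ : ∀ d ∈ K, W.τ d ∈ K := by
    intro d hd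
    have hdS := hVS (hKV hd)
    rw [hKm] at hd ⊢
    exact hd.elim (fun h => Or.inr (hRτ' d hdS h)) (fun h => Or.inl (hRτ d hdS h))
  -- At a vertex of the face the two boundary darts form one pair, the two remaining darts the
  -- other. Both pairs are consecutive, so nothing crosses.
  set θ : D → D := fun d => if R d then X.rot (X.rot (X.rot d)) else if R (X.rot d) then X.rot d
    else if R (X.rot (X.rot (X.rot d))) then X.rot d else X.rot (X.rot (X.rot d)) with hθdef
  have hθ : IsMatching V θ := by
    intro d hd
    have q1 := X.rot_ne d
    have q2 := X.rot_three_ne d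
    have q3 := h4 d
    have q4 : X.rot (X.rot (X.rot (X.rot (X.rot d)))) = X.rot d := h4 _
    have q5 := hRrot d
    have q6 := hRrot2 d
    have q7 := hRrot3 d
    have q8 := hRrot (X.rot d)
    have q9 := hRrot2 (X.rot d)
    have q10 := hRrot (X.rot (X.rot d))
    rw [hVm] at hd
    rw [hVm]
    simp only [hθdef]
    rcases hd with hd | hd | hd | hd <;> grind
  have hθK : ∀ d ∈ K, θ d ∈ K := by
    intro d hd
    have q3 := h4 d
    have q5 := hRrot d
    rw [hKm] at hd
    rw [hKm]
    simp only [hθdef]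
    rcases hd with hd | hd <;> grind
  have hθn : ∀ d ∈ V, X.Near d (θ d) := by
    intro d _
    simp only [hθdef]
    split_ifs
    exacts [(X.near_rot d).rot.rot, X.near_rot d, X.near_rot d, (X.near_rot d).rot.rot]
  have hcross : ∀ d ∈ V, d ∉ K → θ d = X.opp d → X.rot d ∈ K := by
    intro d _ _ h
    exfalso
    have q1 : X.rot d ≠ X.opp d := fun h => X.rot_ne (X.rot d) h.symm
    have q2 : X.rot (X.rot (X.rot d)) ≠ X.opp d := X.rot_ne _
    simp only [hθdef] at h
    split_ifs at h <;> tauto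
  obtain ⟨W', hS', hP', hE', hC'⟩ := W.exists_reduction hVS hVc hKV hKτ hθ hθK hθn hcross
  -- `N x` says that the face of `x` shares an edge with the chosen face.
  set N : D → Prop := fun x => ∃ h ∈ W.S, R (X.rot h) ∧ W.SameFace h x with hN
  by_cases htri : ∃ e ∈ W.S, e ∉ V ∧ X.mate e = X.rot e ∧ N e ∧ N (X.opp e)
  · obtain ⟨e, he, heV, hme, ⟨h, hh, hr, hf⟩, h', hh', hr', hf'⟩ := htri
    have hnot : ∀ r, R r → ∀ d, X.Near r d → ¬ X.Near e d := fun r hr d hrd hed =>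
      heV (by rw [hV, Finset.mem_filter]; exact ⟨he, r, hr, hed.trans hrd.symm⟩)
    left
    exact colourable_of_triangle hP hB ih he hh hh' hme hf hf' (hr.symm.trans hr')
      (hnot _ hr _ (X.near_rot h).symm) (hnot _ (hRτ h hh hr) _ (.refl X _))
      (hnot _ hr' _ (X.near_rot h').symm) (hnot _ (hRτ h' hh' hr') _ (.refl X _))
  right
  have hB' : W'.Bridgeless := by
    -- The boundary of the face of `e` splits the cell of `e`. As this face shares no edge with the
    -- chosen one, its boundary vanishes on `K`, and by parity the two darts left at each removed
    -- vertex agree.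
    have main : ∀ e ∈ W.S, e ∉ V → X.mate e = X.rot e → ¬ N e →
        ∃ Z, W.Even Z ∧ W'.Even Z ∧ Z e + Z (X.rot e) = 1 := by
      intro e he heV hme hNe
      set φ : D → ZMod 2 := fun d => if W.SameFace e d then 1 else 0 with hφdef
      have hφ : ∀ x y, W.SameFace x y → φ x = φ y := fun x y q => by
        have : W.SameFace e x ↔ W.SameFace e y := ⟨fun r => r.trans q, fun r => r.trans q.symm⟩
        simp only [hφdef, this]
      have hb := (even_boundary hφ).1
      set Z : D → ZMod 2 := fun d => φ d + φ (X.rot d) with hZdef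
      have hZK : ∀ d ∈ K, Z d = 0 := by
        intro d hd
        have hdS := hVS (hKV hd)
        rw [hKm] at hd
        have heR : ¬ R e := fun h => heV ((hVm e).2 (Or.inl h))
        have key : ¬ W.SameFace e d ∧ ¬ W.SameFace e (X.rot d) := by
          rcases hd with hd | hd
          · refine ⟨fun q => heR (hd.trans q.symm), fun q => hNe ?_⟩
            exact ⟨W.τ d, W.τ_mem hdS, hRτ' d hdS hd, (sameFace_rot_τ hdS).symm.trans q.symm⟩
          · exact ⟨fun q => hNe ⟨d, hdS, hd, q.symm⟩, fun q => heR (hd.trans q.symm)⟩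
        simp [hZdef, hφdef, key.1, key.2]
      refine ⟨Z, hb, hE' Z hb fun d hd hdK => ?_, ?_⟩
      · have q1 := hZK d
        have q2 := hZK (X.rot d)
        have q3 := hZK (X.rot (X.rot d))
        have q4 := hZK (X.rot (X.rot (X.rot d)))
        have q5 := hb.rot (hVS hd)
        have q6 := h4 d
        rw [hKm] at hdK q1 q2 q3 q4
        rw [hVm] at hd
        clear_value Z
        simp only [hθdef]
        rcases hd with hd | hd | hd | hd <;> grind
      · have q1 : ¬ W.SameFace e (X.rot (X.rot e)) := hP.not_sameFace_opp hB he hme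
        have q2 : φ e = 1 := if_pos (.refl e)
        have q3 : φ (X.rot (X.rot e)) = 0 := if_neg q1
        simp only [hZdef, q2, q3]
        grind
    intro f hf
    have hf' : f ∈ W.S \ V := hS' ▸ hf
    rw [Finset.mem_sdiff] at hf'
    obtain ⟨e, hfe, hme⟩ := exists_near_mate_eq_rot X f
    have he := W.near_mem f hf'.1 e hfe
    have heV : e ∉ V := fun h => hf'.2 (hVc e h f hfe.symm)
    by_cases hNe : N e
    · have hNo : ¬ N (X.opp e) := fun h => htri ⟨e, he, heV, hme, hNe, h⟩
      obtain ⟨Z, z0, z1, z2⟩ := main (X.opp e) (W.opp_mem he)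
        (fun h => heV (hVc _ h e (X.near_opp e).symm)) (mate_opp_of_mate hme) hNo
      exact ⟨Z, z1, by rw [z0.rot_of_mate hf'.1 hfe.opp (mate_opp_of_mate hme), z2]⟩
    · obtain ⟨Z, z0, z1, z2⟩ := main e he heV hme hNe
      exact ⟨Z, z1, by rw [z0.rot_of_mate hf'.1 hfe hme, z2]⟩
  have hd₀V : d₀ ∈ V := (hVm d₀).2 (Or.inl (.refl d₀))
  have hd₀K : d₀ ∈ K := (hKm d₀).2 (Or.inl (.refl d₀))
  obtain ⟨c', hc'⟩ := ih W' (by rw [hS']; exact card_sdiff_lt hVS hd₀V) (hP' hP) hB'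
  obtain ⟨c₁, k1, k2, k3⟩ := hC' ℕ c' (fun d hd => (hc' d hd).1)
  -- The face boundary receives the fresh colour 0; the shift keeps it fresh.
  set c : D → ℕ := fun d => if d ∈ K then 0 else c₁ d + 1 with hc
  have hθ1 : ∀ r, R r → c (X.rot r) = c (X.rot (X.rot r)) := by
    intro r hr
    have q0 : X.rot r ∈ V := hVc r ((hVm r).2 (Or.inl hr)) _ (X.near_rot r)
    have q2 : X.rot r ∉ K := by rw [hKm]; exact not_or.2 ⟨hRrot r hr, hRrot2 r hr⟩
    have q3 : X.rot (X.rot r) ∉ K := by rw [hKm]; exact not_or.2 ⟨hRrot2 r hr, hRrot3 r hr⟩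
    have q4 := k2 _ q0 q2
    have q5 : θ (X.rot r) = X.rot (X.rot r) := by
      simp only [hθdef, hRrot r hr, hRrot2 r hr, h4, hr, if_false, if_true]
    rw [q5] at q4
    simp [hc, q2, q3, q4]
  have hcin : ∀ r, R r → c r = 0 := fun r hr => if_pos ((hKm r).2 (Or.inl hr))
  have hcout : ∀ r, R r → c (X.rot (X.rot (X.rot r))) = 0 := fun r hr =>
    if_pos ((hKm _).2 (Or.inr (by rwa [h4])))
  refine ⟨c, ?_, ?_, ?_, hθ1⟩
  · intro d hd
    have q1 := k1 d hd
    have q2 := hKτ d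
    have q3 := hKτ (W.τ d)
    rw [W.τ_τ hd] at q3
    grind
  · intro d hd
    rw [hcin d₀ (.refl d₀)]
    have := hKm d
    grind
  · intro d hd hnc
    by_cases hdV : d ∈ V
    · obtain ⟨-, r, hr, hn⟩ := Finset.mem_filter.1 hdV
      have hm := hnc r hr hn
      have q1 := hcin r hr
      have q2 := hcout r hr
      have q3 := hθ1 r hr
      have q4 : c (X.rot r) ≠ 0 := by
        have : X.rot r ∉ K := by rw [hKm]; exact not_or.2 ⟨hRrot r hr, hRrot2 r hr⟩
        simp [hc, this]
      have q5 : X.mate (X.opp r) = X.rot (X.rot (X.rot r)) := by rw [mate_opp_of_mate hm]; rfl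
      have q6 : X.opp r = X.rot (X.rot r) := rfl
      have m1 := X.mate_mate r
      have m2 := X.opp_opp r
      have m3 := X.mate_opp r
      have m4 := X.mate_mate (X.opp r)
      have m5 := X.mate_opp (X.mate r)
      have m6 := X.opp_opp (X.mate r)
      rw [← q6] at q3
      rw [← q5] at q2
      rw [← hm] at q3 q4
      clear_value c
      rcases hn.symm with rfl | rfl | rfl | rfl <;> constructor <;> grind
    · have hdS' : d ∈ W'.S := by rw [hS']; exact Finset.mem_sdiff.2 ⟨hd, hdV⟩
      obtain ⟨p1, p2⟩ := (hc' d hdS').2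
      refine proper_congr (c' := fun d => c' d + 1) (fun e he => ?_) ⟨by simpa using p1, by simpa using p2⟩
      have heV : e ∉ V := fun h => hdV (hVc e h d he.symm)
      have heK : e ∉ K := fun h => heV (hKV h)
      simp [hc, heK, k3 e heV]

end Wiring

/-! ### Almost colourings and their circuits -/

namespace Wiring

variable {D : Type*} {X : CellSystem D} {W : Wiring X}

theorem sum_eq_zero_of_edge {Z : D → ZMod 2} {K : Finset D} (hK : K ⊆ W.S)
    (hKτ : ∀ d ∈ K, W.τ d ∈ K) (hZ : ∀ d ∈ W.S, Z (W.τ d) = Z d) : ∑ d ∈ K, Z d = 0 :=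
  Finset.sum_involution (fun d _ => W.τ d) (fun d hd => by rw [hZ d (hK hd)]; grind)
    (fun d hd _ => W.τ_ne (hK hd)) (fun d hd => hKτ d hd) (fun d hd => W.τ_τ (hK hd))

theorem Even.sum_eq_zero {Z : D → ZMod 2} (hZ : W.Even Z) {K : Finset D} (hK : K ⊆ W.S)
    (hKn : ∀ d ∈ K, ∀ e, X.Near d e → e ∈ K) : ∑ d ∈ K, Z d = 0 := by
  classical
  rw [← Finset.sum_filter_add_sum_filter_not K (fun d => X.mate d = X.rot d)]
  have h1 : ∑ d ∈ K.filter (fun d => ¬ X.mate d = X.rot d), Z d =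
      ∑ d ∈ K.filter (fun d => X.mate d = X.rot d), Z (X.mate d) := by
    refine Finset.sum_bij' (fun d _ => X.mate d) (fun d _ => X.mate d) ?_ ?_
      (fun d _ => X.mate_mate d) (fun d _ => X.mate_mate d) (fun d _ => by rw [X.mate_mate])
    · intro d hd
      rw [Finset.mem_filter] at hd ⊢
      refine ⟨hKn d hd.1 _ (X.near_mate d), ?_⟩
      rw [X.mate_mate, (X.consecutive d).resolve_left hd.2, X.rot_four]
    · intro d hd
      rw [Finset.mem_filter] at hd ⊢
      refine ⟨hKn d hd.1 _ (X.near_mate d), ?_⟩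
      rw [X.mate_mate, hd.2]
      exact fun h => X.rot_two_ne d h.symm
  rw [h1, ← Finset.sum_add_distrib]
  refine Finset.sum_involution (fun d _ => X.opp d) ?_ (fun d _ _ => X.opp_ne d) ?_
    (fun d _ => X.opp_opp d)
  · intro d hd
    have := hZ.vertex d (hK (Finset.mem_filter.1 hd).1)
    rw [← this]; ring
  · intro d hd
    rw [Finset.mem_filter] at hd ⊢
    exact ⟨hKn d hd.1 _ (X.near_opp d), mate_opp_of_mate hd.2⟩

/-- Suppose the darts reached from `x` do not meet the other cell. They form a union of edges, and
apart from the cell of `x` a union of vertices. Summing an even set over them in both ways shows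
that it does not split the cell of `x`. -/
theorem Bridgeless.conn (hB : W.Bridgeless) {x : D} (hx : x ∈ W.S) :
    W.Conn (fun _ => True) (fun d => ¬ X.Near x d) x (X.opp x) := by
  classical
  by_contra hcon
  obtain ⟨Z, z1, z2⟩ := hB x hx
  set C : D → Prop := W.Conn (fun _ => True) (fun d => ¬ X.Near x d) x with hC
  have hCm : ∀ d, C (X.mate d) → C d := fun d h => by simpa [X.mate_mate] using Conn.mate h
  set K := W.S.filter C with hK
  have hKS : K ⊆ W.S := Finset.filter_subset _ _
  have h1 : ∑ d ∈ K, Z d = 0 := by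
    refine sum_eq_zero_of_edge hKS (fun d hd => ?_) z1.edge
    rw [hK, Finset.mem_filter] at hd ⊢
    exact ⟨W.τ_mem hd.1, Conn.edge hd.2 hd.1 trivial⟩
  have hxK : x ∈ K := by simp [hK, hx, hC, Conn.refl]
  have hmK : X.mate x ∈ K := by
    rw [hK, Finset.mem_filter]; exact ⟨W.mate_mem hx, Conn.mate .refl⟩
  have h2 : ∑ d ∈ (K.erase x).erase (X.mate x), Z d = 0 := by
    refine z1.sum_eq_zero (fun d hd => hKS (Finset.mem_of_mem_erase (Finset.mem_of_mem_erase hd))) ?_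
    intro d hd e he
    simp only [Finset.mem_erase, hK, Finset.mem_filter] at hd ⊢
    obtain ⟨d1, d2, d3, d4⟩ := hd
    have hn : ¬ X.Near x d := by
      rintro (h | h | h | h)
      · exact d2 h
      · exact d1 h
      · exact hcon (h ▸ d4)
      · exact hcon (hCm _ (h ▸ d4))
    have hne : ¬ X.Near x e := fun h => hn (h.trans he.symm)
    refine ⟨fun h => hne (h ▸ X.near_mate x), fun h => hne (h ▸ .refl X x), W.near_mem d d3 e he, ?_⟩
    rcases he with rfl | rfl | rfl | rfl
    exacts [d4, d4.mate, d4.opp hn, (d4.opp hn).mate]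
  rw [← Finset.add_sum_erase K Z hxK,
    ← Finset.add_sum_erase (K.erase x) Z (Finset.mem_erase.2 ⟨X.mate_ne x, hmK⟩), h2] at h1
  rw [add_zero, z2] at h1
  exact one_ne_zero h1

open Classical in
/-- The other dart of the same colour at a vertex. -/
noncomputable def partner (X : CellSystem D) (c : D → ℕ) (d : D) : D :=
  if c (X.opp d) = c d then X.opp d else X.mate (X.opp d)

/-- Each colour at a proper vertex occurs once in either cell. Hence the continuation along a colour
is a fixed-point-free involution that changes cells. -/
theorem Proper.partner_spec {c : D → ℕ} {d : D} (hd : Proper X c d) (hd' : Proper X c (X.mate d)) :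
    (X.Near d (partner X c d) ∧ partner X c (partner X c d) = d ∧ partner X c d ≠ d ∧
      c (partner X c d) = c d) ∧
    (∀ e, X.Near d e → (c e = c d ↔ e = d ∨ e = partner X c d)) ∧
    (partner X c d = X.opp d ∨ partner X c d = X.mate (X.opp d)) := by
  have q0 := hd.ne
  have q := hd.cases hd'
  have m1 := X.mate_mate d
  have m2 := X.opp_opp d
  have m4 := X.mate_mate (X.opp d)
  have e1 := X.opp_ne d
  have e2 := X.mate_opp_ne d
  have e3 := X.mate_ne_opp d
  have e4 : X.mate d ≠ X.mate (X.opp d) := fun h => e1 (by rw [← m4, ← h, m1])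
  have f0 : partner X c d = if c (X.opp d) = c d then X.opp d else X.mate (X.opp d) := rfl
  have f1 : partner X c (X.opp d) = if c d = c (X.opp d) then d else X.mate d := by
    simp only [partner, m2]
  have f2 : partner X c (X.mate (X.opp d)) =
      if c (X.mate d) = c (X.mate (X.opp d)) then X.mate d else d := by
    have : X.opp (X.mate (X.opp d)) = X.mate d := by rw [← X.mate_opp, X.opp_opp]
    simp only [partner, this, m1]
  rcases q with ⟨q1, q2⟩ | ⟨q1, q2⟩
  · rw [if_pos q1] at f0
    rw [if_pos q1.symm] at f1
    refine ⟨⟨f0 ▸ X.near_opp d, by rw [f0, f1], f0 ▸ e1, by rw [f0, q1]⟩, ?_, Or.inl f0⟩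
    rintro e (rfl | rfl | rfl | rfl)
    · simp
    · simp only [q0, f0, X.mate_ne, e3, or_self]
    · simp [f0, q1]
    · simp only [q2, q0, f0, e2, X.mate_ne, or_self]
  · have q3 : c (X.opp d) ≠ c d := by rw [q2]; exact q0
    have q4 : c (X.mate d) ≠ c (X.mate (X.opp d)) := by rw [q1]; exact q0
    rw [if_neg q3] at f0
    rw [if_neg q4] at f2
    refine ⟨⟨f0 ▸ (X.near_opp d).mate, by rw [f0, f2], f0 ▸ e2, by rw [f0, q1]⟩, ?_, Or.inr f0⟩
    rintro e (rfl | rfl | rfl | rfl)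
    · simp
    · simp only [q0, f0, X.mate_ne, e4, or_self]
    · simp only [q3, f0, e1, (X.mate_ne _).symm, or_self]
    · simp [f0, q1]

variable (W) in
/-- A colouring of the graph obtained by separating the two cells at the vertex of `x`. -/
structure AlmostColouring (x : D) (c : D → ℕ) : Prop where
  edge : ∀ d ∈ W.S, c (W.τ d) = c d
  proper : ∀ d ∈ W.S, ¬ X.Near x d → Proper X c d
  cell : ∀ d, X.Near x d → c (X.mate d) = c d

variable (W) in
/-- Connection along a circuit of an almost colouring. -/
inductive Circ (x : D) (c : D → ℕ) (a : D) : D → Prop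
  | refl : Circ x c a a
  | edge {d : D} : Circ x c a d → d ∈ W.S → Circ x c a (W.τ d)
  | turn {d e : D} : Circ x c a d → d ∈ W.S → ¬ X.Near x d → X.Near d e → c e = c d → Circ x c a e
  | cell {d : D} : Circ x c a d → X.Near x d → Circ x c a (X.mate d)

theorem Circ.trans {x : D} {c : D → ℕ} {a b d : D} (h : W.Circ x c a b) (h' : W.Circ x c b d) :
    W.Circ x c a d := by
  induction h' with
  | refl => exact h
  | edge _ h1 ih => exact ih.edge h1
  | turn _ h1 h2 h3 h4 ih => exact ih.turn h1 h2 h3 h4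
  | cell _ h1 ih => exact ih.cell h1

theorem Circ.symm {x : D} {c : D → ℕ} {a b : D} (h : W.Circ x c a b) : W.Circ x c b a := by
  induction h with
  | refl => exact .refl
  | @edge d _ h1 ih =>
    have := (Circ.refl (W := W) (x := x) (c := c) (a := W.τ d)).edge (W.τ_mem h1)
    rw [W.τ_τ h1] at this
    exact this.trans ih
  | @turn d e _ h1 h2 h3 h4 ih =>
    exact (Circ.refl.turn (W.near_mem d h1 e h3) (fun h => h2 (h.trans h3.symm)) h3.symm h4.symm).trans ih
  | @cell d _ h1 ih =>
    have := (Circ.refl (W := W) (x := x) (c := c) (a := X.mate d)).cell h1.mate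
    rw [X.mate_mate] at this
    exact this.trans ih

theorem Circ.mem {x : D} {c : D → ℕ} {a b : D} (h : W.Circ x c a b) (ha : a ∈ W.S) : b ∈ W.S := by
  induction h with
  | refl => exact ha
  | edge _ h1 _ => exact W.τ_mem h1
  | turn _ h1 _ h3 _ _ => exact W.near_mem _ h1 _ h3
  | cell _ _ ih => exact W.mate_mem ih

namespace AlmostColouring

variable {x : D} {c : D → ℕ}

theorem circ_eq (hc : W.AlmostColouring x c) {a b : D} (h : W.Circ x c a b) : c b = c a := by
  induction h with
  | refl => rfl
  | edge _ h1 ih => rw [hc.edge _ h1, ih]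
  | turn _ _ _ _ h4 ih => rw [h4, ih]
  | cell _ h1 ih => rw [hc.cell _ h1, ih]

/-- A circuit is a walk through darts of its colour. -/
theorem conn_of_circ (hc : W.AlmostColouring x c) {a b : D} (h : W.Circ x c a b)
    {T : D → Prop} (hT : ∀ d ∈ W.S, c d = c a → T d) :
    W.Conn T (fun d => ¬ X.Near x d) a b := by
  induction h with
  | refl => exact .refl
  | @edge d h0 h1 ih => exact ih.edge h1 (hT d h1 (hc.circ_eq h0))
  | @turn d e _ h1 h2 h3 h4 ih =>
    rcases h3 with rfl | rfl | rfl | rfl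
    exacts [ih, ih.mate, ih.opp h2, (ih.opp h2).mate]
  | cell _ _ ih => exact ih.mate

/-- The other dart of the same circuit at a vertex. -/
theorem exists_partner (hc : W.AlmostColouring x c) : ∃ θ : D → D,
    (∀ d ∈ W.S, X.Near d (θ d) ∧ θ (θ d) = d ∧ θ d ≠ d ∧ c (θ d) = c d) ∧
    (∀ d, X.Near x d → θ d = X.mate d) ∧
    (∀ d ∈ W.S, ¬ X.Near x d → ∀ e, X.Near d e → (c e = c d ↔ e = d ∨ e = θ d)) ∧
    (∀ d ∈ W.S, ¬ X.Near x d → θ d = X.opp d ∨ θ d = X.mate (X.opp d)) := by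
  classical
  have main : ∀ d ∈ W.S, ¬ X.Near x d → _ := fun d hd hn => (hc.proper d hd hn).partner_spec
    (hc.proper _ (W.mate_mem hd) (fun h => hn (h.trans (X.near_mate d).symm)))
  set θ : D → D := fun d => if X.Near x d then X.mate d else partner X c d with hθ
  have hoff : ∀ d, ¬ X.Near x d → θ d = partner X c d := fun d hn => if_neg hn
  refine ⟨θ, fun d hd => ?_, fun d hn => if_pos hn, fun d hd hn => ?_, fun d hd hn => ?_⟩
  · by_cases hn : X.Near x d
    · have f0 : θ d = X.mate d := if_pos hn
      have f1 : θ (X.mate d) = X.mate (X.mate d) := if_pos hn.mate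
      exact ⟨f0 ▸ X.near_mate d, by rw [f0, f1, X.mate_mate], f0 ▸ X.mate_ne d, by
        rw [f0, hc.cell d hn]⟩
    · have h1 := (main d hd hn).1
      rw [hoff d hn, hoff _ fun h => hn (h.trans h1.1.symm)]
      exact h1
  · rw [hoff d hn]
    exact (main d hd hn).2.1
  · rw [hoff d hn]
    exact (main d hd hn).2.2

/-- The darts of a set of colours form an even set. -/
theorem even (hc : W.AlmostColouring x c) (f : ℕ → ZMod 2) : W.Even (fun d => f (c d)) := by
  refine ⟨fun d hd => by rw [hc.edge d hd], fun d hd => ?_⟩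
  by_cases hn : X.Near x d
  · rw [hc.cell d hn, hc.cell _ hn.opp]; grind
  · exact (hc.proper d hd hn).sum_eq_zero (hc.proper _ (W.mate_mem hd)
      (fun h => hn (h.trans (X.near_mate d).symm))) f

/-- If the two strands at the special vertex lie on the same circuit, then this circuit can be
split there. -/
theorem colourable_of_circ [DecidableEq D] (hc : W.AlmostColouring x c) (hx : x ∈ W.S)
    (h : W.Circ x c x (X.opp x)) : W.Colourable := by
  classical
  obtain ⟨θ, t1, t2, t3, t4⟩ := hc.exists_partner
  set S := W.S.filter fun d => c d = c x with hS
  set V := W.star x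
  have hSm : ∀ d, d ∈ S ↔ d ∈ W.S ∧ c d = c x := fun d => by rw [hS, Finset.mem_filter]
  have hVS : V ⊆ S := by
    intro d hd
    obtain ⟨h1, h2⟩ := mem_star.1 hd
    rw [hSm]
    refine ⟨h1, ?_⟩
    have e0 := hc.circ_eq h
    rcases h2 with rfl | rfl | rfl | rfl
    exacts [rfl, hc.cell x (.refl X x), e0, by rw [hc.cell _ (X.near_opp x), e0]]
  have hτ : IsMatching S W.τ := fun d hd => by
    rw [hSm] at hd ⊢
    exact ⟨⟨W.τ_mem hd.1, by rw [hc.edge d hd.1, hd.2]⟩, W.τ_τ hd.1, W.τ_ne hd.1⟩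
  have hVn : ∀ d ∈ W.S, (d ∈ V ↔ X.Near x d) := fun d hd => by
    rw [mem_star]; exact and_iff_right hd
  have hθ : IsMatching (S \ V) θ := fun d hd => by
    rw [Finset.mem_sdiff, hSm] at hd ⊢
    obtain ⟨a1, a2, a3, a4⟩ := t1 d hd.1.1
    have := W.near_mem d hd.1.1 _ a1
    exact ⟨⟨⟨this, by rw [a4, hd.1.2]⟩, fun q => hd.2 ((hVn d hd.1.1).2 (((hVn _ this).1 q).trans
      a1.symm))⟩, a2, a3⟩
  -- `τ'` pairs the four darts at `x` by following circuits until they return to `x`; `Z` below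
  -- marks the excursion that starts at `x`.
  obtain ⟨τ', r1, r2, r3⟩ := hτ.exists_resolution hθ Finset.sdiff_subset
  rw [Finset.sdiff_sdiff_eq_self hVS] at r1 r2 r3
  have hxV : x ∈ V := mem_star.2 ⟨hx, .refl X x⟩
  obtain ⟨p1, p2, p3⟩ := r1 x hxV
  have hpair : ∀ d ∈ V, (if τ' d = x ∨ τ' d = τ' x then (1 : ZMod 2) else 0) =
      if d = x ∨ d = τ' x then 1 else 0 := fun d hd => by
    have := r1 d hd
    grind
  obtain ⟨Z, z1, z2, z3⟩ := r3 (ZMod 2) (fun d => if d = x ∨ d = τ' x then 1 else 0) hpair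
  have zV : ∀ d ∈ V, Z d = if d = x ∨ d = τ' x then 1 else 0 := fun d hd => z3 d (by grind)
  -- Otherwise the circuit closes up at the cell of `x` before reaching the other cell.
  have hx' : τ' x ≠ X.mate x := by
    intro hm
    have key : ∀ d, W.Circ x c x d → Z d = 1 := by
      intro d hd
      induction hd with
      | refl => rw [zV x hxV]; simp
      | @edge d h0 h1 ih => rw [z1 d ((hSm d).2 ⟨h1, hc.circ_eq h0⟩), ih]
      | @turn d e h0 h1 h2 h3 h4 ih =>
        rcases (t3 d h1 h2 e h3).1 h4 with rfl | rfl
        · exact ih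
        · rw [z2 d (Finset.mem_sdiff.2 ⟨(hSm d).2 ⟨h1, hc.circ_eq h0⟩, fun q => h2 ((hVn d h1).1 q)⟩),
            ih]
      | @cell d h0 h1 ih =>
        have h2 := h0.mem hx
        rw [zV _ ((hVn _ (W.mate_mem h2)).2 h1.mate)]
        rw [zV _ ((hVn _ h2).2 h1), hm] at ih
        rw [hm]
        have := X.mate_mate d
        have := X.mate_mate x
        grind
    have h1 := key _ h
    rw [zV _ ((hVn _ (W.opp_mem hx)).2 (X.near_opp x)), hm] at h1
    have := X.opp_ne x
    have := X.mate_ne_opp x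
    grind
  have hnear : X.Near x (τ' x) := (mem_star.1 p1).2
  have hZx : ∀ d ∈ W.S, ¬ X.Near x d → ∀ e, X.Near d e → c e = c d → c d = c x → Z e = Z d := by
    intro d hd hn e he hce hcd
    rcases (t3 d hd hn e he).1 hce with rfl | rfl
    · rfl
    · exact z2 d (Finset.mem_sdiff.2 ⟨(hSm d).2 ⟨hd, hcd⟩, fun q => hn ((hVn d hd).1 q)⟩)
  -- The excursion gets a fresh colour. It joins darts in different cells of `x`, so each cell there
  -- now has one dart of either colour.
  refine ⟨fun d => if c d = c x ∧ Z d = 1 then 0 else c d + 1, fun d hd => ⟨?_, ?_⟩⟩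
  · have h1 := hc.edge d hd
    have h2 : c d = c x → Z (W.τ d) = Z d := fun q => z1 d ((hSm d).2 ⟨hd, q⟩)
    grind
  · by_cases hn : X.Near x d
    · have hcx : ∀ d, X.Near x d → c d = c x ∧ Z d = if d = x ∨ d = τ' x then 1 else 0 := by
        intro d hd
        have := W.near_mem x hx d hd
        have h1 := (hVn d this).2 hd
        exact ⟨((hSm d).1 (hVS h1)).2, zV d h1⟩
      have a0 := hcx _ hn
      have a1 := hcx _ hn.mate
      have a2 := hcx _ hn.opp
      have a3 := hcx _ hn.opp.mate
      have m1 := X.mate_mate x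
      have m2 := X.opp_opp x
      have m3 := X.mate_opp x
      have m4 := X.mate_mate (X.opp x)
      have m5 := X.mate_opp (X.mate x)
      have m6 := X.opp_opp (X.mate x)
      have e1 := X.opp_ne x
      have e2 := X.mate_opp_ne x
      have e3 := X.mate_ne_opp x
      have e4 := X.mate_ne x
      have e5 := X.mate_ne (X.opp x)
      clear_value S V
      clear r1 r2 r3 z1 z2 z3 zV hpair hτ hθ hVn hSm t1 t2 t3 t4 hZx hcx
      rcases hnear with h1 | h1 | h1 | h1
      · exact absurd h1 p3
      · exact absurd h1 hx'
      all_goals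
        rw [h1] at a0 a1 a2 a3
        rcases hn with rfl | rfl | rfl | rfl <;> constructor <;> grind
    · have q0 := hZx d hd hn
      have q := hc.proper d hd hn
      have q1 := q0 _ (X.near_opp d)
      have q2 := q0 _ (X.near_opp d).mate
      obtain ⟨q3, q4⟩ := q
      constructor <;> grind

end AlmostColouring

end Wiring

/-! ### Deleting a colour class -/

namespace Wiring

variable {D : Type*} {X : CellSystem D} {W : Wiring X}

namespace AlmostColouring

variable {x : D} {c : D → ℕ}

/-- Deleting a colour class that is avoided by an even set separating the two cells at the special
vertex. -/
theorem colourable_of_avoid [DecidableEq D] (hc : W.AlmostColouring x c) (hx : x ∈ W.S)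
    (hP : W.Planar) (ih : W.SmallerColourable) {a : D} (ha : a ∈ W.S) (hax : c a ≠ c x)
    (hay : c a ≠ c (X.opp x)) {Z : D → ZMod 2} (hZ : W.Even Z)
    (hZa : ∀ d ∈ W.S, c d = c a → Z d = 0) (hZx : Z x + Z (X.mate x) = 1) : W.Colourable := by
  classical
  obtain ⟨θ, t1, t2, t3, t4⟩ := hc.exists_partner
  set V := W.S.filter fun d => ∃ e, X.Near d e ∧ c e = c a with hV
  set K := W.S.filter fun d => c d = c a with hK
  have hVm : ∀ d, d ∈ V ↔ d ∈ W.S ∧ ∃ e, X.Near d e ∧ c e = c a := fun d => Finset.mem_filter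
  have hKm : ∀ d, d ∈ K ↔ d ∈ W.S ∧ c d = c a := fun d => Finset.mem_filter
  have hVS : V ⊆ W.S := Finset.filter_subset _ _
  have hKV : K ⊆ V := fun d hd => by
    rw [hKm] at hd
    exact (hVm d).2 ⟨hd.1, d, .refl X d, hd.2⟩
  have hVc : ∀ d ∈ V, ∀ e, X.Near d e → e ∈ V := fun d hd e he => by
    rw [hVm] at hd ⊢
    obtain ⟨h1, f, h2, h3⟩ := hd
    exact ⟨W.near_mem d h1 e he, f, he.symm.trans h2, h3⟩
  have hKτ : ∀ d ∈ K, W.τ d ∈ K := fun d hd => by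
    rw [hKm] at hd ⊢
    exact ⟨W.τ_mem hd.1, by rw [hc.edge d hd.1, hd.2]⟩
  have hθ : IsMatching V θ := fun d hd => by
    obtain ⟨h1, h2, h3, h4⟩ := t1 d (hVS hd)
    exact ⟨hVc d hd _ h1, h2, h3⟩
  have hθK : ∀ d ∈ K, θ d ∈ K := fun d hd => by
    rw [hKm] at hd ⊢
    obtain ⟨h1, h2, h3, h4⟩ := t1 d hd.1
    exact ⟨W.near_mem d hd.1 _ h1, by rw [h4, hd.2]⟩
  have hxV : ∀ d, X.Near x d → d ∉ V := by
    rintro d hd hdV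
    obtain ⟨-, e, h1, h2⟩ := (hVm d).1 hdV
    have h3 := hc.cell x (.refl X x)
    have h4 := hc.cell _ (X.near_opp x)
    rcases hd.trans h1 with rfl | rfl | rfl | rfl <;> grind
  have hother : ∀ d ∈ V, d ∉ K → ∀ e, X.Near d e → e ∈ K ∨ c e = c d := by
    intro d hd hdK e he
    have hdS := hVS hd
    obtain ⟨-, f, h1, h2⟩ := (hVm d).1 hd
    have hn : ¬ X.Near x d := fun h => hxV d h hd
    have hdc : c d ≠ c a := fun h => hdK ((hKm d).2 ⟨hdS, h⟩)
    rw [hKm]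
    have := W.near_mem d hdS e he
    have q := (hc.proper d hdS hn).cases
      (hc.proper _ (W.mate_mem hdS) (fun h => hn (h.trans (X.near_mate d).symm)))
    rcases h1 with rfl | rfl | rfl | rfl <;> rcases he with rfl | rfl | rfl | rfl <;> grind
  have hnear : ∀ d ∈ V, X.Near d (θ d) := fun d hd => (t1 d (hVS hd)).1
  -- At an affected vertex only two colours occur. If the surviving colour uses opposite darts, the
  -- strand it crosses has the deleted colour.
  have hcross : ∀ d ∈ V, d ∉ K → θ d = X.opp d → X.rot d ∈ K := by
    intro d hd hdK hopp
    refine (hother d hd hdK _ (X.near_rot d)).resolve_right fun h => ?_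
    have hn : ¬ X.Near x d := fun h => hxV d h hd
    rcases (t3 d (hVS hd) hn _ (X.near_rot d)).1 h with h | h
    · exact X.rot_ne d h
    · rw [hopp] at h
      exact X.rot_ne _ h.symm
  obtain ⟨W', hS', hP', hE', hC'⟩ := W.exists_reduction hVS hVc hKV hKτ hθ hθK hnear hcross
  -- `Z` vanishes on the two deleted darts at the vertex, so parity makes it agree on the other two.
  have hZθ : ∀ d ∈ V, d ∉ K → Z (θ d) = Z d := by
    intro d hd hdK
    have hdS := hVS hd
    have hn : ¬ X.Near x d := fun h => hxV d h hd
    have h1 := hZ.vertex d hdS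
    have hz : ∀ e, X.Near d e → e ≠ d → e ≠ θ d → Z e = 0 := by
      intro e he h1 h2
      have h3 : c e ≠ c d := fun h => by
        rcases (t3 d hdS hn e he).1 h with h | h
        exacts [h1 h, h2 h]
      have h4 := ((hKm e).1 ((hother d hd hdK e he).resolve_right h3)).2
      exact hZa e (W.near_mem d hdS e he) h4
    have e0 := X.mate_ne d
    have e1 := X.opp_ne d
    have e2 := X.mate_opp_ne d
    have e3 := X.mate_ne_opp d
    have e5 := X.mate_ne (X.opp d)
    have e4 : X.mate d ≠ X.mate (X.opp d) := fun h => e1 (by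
      rw [← X.mate_mate (X.opp d), ← h, X.mate_mate])
    have z1 := hz _ (X.near_mate d)
    have z2 := hz _ (X.near_opp d)
    have z3 := hz _ (X.near_opp d).mate
    rcases t4 d hdS hn with h | h
    · rw [z1 e0 (h ▸ e3), z3 e2 (h ▸ e5)] at h1
      rw [h]
      clear * - h1
      grind
    · rw [z1 e0 (h ▸ e4), z2 e1 (h ▸ e5.symm)] at h1
      rw [h]
      clear * - h1
      grind
  -- At `x` the given set `Z` splits the cells; at any other remaining vertex a colour class of `c`
  -- does.
  have hB' : W'.Bridgeless := by
    intro f hf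
    rw [hS', Finset.mem_sdiff] at hf
    by_cases hn : X.Near x f
    · exact ⟨Z, hE' Z hZ hZθ, by rw [hZ.add_mate hx hn, hZx]⟩
    · refine ⟨_, hE' _ (hc.even fun k => if k = c f then 1 else 0) fun d hd _ => ?_, ?_⟩
      · rw [(t1 d (hVS hd)).2.2.2]
      · have := (hc.proper f hf.1 hn).ne
        simp [this]
  have haV : a ∈ V := (hVm a).2 ⟨ha, a, .refl X a, rfl⟩
  obtain ⟨c', hc'⟩ := ih W' (by rw [hS']; exact card_sdiff_lt hVS haV) (hP' hP) hB'
  obtain ⟨c₁, k1, k2, k3⟩ := hC' ℕ c' (fun d hd => (hc' d hd).1)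
  refine ⟨fun d => if d ∈ K then 0 else c₁ d + 1, fun d hd => ⟨?_, ?_⟩⟩
  · have q1 := k1 d hd
    have q2 := hKτ d
    have q3 := hKτ (W.τ d)
    rw [W.τ_τ hd] at q3
    grind
  · by_cases hdV : d ∈ V
    · have hn : ¬ X.Near x d := fun h => hxV d h hdV
      have key : ∀ e, X.Near d e → c e = c d →
          (if e ∈ K then 0 else c₁ e + 1) = (if d ∈ K then 0 else c₁ d + 1) := by
        intro e he h
        rcases (t3 d hd hn e he).1 h with rfl | rfl
        · rfl
        · have h1 := hθK d
          have h2 := hθK (θ d)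
          have h3 := k2 d hdV
          rw [(t1 d hd).2.1] at h2
          grind
      have key' : ∀ e, X.Near d e → c e ≠ c d → (e ∈ K ↔ d ∉ K) := by
        intro e he h
        have h1 := hother d hdV
        have h2 := hKm e
        have h3 := hKm d
        grind
      obtain ⟨p1, p2⟩ := hc.proper d hd hn
      have := key _ (X.near_opp d)
      have := key _ (X.near_opp d).mate
      have := key' _ (X.near_mate d)
      constructor <;> grind
    · have hdS' : d ∈ W'.S := by rw [hS']; exact Finset.mem_sdiff.2 ⟨hd, hdV⟩
      obtain ⟨p1, p2⟩ := (hc' d hdS').2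
      refine proper_congr (c' := fun d => c' d + 1) (fun e he => ?_)
        ⟨by simpa using p1, by simpa using p2⟩
      have heV : e ∉ V := fun h => hdV (hVc e h d he.symm)
      have heK : e ∉ K := fun h => heV (hKV h)
      simp [heK, k3 e heV]

end AlmostColouring

end Wiring

/-! ### The chain of circuits -/

theorem SimpleGraph.Reachable.exists_geodesic {V : Type*} {G : SimpleGraph V} {u v : V}
    (h : G.Reachable u v) : ∃ s : ℕ → V, s 0 = u ∧ s (G.dist u v) = v ∧
      (∀ i < G.dist u v, G.Adj (s i) (s (i + 1))) ∧ ∀ i ≤ G.dist u v, G.dist u (s i) = i := by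
  obtain ⟨p, hp⟩ := h.exists_walk_length_eq_dist
  refine ⟨p.getVert, p.getVert_zero, by rw [← hp, p.getVert_length],
    fun i hi => p.adj_getVert_succ (hp ▸ hi), fun i hi => ?_⟩
  rw [← length_eq_dist_of_subwalk hp (p.isSubwalk_take i), p.take_length, min_eq_left (hp ▸ hi)]

namespace Wiring

variable {D : Type*} {X : CellSystem D} {W : Wiring X}

namespace AlmostColouring

variable {x : D} {c : D → ℕ}

/-- Circuits of equal colour are disjoint, so they may be given different colours. Afterwards
colours and circuits can be identified. -/
theorem exists_circ_colouring [Finite D] (hc : W.AlmostColouring x c) :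
    ∃ c', W.AlmostColouring x c' ∧ (∀ d e, c' d = c' e ↔ W.Circ x c d e) ∧
      ∀ d e, c' d = c' e → W.Circ x c' d e := by
  let s : Setoid D := ⟨W.Circ x c, fun _ => .refl, fun h => h.symm, fun h h' => h.trans h'⟩
  obtain ⟨g, hg⟩ := exists_injective_nat (Quotient s)
  have key : ∀ d e, g (Quotient.mk s d) = g (Quotient.mk s e) ↔ W.Circ x c d e := fun d e =>
    hg.eq_iff.trans Quotient.eq
  refine ⟨fun d => g (Quotient.mk s d), ⟨fun d hd => ?_, fun d hd hn => ?_, fun d hn => ?_⟩, key, ?_⟩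
  · exact ((key _ _).2 (Circ.refl.edge hd)).symm
  · obtain ⟨h1, h2⟩ := hc.proper d hd hn
    refine ⟨fun h => h1 (hc.circ_eq ((key _ _).1 h)).symm, ?_⟩
    rcases h2 with h | h
    · exact .inl ((key _ _).2 (Circ.refl.turn hd hn (X.near_opp d) h)).symm
    · exact .inr ((key _ _).2 (Circ.refl.turn hd hn (X.near_opp d).mate h)).symm
  · exact ((key _ _).2 (Circ.refl.cell hn)).symm
  · intro d e h
    have h := (key d e).1 h
    induction h with
    | refl => exact .refl
    | edge _ h1 ih => exact (ih ((key _ _).2 ‹_›)).edge h1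
    | turn h0 h1 h2 h3 h4 ih =>
      exact (ih ((key _ _).2 h0)).turn h1 h2 h3 ((key _ _).2 (Circ.refl.turn h1 h2 h3 h4)).symm
    | cell _ h1 ih => exact (ih ((key _ _).2 ‹_›)).cell h1

/-- Either `W` is colourable, or the circuits of the almost colouring form a chain that joins the
two cells of the special vertex. -/
theorem exists_heights [Finite D] [DecidableEq D] (hc : W.AlmostColouring x c) (hx : x ∈ W.S)
    (hP : W.Planar) (hB : W.Bridgeless) (ih : W.SmallerColourable) : W.Colourable ∨
    ∃ h : D → ℕ, W.AlmostColouring x h ∧ (∀ d ∈ W.S, ∀ e ∈ W.S, h d = h e ↔ W.Circ x c d e) ∧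
      h (X.opp x) = 0 ∧ 0 < h x ∧ (∀ d ∈ W.S, h d ≤ h x) ∧
      (∀ d ∈ W.S, ¬ X.Near x d → h (X.mate d) = h d + 1 ∨ h d = h (X.mate d) + 1) ∧
      ∀ j, ∀ d ∈ W.S, h d ≤ j → W.Conn (fun e => h e ≤ j) (fun e => ¬ X.Near x e) d (X.opp x) := by
  obtain ⟨c', hc', hcc, hcc'⟩ := hc.exists_circ_colouring
  by_cases hcirc : W.Circ x c x (X.opp x)
  · exact .inl (hc.colourable_of_circ hx hcirc)
  by_contra hcon
  rw [not_or] at hcon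
  obtain ⟨hnc, hcon⟩ := hcon
  -- The intersection graph of the circuits: two are adjacent when they meet at a vertex other than
  -- that of `x`.
  let G : SimpleGraph ℕ := SimpleGraph.fromRel
    fun i j => ∃ d ∈ W.S, ¬ X.Near x d ∧ c' d = i ∧ c' (X.mate d) = j
  have hG : ∀ d ∈ W.S, ¬ X.Near x d → G.Adj (c' d) (c' (X.mate d)) := fun d hd hn =>
    (SimpleGraph.fromRel_adj _ _ _).2 ⟨((hc'.proper d hd hn).ne).symm, .inl ⟨d, hd, hn, rfl, rfl⟩⟩
  have hG' : ∀ i j, G.Adj i j → ∃ d ∈ W.S, ¬ X.Near x d ∧ c' d = i ∧ c' (X.mate d) = j := by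
    intro i j hij
    obtain ⟨-, h | ⟨d, h1, h2, h3, h4⟩⟩ := (SimpleGraph.fromRel_adj _ _ _).1 hij
    · exact h
    · exact ⟨X.mate d, W.mate_mem h1, fun h => h2 (h.trans (X.near_mate d).symm), h4,
        by rw [X.mate_mate, h3]⟩
  have hreach : G.Reachable (c' (X.opp x)) (c' x) := by
    have key : ∀ d, W.Conn (fun _ => True) (fun d => ¬ X.Near x d) x d → G.Reachable (c' x) (c' d) := by
      intro d hd
      have hmate : ∀ d, d ∈ W.S → G.Reachable (c' x) (c' d) → G.Reachable (c' x) (c' (X.mate d)) := by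
        intro d hd h
        by_cases hn : X.Near x d
        · rwa [hc'.cell d hn]
        · exact h.trans (hG d hd hn).reachable
      induction hd with
      | refl => exact .refl _
      | edge _ h1 _ ih => rwa [hc'.edge _ h1]
      | mate h0 ih => exact hmate _ (h0.mem hx) ih
      | @opp d h0 h1 ih =>
        rcases (hc'.proper d (h0.mem hx) h1).eq with h | h
        · rwa [h]
        · have := hmate _ (W.mate_mem (W.opp_mem (h0.mem hx))) (h ▸ ih)
          rwa [X.mate_mate] at this
    exact (key _ (hB.conn hx)).symm
  obtain ⟨s, s1, s2, s3, s4⟩ := hreach.exists_geodesic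
  set n := G.dist (c' (X.opp x)) (c' x) with hn
  have hconn : ∀ j i, i ≤ j → i ≤ n → ∀ d ∈ W.S, c' d = s i →
      W.Conn (fun e => ∃ k ≤ j, k ≤ n ∧ c' e = s k) (fun e => ¬ X.Near x e) d (X.opp x) := by
    intro j i
    induction i with
    | zero =>
      intro _ _ d hd h
      exact hc'.conn_of_circ (hcc' _ _ (h.trans s1)) fun e _ he => ⟨0, by omega, by omega, he.trans h⟩
    | succ i ih =>
      intro hij hin d hd h
      obtain ⟨f, f1, -, f2, f3⟩ := hG' _ _ (s3 i hin)
      have h1 := hc'.conn_of_circ (T := fun e => ∃ k ≤ j, k ≤ n ∧ c' e = s k)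
        (hcc' d (X.mate f) (h.trans f3.symm)) fun e _ he => ⟨i + 1, hij, hin, he.trans h⟩
      have h2 := h1.mate
      rw [X.mate_mate] at h2
      exact h2.trans (ih (by omega) (by omega) f f1 f2)
  have hTτ : ∀ j, ∀ d ∈ W.S, (∃ k ≤ j, k ≤ n ∧ c' d = s k) → ∃ k ≤ j, k ≤ n ∧ c' (W.τ d) = s k :=
    fun j d hd => by rw [hc'.edge d hd]; exact id
  have hO : ∀ d e, ¬ X.Near x d → X.Near d e → ¬ X.Near x e := fun d e h h' h'' =>
    h (h''.trans h'.symm)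
  -- The circuits of the geodesic already contain a walk between the two cells of `x`, hence an even
  -- set splitting them. A circuit off the geodesic is avoided by this set and can be deleted.
  have hall : ∀ d ∈ W.S, ∃ k ≤ n, c' d = s k := by
    intro a ha
    by_contra! hcon'
    obtain ⟨Z, z1, z2, z3⟩ := (hconn n n le_rfl le_rfl x hx s2.symm).exists_even (hTτ n) hO
    refine hnc (hc'.colourable_of_avoid hx hP ih ha ?_ ?_ z1 (fun d hd h => z2 d hd ?_) ?_)
    · rw [← s2]; exact hcon' n le_rfl
    · rw [← s1]; exact hcon' 0 (Nat.zero_le _)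
    · rintro ⟨k, -, k1, k2⟩
      exact hcon' k k1 (h ▸ k2)
    · rw [z3 x hx (fun h => h (.refl X x)), if_pos (.refl X x)]
  set h : D → ℕ := fun d => G.dist (c' (X.opp x)) (c' d) with hh
  have hs : ∀ d ∈ W.S, h d ≤ n ∧ c' d = s (h d) := by
    intro d hd
    obtain ⟨k, k1, k2⟩ := hall d hd
    have : h d = k := by simp only [hh]; rw [k2, s4 k k1]
    rw [this]; exact ⟨k1, k2⟩
  have heq : ∀ d ∈ W.S, ∀ e ∈ W.S, h d = h e ↔ c' d = c' e := fun d hd e he =>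
    ⟨fun q => by rw [(hs d hd).2, (hs e he).2, q], fun q => by simp only [hh, q]⟩
  have hxn : h x = n := rfl
  refine hcon ⟨h, ⟨fun d hd => ?_, fun d hd hn => ?_, fun d hd => ?_⟩, ?_, ?_, ?_, ?_, ?_, ?_⟩
  · simp only [hh, hc'.edge d hd]
  · obtain ⟨h1, h2⟩ := hc'.proper d hd hn
    exact ⟨fun q => h1 ((heq _ (W.mate_mem hd) _ hd).1 q),
      h2.imp (heq _ (W.opp_mem hd) _ hd).2 (heq _ (W.mate_mem (W.opp_mem hd)) _ hd).2⟩
  · simp only [hh, hc'.cell d hd]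
  · exact fun d hd e he => (heq d hd e he).trans (hcc d e)
  · exact G.dist_self
  · rw [Nat.pos_iff_ne_zero]
    intro q
    exact hcirc ((hcc _ _).1 ((heq _ hx _ (W.opp_mem hx)).1 (q.trans G.dist_self.symm)))
  · exact fun d hd => (hs d hd).1
  · intro d hd hn
    have h1 := hG d hd hn
    have h2 : h d ≠ h (X.mate d) := fun q => h1.ne ((heq _ hd _ (W.mate_mem hd)).1 q)
    -- Circuits that meet have distances from the bottom differing by at most one; here the
    -- distances are also distinct.
    have h3 := h1.diff_dist_adj (u := c' (X.opp x))
    simp only [hh] at h2 ⊢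
    omega
  · intro j d hd hj
    refine (hconn j (h d) hj (hs d hd).1 d hd (hs d hd).2).mono ?_ fun _ => id
    rintro e ⟨k, k1, k2, k3⟩
    simp only [hh, k3, s4 k k2, k1]

end AlmostColouring

end Wiring

/-! ### Facial chains and arcs of the second circuit -/

namespace Wiring

variable {D : Type*} {X : CellSystem D} {W : Wiring X}

variable (W) in
/-- `θ` sends a dart to the other dart of its circuit at its vertex. -/
structure IsPartner (x : D) (c : D → ℕ) (θ : D → D) : Prop where
  near : ∀ d ∈ W.S, X.Near d (θ d)
  invol : ∀ d ∈ W.S, θ (θ d) = d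
  ne : ∀ d ∈ W.S, θ d ≠ d
  colour : ∀ d ∈ W.S, c (θ d) = c d
  cell : ∀ d, X.Near x d → θ d = X.mate d
  turn : ∀ d ∈ W.S, ¬ X.Near x d → ∀ e, X.Near d e → (c e = c d ↔ e = d ∨ e = θ d)

theorem AlmostColouring.exists_isPartner {x : D} {c : D → ℕ} (hc : W.AlmostColouring x c) :
    ∃ θ, W.IsPartner x c θ := by
  obtain ⟨θ, t1, t2, t3, -⟩ := hc.exists_partner
  exact ⟨θ, fun d hd => (t1 d hd).1, fun d hd => (t1 d hd).2.1, fun d hd => (t1 d hd).2.2.1,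
    fun d hd => (t1 d hd).2.2.2, t2, t3⟩

namespace IsPartner

variable {x : D} {c : D → ℕ} {θ : D → D}

theorem mem (hθ : W.IsPartner x c θ) {d : D} (hd : d ∈ W.S) : θ d ∈ W.S :=
  W.near_mem d hd _ (hθ.near d hd)

/-- An edge-invariant indicator that is also invariant under all turns but one is invariant under
that one: a union of strands has an even number of ends. -/
theorem parity [DecidableEq D] (hθ : W.IsPartner x c θ) {Y : D → ZMod 2}
    (hY : ∀ d ∈ W.S, Y (W.τ d) = Y d) {a : D} (ha : a ∈ W.S)
    (h : ∀ d ∈ W.S, d ≠ a → d ≠ θ a → Y (θ d) = Y d) : Y (θ a) = Y a := by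
  have h1 := sum_eq_zero_of_edge (W := W) le_rfl (fun d hd => W.τ_mem hd) hY
  have h2 : ∑ d ∈ (W.S.erase a).erase (θ a), Y d = 0 := by
    refine Finset.sum_involution (fun d _ => θ d) ?_ ?_ ?_ ?_
    · intro d hd
      simp only [Finset.mem_erase] at hd
      rw [h d hd.2.2 hd.2.1 hd.1]; grind
    · intro d hd _
      simp only [Finset.mem_erase] at hd
      exact hθ.ne d hd.2.2
    · intro d hd
      simp only [Finset.mem_erase] at hd ⊢
      have := hθ.invol d hd.2.2
      have := hθ.invol a ha
      have := hθ.mem hd.2.2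
      grind
    · intro d hd
      simp only [Finset.mem_erase] at hd
      exact hθ.invol d hd.2.2
  rw [← Finset.add_sum_erase _ Y ha,
    ← Finset.add_sum_erase _ Y (Finset.mem_erase.2 ⟨hθ.ne a ha, hθ.mem ha⟩), h2] at h1
  grind

/-- A property of darts kept along edges and turns of one colour spreads over a whole circuit. -/
theorem circ_induction (hθ : W.IsPartner x c θ) (hc : W.AlmostColouring x c) {Y : D → Prop}
    {a b : D} (h : W.Circ x c a b) (ha : a ∈ W.S) (hYa : Y a)
    (hYτ : ∀ d ∈ W.S, c d = c a → Y d → Y (W.τ d))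
    (hYθ : ∀ d ∈ W.S, c d = c a → Y d → Y (θ d)) : Y b := by
  induction h with
  | refl => exact hYa
  | edge h0 h1 ih => exact hYτ _ h1 (hc.circ_eq h0) ih
  | turn h0 h1 h2 h3 h4 ih =>
    rcases (hθ.turn _ h1 h2 _ h3).1 h4 with rfl | rfl
    · exact ih
    · exact hYθ _ h1 (hc.circ_eq h0) ih
  | cell h0 h1 ih =>
    rw [← hθ.cell _ h1]
    exact hYθ _ (h0.mem ha) (hc.circ_eq h0) ih

end IsPartner

variable (W) in
/-- A colouring by heights in which the circuits form a chain that ends with the boundary of the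
face of `x`. The vertex of `x` is the only one at which this face has its corner inside a cell. -/
structure FacialChain (x : D) (h : D → ℕ) : Prop where
  mem : x ∈ W.S
  corner : X.mate x = X.rot (X.rot (X.rot x))
  corner_of_ne : ∀ r, W.SameFace x r → r ≠ x → X.mate r = X.rot r
  unique : ∀ a b, W.SameFace x a → W.SameFace x b → X.Near a b → b = a
  almost : W.AlmostColouring x h
  top : ∀ d ∈ W.S, h d = h x ↔ W.SameFace x d ∨ W.SameFace x (X.rot d)
  circ : ∀ d ∈ W.S, ∀ e ∈ W.S, h d = h e → W.Circ x h d e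
  zero : h (X.opp x) = 0
  pos : 0 < h x
  le : ∀ d ∈ W.S, h d ≤ h x
  site : ∀ d ∈ W.S, ¬ X.Near x d → h (X.mate d) = h d + 1 ∨ h d = h (X.mate d) + 1
  conn : ∀ j, ∀ d ∈ W.S, h d ≤ j →
    W.Conn (fun e => h e ≤ j) (fun e => ¬ X.Near x e) d (X.opp x)

variable (W) in
/-- The darts leaving the boundary of the face of `x`, except for those at `x`. -/
def Contact (x d : D) : Prop := ∃ r, W.SameFace x r ∧ r ≠ x ∧ (d = X.rot r ∨ d = X.rot (X.rot r))

namespace FacialChain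

variable {x : D} {h : D → ℕ}

theorem not_near (H : W.FacialChain x h) {r : D} (hr : W.SameFace x r) (hrx : r ≠ x) :
    ¬ X.Near x r := fun hn => hrx (H.unique x r (.refl x) hr hn)

variable (W) in
/-- `α` is an arc of the second circuit, between its contacts `q` and `e` with the first one. -/
structure IsArc [DecidableEq D] (x : D) (h : D → ℕ) (θ : D → D) (q e : D) (α : D → ZMod 2) : Prop where
  left : W.Contact x q
  right : W.Contact x e
  ne : e ≠ q
  edge : ∀ d ∈ W.S, α (W.τ d) = α d
  height : ∀ d, α d = 1 → d ∈ W.S ∧ h d + 1 = h x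
  contact : ∀ d, W.Contact x d → α d = if d = q ∨ d = e then 1 else 0
  partner : ∀ d ∈ W.S, ¬ W.Contact x d → α (θ d) = α d

theorem IsArc.eq_zero [DecidableEq D] {θ : D → D} {q e : D} {α : D → ZMod 2}
    (A : IsArc W x h θ q e α) {d : D} (hd : h d + 1 ≠ h x) : α d = 0 := by
  have : ∀ z : ZMod 2, z ≠ 1 → z = 0 := by decide
  exact this _ fun q => hd (A.height d q).2

variable [Finite D]

/-- Heights in a cell differ by one and the boundary darts are at the maximum, so the two inner
darts lie just below it. -/
theorem heights (H : W.FacialChain x h) {r : D} (hr : W.SameFace x r) (hrx : r ≠ x) :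
    h r = h x ∧ h (X.rot r) + 1 = h x ∧ h (X.rot (X.rot r)) + 1 = h x ∧
      h (X.rot (X.rot (X.rot r))) = h x := by
  have hrS := hr.mem H.mem
  have h0 : h r = h x := (H.top r hrS).2 (.inl hr)
  have h3 : h (X.rot (X.rot (X.rot r))) = h x :=
    (H.top _ (W.rot_mem (W.rot_mem (W.rot_mem hrS)))).2 (.inr (by rwa [X.rot_four]))
  have hm := H.corner_of_ne r hr hrx
  have hn := H.not_near hr hrx
  have hm' := mate_opp_of_mate hm
  unfold CellSystem.opp at hm'
  have s1 := H.site r hrS hn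
  have s2 := H.site _ (W.rot_mem (W.rot_mem hrS)) (fun q => hn (q.trans (X.near_opp r).symm))
  have l1 := H.le _ (W.rot_mem hrS)
  have l2 := H.le _ (W.rot_mem (W.rot_mem hrS))
  rw [hm] at s1
  rw [hm'] at s2
  omega

theorem contact_height (H : W.FacialChain x h) {d : D} (hd : W.Contact x d) :
    d ∈ W.S ∧ h d + 1 = h x ∧ ¬ X.Near x d := by
  obtain ⟨r, h1, h2, h3⟩ := hd
  have := H.heights h1 h2
  have hrS := h1.mem H.mem
  have hn := H.not_near h1 h2
  rcases h3 with rfl | rfl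
  · exact ⟨W.rot_mem hrS, this.2.1, fun q => hn (q.trans (X.near_rot r).symm)⟩
  · exact ⟨W.opp_mem hrS, this.2.2.1, fun q => hn (q.trans (X.near_opp r).symm)⟩

theorem contact_of_near (H : W.FacialChain x h) {d r : D} (hr : W.SameFace x r) (hrx : r ≠ x)
    (hn : X.Near r d) (hd : h d + 1 = h x) : W.Contact x d := by
  have := H.heights hr hrx
  rcases X.near_iff_rot.1 hn with rfl | rfl | rfl | rfl
  · omega
  · exact ⟨r, hr, hrx, .inl rfl⟩
  · exact ⟨r, hr, hrx, .inr rfl⟩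
  · omega

theorem contact_of_mate (H : W.FacialChain x h) {d : D} (hd : d ∈ W.S) (hn : ¬ X.Near x d)
    (hm : h (X.mate d) = h x) (hd' : h d + 1 = h x) : W.Contact x d := by
  rcases (H.top _ (W.mate_mem hd)).1 hm with q | q
  · exact H.contact_of_near q (fun e => hn (e ▸ (X.near_mate d).symm)) (X.near_mate d).symm hd'
  · exact H.contact_of_near q (fun e => hn (e ▸ (X.near_mate d).rot.symm)) (X.near_mate d).rot.symm hd'

theorem partner_rot (H : W.FacialChain x h) {θ : D → D} (hθ : W.IsPartner x h θ) {r : D}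
    (hr : W.SameFace x r) (hrx : r ≠ x) :
    θ (X.rot r) = X.rot (X.rot r) ∧ θ (X.rot (X.rot r)) = X.rot r := by
  have hrS := hr.mem H.mem
  have h1 := H.heights hr hrx
  have hn := H.not_near hr hrx
  have h2 := ((hθ.turn _ (W.rot_mem hrS) (fun q => hn (q.trans (X.near_rot r).symm)) _
    (X.near_rot _)).1 (by omega)).resolve_left (X.rot_ne _)
  exact ⟨h2.symm, by rw [h2, hθ.invol _ (W.rot_mem hrS)]⟩

theorem contact_partner (H : W.FacialChain x h) {θ : D → D} (hθ : W.IsPartner x h θ) {d : D}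
    (hd : W.Contact x d) : W.Contact x (θ d) := by
  obtain ⟨r, h1, h2, h3⟩ := hd
  have := H.partner_rot hθ h1 h2
  rcases h3 with rfl | rfl
  · exact ⟨r, h1, h2, .inr this.1⟩
  · exact ⟨r, h1, h2, .inl this.2⟩

/-- Follow the second circuit from `q` to its next contact: resolving all darts of that height which
are not contacts pairs up the contacts. -/
theorem exists_arc [DecidableEq D] (H : W.FacialChain x h) {θ : D → D} (hθ : W.IsPartner x h θ)
    {q : D} (hq : W.Contact x q) : ∃ e α, IsArc W x h θ q e α := by
  classical
  set S := W.S.filter fun d => h d + 1 = h x with hS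
  set V := S.filter fun d => W.Contact x d with hV
  have hSm : ∀ d, d ∈ S ↔ d ∈ W.S ∧ h d + 1 = h x := fun d => Finset.mem_filter
  have hVm : ∀ d, d ∈ V ↔ W.Contact x d := fun d => by
    rw [hV, Finset.mem_filter, hSm]
    exact ⟨fun h => h.2, fun h => ⟨⟨(H.contact_height h).1, (H.contact_height h).2.1⟩, h⟩⟩
  have hVS : V ⊆ S := Finset.filter_subset _ _
  have hτ : IsMatching S W.τ := fun d hd => by
    rw [hSm] at hd ⊢
    exact ⟨⟨W.τ_mem hd.1, by rw [H.almost.edge d hd.1, hd.2]⟩, W.τ_τ hd.1, W.τ_ne hd.1⟩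
  have hθ' : IsMatching (S \ V) θ := fun d hd => by
    rw [Finset.mem_sdiff, hSm, hVm] at hd ⊢
    obtain ⟨⟨h1, h2⟩, h3⟩ := hd
    refine ⟨⟨⟨hθ.mem h1, by rw [hθ.colour d h1, h2]⟩, fun hc => h3 ?_⟩, hθ.invol d h1, hθ.ne d h1⟩
    have := H.contact_partner hθ hc
    rwa [hθ.invol d h1] at this
  obtain ⟨τ', r1, -, r3⟩ := hτ.exists_resolution hθ' Finset.sdiff_subset
  rw [Finset.sdiff_sdiff_eq_self hVS] at r1 r3
  obtain ⟨p1, p2, p3⟩ := r1 q ((hVm q).2 hq)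
  obtain ⟨Z, z1, z2, z3⟩ := r3 (ZMod 2) (fun d => if d = q ∨ d = τ' q then 1 else 0)
    (fun d hd => by have := r1 d hd; grind)
  have hSc : ∀ d ∈ W.S, (W.τ d ∈ S ↔ d ∈ S) := fun d hd => by
    rw [hSm, hSm, H.almost.edge d hd]
    exact and_congr_left fun _ => ⟨fun _ => hd, fun _ => W.τ_mem hd⟩
  refine ⟨τ' q, fun d => if d ∈ S then Z d else 0, hq, (hVm _).1 p1, p3, fun d hd => ?_, fun d hd => ?_,
    fun d hd => ?_, fun d hd hdc => ?_⟩
  · have := hSc d hd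
    have := z1 d
    grind
  · rw [← hSm]
    by_contra hdS
    simp [hdS] at hd
  · rw [← hVm] at hd
    have := hVS hd
    have := z3 d
    grind
  · have h1 : θ d ∈ S ↔ d ∈ S := by
      rw [hSm, hSm, hθ.colour d hd]
      exact and_congr_left fun _ => ⟨fun _ => hd, fun _ => hθ.mem hd⟩
    have := z2 d
    rw [← hVm] at hdc
    grind

end FacialChain

end Wiring

/-! ### The order of the contacts along the face -/

namespace Wiring

variable {D : Type*} {X : CellSystem D} {W : Wiring X}

theorem vertex_sum_near {Z : D → ZMod 2} {d e : D} (hn : X.Near d e) :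
    Z e + Z (X.mate e) + Z (X.opp e) + Z (X.mate (X.opp e)) =
      Z d + Z (X.mate d) + Z (X.opp d) + Z (X.mate (X.opp d)) := by
  have m1 := X.mate_mate d
  have m2 := X.opp_opp d
  have m3 := X.mate_opp d
  have m4 := X.mate_mate (X.opp d)
  have m6 := X.opp_opp (X.mate d)
  rcases hn with rfl | rfl | rfl | rfl
  · rfl
  · rw [m1, ← m3, m4]; ring
  · rw [m2]; ring
  · rw [m4, m3, m6, m1]; ring

variable (W) in
/-- The number of steps from `x` to `r` along the face of `x`. -/
noncomputable def faceIndex (x r : D) : ℕ := sInf {i | (W.facePerm ^ i) x = r}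

theorem faceIndex_le {x r : D} {i : ℕ} (h : (W.facePerm ^ i) x = r) : W.faceIndex x r ≤ i :=
  Nat.sInf_le h

theorem faceIndex_self (x : D) : W.faceIndex x x = 0 :=
  Nat.le_zero.1 (faceIndex_le rfl)

theorem SameFace.facePerm_pow_faceIndex [Finite D] {x r : D} (h : W.SameFace x r) :
    (W.facePerm ^ W.faceIndex x r) x = r :=
  Nat.sInf_mem (s := {i | (W.facePerm ^ i) x = r}) (Equiv.Perm.SameCycle.exists_nat_pow_eq h)

theorem SameFace.faceIndex_inj [Finite D] {x r s : D} (h : W.SameFace x r) (h' : W.SameFace x s)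
    (he : W.faceIndex x r = W.faceIndex x s) : r = s := by
  rw [← h.facePerm_pow_faceIndex, ← h'.facePerm_pow_faceIndex, he]

theorem SameFace.faceIndex_succ [Finite D] {x r : D} (h : W.SameFace x r)
    (hne : W.facePerm r ≠ x) : W.faceIndex x (W.facePerm r) = W.faceIndex x r + 1 := by
  have h1 := h.facePerm_pow_faceIndex
  have h' : W.SameFace x (W.facePerm r) := h.trans (sameFace_facePerm r)
  have h2 := h'.facePerm_pow_faceIndex
  refine le_antisymm (faceIndex_le (by rw [pow_succ', Equiv.Perm.mul_apply, h1])) ?_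
  obtain ⟨j, hj⟩ : ∃ j, W.faceIndex x (W.facePerm r) = j + 1 := by
    refine Nat.exists_eq_succ_of_ne_zero fun h0 => hne ?_
    rw [h0] at h2
    exact h2.symm
  rw [hj, pow_succ', Equiv.Perm.mul_apply] at h2
  rw [hj]
  exact Nat.succ_le_succ (faceIndex_le (W.facePerm.injective h2))

theorem SameFace.faceIndex_le_of_last [Finite D] {x r s : D} (h : W.SameFace x r)
    (hs : W.SameFace x s) (he : W.facePerm r = x) : W.faceIndex x s ≤ W.faceIndex x r := by
  by_contra! hlt
  have h1 := h.facePerm_pow_faceIndex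
  have h2 := hs.facePerm_pow_faceIndex
  obtain ⟨k, hk⟩ := Nat.exists_eq_add_of_lt hlt
  have h3 : (W.facePerm ^ k) x = s := by
    rw [← h2, hk, show W.faceIndex x r + k + 1 = k + (W.faceIndex x r + 1) by ring, pow_add,
      Equiv.Perm.mul_apply, pow_succ', Equiv.Perm.mul_apply, h1, he]
  have := faceIndex_le h3
  omega

namespace FacialChain

variable {x : D} {h : D → ℕ}

theorem not_sameFace_rot (H : W.FacialChain x h) {r : D} (hr : W.SameFace x r) :
    ¬ W.SameFace x (X.rot r) ∧ ¬ W.SameFace x (X.rot (X.rot r)) ∧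
      ¬ W.SameFace x (X.rot (X.rot (X.rot r))) :=
  ⟨fun q => X.rot_ne r (H.unique r _ hr q (X.near_rot r)),
    fun q => X.rot_two_ne r (H.unique r _ hr q (X.near_rot r).rot),
    fun q => X.rot_three_ne r (H.unique r _ hr q (X.near_rot r).rot.rot)⟩

variable [Finite D] [DecidableEq D]

open Classical in
/-- The even set that consists of an arc of the second circuit and of a part of the first one. -/
theorem even_arc (H : W.FacialChain x h) {θ : D → D} (hθ : W.IsPartner x h θ)
    (h1 : W.facePerm x ≠ x) (h2 : W.facePerm (W.facePerm x) ≠ x) {e r : D} {α : D → ZMod 2}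
    (A : IsArc W x h θ (X.rot (X.rot (W.facePerm x))) e α) (hr : W.SameFace x r) (hrx : r ≠ x)
    (he : e = X.rot r ∨ e = X.rot (X.rot r)) :
    ∃ B : D → ZMod 2,
      (∀ d, B d = if W.SameFace x d ∧ 2 ≤ W.faceIndex x d ∧ W.faceIndex x d ≤ W.faceIndex x r
        then 1 else 0) ∧
      W.Even (fun d => α d + (B d + B (W.τ d))) ∧
      (∀ d ∈ W.S, h d ≠ h x → B d + B (W.τ d) = 0) ∧
      ∀ d ∈ W.S, (∀ r', W.SameFace x r' → X.Near r' d → r' = x) → B d + B (W.τ d) = 0 := by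
  -- The dart `d` ends the face edge traversed just before the corner `d`. So indices from 2 up to
  -- that of `r` select the boundary edges between `W.facePerm x`, of index 1, and `r`.
  obtain ⟨B, hB⟩ : ∃ B : D → ZMod 2, ∀ d, B d = if W.SameFace x d ∧ 2 ≤ W.faceIndex x d ∧
    W.faceIndex x d ≤ W.faceIndex x r then 1 else 0 := ⟨_, fun _ => rfl⟩
  have hB0 : ∀ d, ¬ W.SameFace x d → B d = 0 := fun d hd => (hB d).trans (if_neg fun q => hd q.1)
  have hBτ : ∀ d ∈ W.S, ¬ W.SameFace x (X.rot d) → B (W.τ d) = 0 := fun d hd q =>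
    hB0 _ fun q' => q (q'.trans (sameFace_rot_τ hd).symm)
  have hBx : B x = 0 := (hB x).trans (if_neg fun q => by rw [faceIndex_self] at q; omega)
  have hx1 : W.SameFace x (W.facePerm x) := sameFace_facePerm x
  have i1 : W.faceIndex x (W.facePerm x) = 1 := by
    rw [(SameFace.refl x).faceIndex_succ h1, faceIndex_self]
  have hBx1 : B (W.facePerm x) = 0 := (hB _).trans (if_neg fun q => by rw [i1] at q; omega)
  have hv : ∀ d ∈ W.S, (∀ r', W.SameFace x r' → X.Near r' d → r' = x) → B d + B (W.τ d) = 0 := by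
    intro d hd hr'
    have e1 : B d = 0 := by
      by_cases hds : W.SameFace x d
      · rw [hr' d hds (.refl X d), hBx]
      · exact hB0 d hds
    have e2 : B (W.τ d) = 0 := by
      by_cases hds : W.SameFace x (X.rot d)
      · have := hr' _ hds (X.near_rot d).symm
        rw [← facePerm_rot hd, this, hBx1]
      · exact hBτ d hd hds
    rw [e1, e2, add_zero]
  refine ⟨B, hB, ⟨fun d hd => ?_, fun d hd => ?_⟩, fun d hd hdx => ?_, hv⟩
  · simp only [A.edge d hd, W.τ_τ hd, add_comm (B d)]
  · by_cases hd' : ∀ r', W.SameFace x r' → X.Near r' d → r' = x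
    · have hnc : ∀ e ∈ W.star d, ¬ W.Contact x e := by
        rintro e he ⟨r', q1, q2, q3⟩
        refine q2 (hd' r' q1 ?_)
        refine CellSystem.Near.trans ?_ (mem_star.1 he).2.symm
        rcases q3 with rfl | rfl
        exacts [X.near_rot r', (X.near_rot r').rot]
      have hS : ∀ e ∈ W.star d, e ∈ W.S := fun e he => (mem_star.1 he).1
      refine vertex_sum_of_matching (Z := fun d => α d + (B d + B (W.τ d))) (V := W.star d) (star_closed d) (θ := θ)
        (fun e he => ⟨star_closed d e he _ (hθ.near e (hS e he)), hθ.invol e (hS e he),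
          hθ.ne e (hS e he)⟩) (fun e he => hθ.near e (hS e he)) (fun e he => ?_)
        (mem_star.2 ⟨hd, .refl X d⟩)
      have hne : ∀ f, X.Near d f → ∀ r', W.SameFace x r' → X.Near r' f → r' = x :=
        fun f hf r' q1 q2 => hd' r' q1 (q2.trans hf.symm)
      have hde := (mem_star.1 he).2
      rw [A.partner e (hS e he) (hnc e he), hv e (hS e he) (hne e hde),
        hv _ (hθ.mem (hS e he)) (hne _ (hde.trans (hθ.near e (hS e he))))]
    · push Not at hd'
      obtain ⟨s, hs, hsd, hsx⟩ := hd'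
      have hsum := vertex_sum_near (Z := fun d => α d + (B d + B (W.τ d))) hsd
      rw [hsum]
      have hsS := hs.mem H.mem
      have hm := H.corner_of_ne s hs hsx
      rw [mate_opp_of_mate hm, hm]
      simp only [CellSystem.opp]
      obtain ⟨n1, n2, n3⟩ := H.not_sameFace_rot hs
      obtain ⟨k0, k1, k2, k3⟩ := H.heights hs hsx
      have hα0 : α s = 0 := A.eq_zero (by omega)
      have hα3 : α (X.rot (X.rot (X.rot s))) = 0 := A.eq_zero (by omega)
      have b1 := hB0 _ n1
      have b2 := hB0 _ n2
      have b3 := hB0 _ n3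
      have c0 := hBτ s hsS n1
      have c1 := hBτ _ (W.rot_mem hsS) n2
      have c2 := hBτ _ (W.rot_mem (W.rot_mem hsS)) n3
      have c3 : W.τ (X.rot (X.rot (X.rot s))) = W.facePerm s := (facePerm_apply hsS).symm
      have u1 : ∀ s', W.SameFace x s' → X.rot s ≠ X.rot (X.rot s') := fun s' hs' q => by
        have q' := X.rot_injective q
        exact (H.not_sameFace_rot hs').1 (q' ▸ hs)
      have u2 : ∀ s', W.SameFace x s' → X.rot (X.rot s) ≠ X.rot s' := fun s' hs' q => by
        have q' := X.rot_injective q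
        exact n1 (q' ▸ hs')
      have hα1 : α (X.rot s) = if e = X.rot r ∧ s = r then 1 else 0 := by
        rw [A.contact _ ⟨s, hs, hsx, .inl rfl⟩]
        have w1 := u1 _ hx1
        have w2 := u1 _ hr
        have := X.rot_injective.eq_iff (a := s) (b := r)
        refine if_congr ?_ rfl rfl
        clear * - this he w1 w2
        grind
      have hα2 : α (X.rot (X.rot s)) = if s = W.facePerm x ∨ (e = X.rot (X.rot r) ∧ s = r)
          then 1 else 0 := by
        rw [A.contact _ ⟨s, hs, hsx, .inr rfl⟩]
        have v1 := u2 _ hr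
        have v2 : X.rot (X.rot s) = X.rot (X.rot r) ↔ s = r := by
          rw [X.rot_injective.eq_iff, X.rot_injective.eq_iff]
        refine if_congr ?_ rfl rfl
        rw [X.rot_injective.eq_iff, X.rot_injective.eq_iff]
        clear * - v1 v2 he
        grind
      have hα12 : α (X.rot s) + α (X.rot (X.rot s)) =
          (if s = W.facePerm x then 1 else 0) + if s = r then 1 else 0 := by
        rw [hα1, hα2]
        have w1 := A.ne
        have w2 : X.rot r ≠ X.rot (X.rot r) := fun q => X.rot_ne _ q.symm
        clear * - w1 w2 he
        grind
      have j1 : W.faceIndex x s = 1 ↔ s = W.facePerm x :=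
        ⟨fun q => hs.faceIndex_inj hx1 (q.trans i1.symm), fun q => by rw [q, i1]⟩
      have j2 : W.faceIndex x s = W.faceIndex x r ↔ s = r :=
        ⟨fun q => hs.faceIndex_inj hr q, fun q => by rw [q]⟩
      have j0 : W.faceIndex x s ≠ 0 := fun q =>
        hsx (hs.faceIndex_inj (.refl x) (q.trans (faceIndex_self x).symm))
      have j0' : W.faceIndex x r ≠ 0 := fun q =>
        hrx (hr.faceIndex_inj (.refl x) (q.trans (faceIndex_self x).symm))
      have hBs : B s + B (W.facePerm s) =
          (if s = W.facePerm x then 1 else 0) + if s = r then 1 else 0 := by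
        simp only [← j1, ← j2]
        -- At the last corner before `x` the index drops to 0 instead of increasing.
        by_cases hl : W.facePerm s = x
        · rw [hl, hBx, hB]
          have l1 := hs.faceIndex_le_of_last hr hl
          have l2 : W.faceIndex x s ≠ 1 := fun q => h2 (by rw [← j1.1 q, hl])
          have l3 : (W.SameFace x s ∧ 2 ≤ W.faceIndex x s ∧ W.faceIndex x s ≤ W.faceIndex x r) ↔
            W.faceIndex x s = W.faceIndex x r := ⟨fun q => by omega, fun q => ⟨hs, by omega, by omega⟩⟩
          simp only [l2, l3, if_false, add_zero, zero_add]
        · have l1 := hs.faceIndex_succ hl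
          have l2 : W.SameFace x (W.facePerm s) := hs.trans (sameFace_facePerm s)
          simp only [hB, l1, hs, l2, true_and]
          generalize W.faceIndex x s = i at *
          generalize W.faceIndex x r = m at *
          split_ifs <;> first | omega | rfl
      rw [c3, hα0, hα3, b1, b2, b3, c0, c1, c2]
      rw [show 0 + (B s + 0) + (α (X.rot s) + (0 + 0)) + (α (X.rot (X.rot s)) + (0 + 0)) +
        (0 + (0 + B (W.facePerm s))) = (B s + B (W.facePerm s)) + (α (X.rot s) + α (X.rot (X.rot s)))
        by ring, hα12, hBs]
      clear * -
      grind
  · have q1 : B d = 0 := hB0 d fun q => hdx ((H.top d hd).2 (.inl q))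
    have q2 : B (W.τ d) = 0 := hBτ d hd fun q => hdx ((H.top d hd).2 (.inr q))
    rw [q1, q2, add_zero]

end FacialChain

end Wiring

/-! ### The Jordan curve argument -/

namespace Wiring

variable {D : Type*} {X : CellSystem D} {W : Wiring X}

theorem IsFaceColouring.eq_of_near {Z φ : D → ZMod 2} (hφ : W.IsFaceColouring Z φ) {d : D}
    (hd : d ∈ W.S) (hZ : ∀ e, X.Near d e → Z e = 0) {e : D} (he : X.Near d e) : φ e = φ d := by
  have e1 := (hφ d hd).1
  have e2 := (hφ _ (W.rot_mem hd)).1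
  have e3 := (hφ _ (W.rot_mem (W.rot_mem hd))).1
  rw [hZ _ (.refl X d), add_zero] at e1
  rw [hZ _ (X.near_rot d), add_zero, e1] at e2
  rw [hZ _ (X.near_rot d).rot, add_zero, e2] at e3
  rcases X.near_iff_rot.1 he with rfl | rfl | rfl | rfl
  exacts [rfl, e1, e2, e3]

namespace FacialChain

variable {x : D} {h : D → ℕ}

theorem eq_or_partner (H : W.FacialChain x h) {θ : D → D} (hθ : W.IsPartner x h θ) {d e : D}
    (hd : d ∈ W.S) (hdh : h d + 1 = h x) (hn : X.Near d e) (he : h e = h d) : e = d ∨ e = θ d := by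
  by_cases hx : X.Near x d
  · have h3 := H.almost.cell x (.refl X x)
    have m1 := X.mate_mate x
    have m4 := X.mate_mate (X.opp x)
    rw [hθ.cell d hx]
    have hxe := hx.trans hn
    rcases hx with rfl | rfl | rfl | rfl <;> rcases hxe with rfl | rfl | rfl | rfl <;> grind
  · exact (hθ.turn d hd hx e hn).1 he

variable [Finite D] [DecidableEq D]

/-- The second circuit visits its contacts with the first one in their order on the face. -/
theorem arc_right (H : W.FacialChain x h) (hP : W.Planar) {θ : D → D} (hθ : W.IsPartner x h θ)
    (h1 : W.facePerm x ≠ x) (h2 : W.facePerm (W.facePerm x) ≠ x) {e : D} {α : D → ZMod 2}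
    (A : IsArc W x h θ (X.rot (X.rot (W.facePerm x))) e α) :
    e = X.rot (W.facePerm (W.facePerm x)) := by
  classical
  by_contra hcon
  obtain ⟨r, hr, hrx, he⟩ := A.right
  obtain ⟨B, hB, hZ, hBt, hBv⟩ := H.even_arc hθ h1 h2 A hr hrx he
  obtain ⟨φ, hφ⟩ := hP _ hZ
  have hφ' : ∀ d ∈ W.S, φ (X.rot d) = φ d + (α d + (B d + B (W.τ d))) := fun d hd => (hφ d hd).1
  set q := X.rot (X.rot (W.facePerm x)) with hq
  have hx1 : W.SameFace x (W.facePerm x) := sameFace_facePerm x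
  have hx2 : W.SameFace x (W.facePerm (W.facePerm x)) := hx1.trans (sameFace_facePerm _)
  have i1 : W.faceIndex x (W.facePerm x) = 1 := by
    rw [(SameFace.refl x).faceIndex_succ h1, faceIndex_self]
  have i2 : W.faceIndex x (W.facePerm (W.facePerm x)) = 2 := by rw [hx1.faceIndex_succ h2, i1]
  have d12 : W.facePerm (W.facePerm x) ≠ W.facePerm x := fun q => h1 (W.facePerm.injective q)
  have hqc := H.contact_height A.left
  have hαq : α q = 1 := by rw [A.contact q A.left]; simp
  have hαe : α e = 1 := by rw [A.contact e A.right]; simp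
  have hα2 : W.facePerm (W.facePerm x) ≠ r → α (X.rot (W.facePerm (W.facePerm x))) ≠ 1 := by
    intro hr2 hα
    rw [A.contact _ ⟨_, hx2, h2, .inl rfl⟩] at hα
    simp only [ite_eq_left_iff, zero_ne_one, imp_false, not_not] at hα
    rcases hα with hα | hα
    · exact (H.not_sameFace_rot hx1).1 (X.rot_injective hα ▸ hx2)
    · exact hcon hα.symm
  -- The second circuit is a single circuit, so it leads from the first contact at the second vertex
  -- to `q`; no property kept along it can hold there and fail at `q`.
  have hreach : ∀ Y : D → Prop, ¬ Y q → (∀ d ∈ W.S, h d + 1 = h x → Y d → Y (W.τ d)) →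
      (∀ d ∈ W.S, h d + 1 = h x → Y d → Y (θ d)) →
      ¬ Y (X.rot (W.facePerm (W.facePerm x))) := by
    intro Y hY hYτ hYθ hY2
    have c2 := H.contact_height ⟨_, hx2, h2, .inl rfl⟩
    exact hY (hθ.circ_induction H.almost (H.circ _ c2.1 _ hqc.1 (by omega)) c2.1 hY2
      (fun d hd hdh => hYτ d hd (by omega)) (fun d hd hdh => hYθ d hd (by omega)))
  -- An arc returning to its first vertex closes up to the whole second circuit and misses the
  -- contacts at the second vertex.
  by_cases hr1 : r = W.facePerm x
  · have her : e = X.rot r := he.resolve_right fun q' => A.ne (by rw [q', hr1])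
    refine hreach (fun d => α d ≠ 1) (by simp [hαq]) (fun d hd _ => by rw [A.edge d hd]; exact id) ?_
      (hα2 (by rw [hr1]; exact d12))
    intro d hd _ hα hα'
    by_cases hc : W.Contact x d
    · obtain ⟨p1, p2⟩ := H.partner_rot hθ hr hrx
      rw [A.contact _ (H.contact_partner hθ hc)] at hα'
      rw [A.contact _ hc] at hα
      have := hθ.invol d hd
      grind
    · rw [A.partner d hd hc] at hα'
      exact hα hα'
  -- The part of the second circuit off the arc that runs inside the region cut off by the arc and
  -- the face edges up to `r`, on the side with the colour opposite to `φ x`.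
  set Y : D → Prop := fun d => d ∈ W.S ∧ h d + 1 = h x ∧ α d ≠ 1 ∧ φ d = φ x + 1 with hY
  have hz : ∀ z : ZMod 2, z ≠ 1 → z = 0 := by decide
  have hφr : ∀ s, W.SameFace x s → φ s = φ x := fun s hs => (hφ.eq hs H.mem).symm
  have hYτ : ∀ d ∈ W.S, h d + 1 = h x → Y d → Y (W.τ d) := by
    rintro d - - ⟨y1, y2, y3, y4⟩
    refine ⟨W.τ_mem y1, by rw [H.almost.edge d y1, y2], by rwa [A.edge d y1], ?_⟩
    rw [(hφ d y1).2, hφ' d y1, hz _ y3, hBt d y1 (by omega), y4, add_zero, add_zero]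
  have hir : 2 ≤ W.faceIndex x r := by
    have q0 : W.faceIndex x r ≠ 0 := fun q' =>
      hrx (hr.faceIndex_inj (.refl x) (q'.trans (faceIndex_self x).symm))
    have q1 : W.faceIndex x r ≠ 1 := fun q' => hr1 (hr.faceIndex_inj hx1 (q'.trans i1.symm))
    omega
  have hφrot : ∀ s, W.SameFace x s → φ (X.rot s) = φ x + B s := by
    intro s hs
    have hsS := hs.mem H.mem
    have q0 : α s = 0 := A.eq_zero (by
      have := (H.top s hsS).2 (.inl hs)
      omega)
    have q1 : B (W.τ s) = 0 := by
      rw [hB, if_neg]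
      exact fun q' => (H.not_sameFace_rot hs).1 (q'.1.trans (sameFace_rot_τ hsS).symm)
    rw [hφ' s hsS, q0, q1, hφr s hs, zero_add, add_zero]
  have hφrot2 : ∀ s, W.SameFace x s → s ≠ x → φ (X.rot (X.rot s)) = φ (X.rot s) + α (X.rot s) := by
    intro s hs hsx
    have hsS := hs.mem H.mem
    rw [hφ' _ (W.rot_mem hsS), hBt _ (W.rot_mem hsS) (by have := H.heights hs hsx; omega), add_zero]
  -- The circuit can leave the region only at an end of the arc. This happens only when the arc ends
  -- in the second inner dart of `r`; then the first one lies inside.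
  have hYθ : ∀ d ∈ W.S, (e = X.rot (X.rot r) → d ≠ X.rot r) → Y d → Y (θ d) := by
    rintro d - hdr ⟨y1, y2, y3, y4⟩
    by_cases hc : W.Contact x d
    · have hc' := H.contact_partner hθ hc
      have hch := H.contact_height hc'
      obtain ⟨s, hs, hsx, hds⟩ := hc
      obtain ⟨p1, p2⟩ := H.partner_rot hθ hs hsx
      have f1 := hφrot s hs
      have f2 := hφrot2 s hs hsx
      by_cases hs1 : s = W.facePerm x
      · have b1 : B s = 0 := by rw [hB, if_neg]; rw [hs1, i1]; omega
        rcases hds with rfl | rfl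
        · rw [f1, b1] at y4
          exact absurd y4 (by clear * -; grind)
        · exact absurd (hs1 ▸ hαq) y3
      by_cases hsr : s = r
      · have br : B r = 1 := by rw [hB, if_pos]; exact ⟨hr, hir, le_rfl⟩
        subst hsr
        rcases he with he | he <;> rcases hds with rfl | rfl
        · exact absurd (he ▸ hαe) y3
        · rw [f2, f1, br, ← he, hαe] at y4
          exact absurd y4 (by clear * -; grind)
        · exact absurd rfl (hdr he)
        · exact absurd (he ▸ hαe) y3
      have a1 : ∀ f, W.Contact x f → X.Near s f → α f = 0 := by
        intro f hf hn
        rw [A.contact f hf, if_neg]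
        rintro (rfl | rfl)
        · exact hs1 (H.unique _ _ hx1 hs (((X.near_rot _).rot).trans hn.symm))
        · have : X.Near r f := by
            rcases he with rfl | rfl
            exacts [X.near_rot r, (X.near_rot r).rot]
          exact hsr (H.unique _ _ hr hs (this.trans hn.symm))
      have hns : X.Near s d := by
        rcases hds with rfl | rfl
        exacts [X.near_rot s, (X.near_rot s).rot]
      refine ⟨hch.1, hch.2.1, by rw [a1 _ hc' (hns.trans (hθ.near d y1))]; exact zero_ne_one, ?_⟩
      rw [a1 _ ⟨s, hs, hsx, .inl rfl⟩ (X.near_rot s), add_zero] at f2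
      rcases hds with rfl | rfl
      · rw [p1, f2, y4]
      · rw [p2, ← f2, y4]
    · refine ⟨hθ.mem y1, by rw [hθ.colour d y1, y2], by rwa [A.partner d y1 hc], ?_⟩
      rw [hφ.eq_of_near y1 (fun f hf => ?_) (hθ.near d y1), y4]
      have b0 : B f + B (W.τ f) = 0 := by
        refine hBv f (W.near_mem d y1 f hf) fun r' q1 q2 => ?_
        by_contra q3
        exact hc (H.contact_of_near q1 q3 (q2.trans hf.symm) y2)
      have a0 : α f = 0 := by
        by_cases q0 : h f + 1 = h x
        · rcases H.eq_or_partner hθ y1 y2 hf (by omega) with rfl | rfl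
          · exact hz _ y3
          · rw [A.partner d y1 hc]; exact hz _ y3
        · exact A.eq_zero q0
      simp only [a0, b0, add_zero]
  -- In this case exactly one turn, at `X.rot r`, leaves the region, against `parity`. Otherwise the
  -- second vertex lies strictly before `r`, and the circuit starting there is trapped in the region
  -- without reaching `q`.
  by_cases her : e = X.rot (X.rot r)
  · have hrc : W.Contact x (X.rot r) := ⟨r, hr, hrx, .inl rfl⟩
    have hrS := (H.contact_height hrc).1
    have hp := (H.partner_rot hθ hr hrx).1
    have key := hθ.parity (Y := fun d => if Y d then 1 else 0) (fun d hd => ?_) hrS (fun d hd q1 q2 => ?_)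
    · rw [hp, if_neg (fun q' => q'.2.2.1 (her ▸ hαe)), if_pos] at key
      · exact zero_ne_one key
      · refine ⟨hrS, (H.contact_height hrc).2.1, ?_, ?_⟩
        · rw [A.contact _ hrc, if_neg]
          · exact zero_ne_one
          · rintro (q1 | q1)
            · exact (H.not_sameFace_rot hx1).1 (X.rot_injective q1 ▸ hr)
            · rw [her] at q1
              exact X.rot_ne _ q1.symm
        · rw [hφrot r hr, hB, if_pos ⟨hr, hir, le_rfl⟩]
    · have h1 : Y (W.τ d) → Y d := fun y => by
        have := hYτ _ y.1 y.2.1 y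
        rwa [W.τ_τ hd] at this
      exact if_congr ⟨h1, fun y => hYτ d hd y.2.1 y⟩ rfl rfl
    · have h1 : Y (θ d) → Y d := fun y => by
        have := hYθ _ y.1 (fun _ q3 => q2 (by rw [← q3, hθ.invol d hd])) y
        rwa [hθ.invol d hd] at this
      exact if_congr ⟨h1, hYθ d hd (fun _ => q1)⟩ rfl rfl
  · have her' := he.resolve_right her
    have hr2 : W.facePerm (W.facePerm x) ≠ r := fun q' => hcon (by rw [her', q'])
    refine hreach Y (fun y => y.2.2.1 hαq) hYτ (fun d hd _ => hYθ d hd fun q' => absurd q' her) ?_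
    have c2 := H.contact_height ⟨_, hx2, h2, .inl rfl⟩
    refine ⟨c2.1, c2.2.1, hα2 hr2, ?_⟩
    rw [hφrot _ hx2, hB, if_pos]
    exact ⟨hx2, i2.ge, by rw [i2]; exact hir⟩

end FacialChain

end Wiring

/-! ### Exchanging an arc with a face edge -/

namespace Wiring

variable {D : Type*} {X : CellSystem D} {W : Wiring X}

theorem proper_of_alternating {c : D → ℕ} {s d : D} (hs : X.mate s = X.rot s) (hn : X.Near s d)
    (h1 : c (X.rot (X.rot s)) = c s) (h2 : c (X.rot (X.rot (X.rot s))) = c (X.rot s))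
    (h3 : c (X.rot s) ≠ c s) : Proper X c d := by
  have hs' := mate_opp_of_mate hs
  have m1 := X.mate_mate s
  have m2 := X.mate_mate (X.rot (X.rot s))
  have m3 := X.rot_four s
  unfold CellSystem.opp at hs'
  rcases X.near_iff_rot.1 hn with rfl | rfl | rfl | rfl <;> constructor <;>
    (try unfold CellSystem.opp) <;> grind

namespace FacialChain

variable {x : D} {h : D → ℕ} [Finite D] [DecidableEq D]

/-- The colouring obtained by exchanging an arc of the second circuit with the edge of `g` on the
first one. -/
def swap (W : Wiring X) (x : D) (h : D → ℕ) (g : D) (α : D → ZMod 2) (d : D) : ℕ :=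
  if d = g ∨ d = W.τ g then h x - 1 else if α d = 1 then h x else h d

-- At each end of the exchanged edge one boundary dart and one contact trade colours, so the two
-- colours alternate around the vertex. At all other vertices the arc runs along whole strands, and
-- where it is recoloured away from the face boundary the colour `h x` does not occur yet.
set_option maxHeartbeats 1000000 in
theorem swap_almost (H : W.FacialChain x h) {θ : D → D} (hθ : W.IsPartner x h θ)
    (h1 : W.facePerm x ≠ x) (h2 : W.facePerm (W.facePerm x) ≠ x) {α : D → ZMod 2}
    (A : IsArc W x h θ (X.rot (X.rot (W.facePerm x))) (X.rot (W.facePerm (W.facePerm x))) α) :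
    W.AlmostColouring x (swap W x h (X.rot (X.rot (X.rot (W.facePerm x)))) α) ∧
      swap W x h (X.rot (X.rot (X.rot (W.facePerm x)))) α (W.facePerm (W.facePerm x)) + 1 = h x ∧
      swap W x h (X.rot (X.rot (X.rot (W.facePerm x)))) α (W.facePerm x) = h x := by
  obtain ⟨a, ha⟩ : ∃ a, a = W.facePerm x := ⟨_, rfl⟩
  obtain ⟨b, hb⟩ : ∃ b, b = W.facePerm a := ⟨_, rfl⟩
  have hxa : W.SameFace x a := ha ▸ sameFace_facePerm x
  have hxb : W.SameFace x b := hxa.trans (hb ▸ sameFace_facePerm a)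
  have hab : b ≠ a := fun q => h1 (W.facePerm.injective (by rw [← ha, ← hb, q]))
  rw [← ha, ← hb] at A h2
  rw [← ha] at h1
  rw [← ha, ← hb]
  have haS := hxa.mem H.mem
  have hbS := hxb.mem H.mem
  set g := X.rot (X.rot (X.rot a)) with hg
  have hτg : W.τ g = b := by rw [hb, facePerm_apply haS]
  have hgS : g ∈ W.S := W.rot_mem (W.rot_mem (W.rot_mem haS))
  have hna : X.Near a g := (X.near_rot a).rot.rot
  have hpos := H.pos
  set h' := swap W x h g α with hh'
  have hdef : ∀ d, h' d = if d = g ∨ d = b then h x - 1 else if α d = 1 then h x else h d :=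
    fun d => by rw [hh', swap, hτg]
  clear_value h'
  have nxa : ¬ X.Near x a := H.not_near hxa h1
  have nxb : ¬ X.Near x b := H.not_near hxb h2
  have nab : ¬ X.Near a b := fun q => hab (H.unique a b hxa hxb q)
  have hz : ∀ z : ZMod 2, z ≠ 1 → z = 0 := by decide
  obtain ⟨a0, a1, a2, a3⟩ := H.heights hxa h1
  obtain ⟨b0, b1, b2, b3⟩ := H.heights hxb h2
  have near_ne : ∀ {s f f' : D}, X.Near s f → ¬ X.Near s f' → f ≠ f' := fun q q' e => q' (e ▸ q)
  have αne : ∀ f, h f + 1 ≠ h x → α f ≠ 1 := fun f hf q => hf (A.height f q).2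
  have va0 : h' a = h x := by
    rw [hdef, if_neg, if_neg (αne _ (by omega)), a0]
    exact not_or.2 ⟨fun q => X.rot_three_ne a q.symm, hab.symm⟩
  have va1 : h' (X.rot a) = h x - 1 := by
    rw [hdef, if_neg, if_neg]
    · omega
    · rw [A.contact _ ⟨a, hxa, h1, .inl rfl⟩, if_neg]
      · exact zero_ne_one
      · rintro (q | q)
        · exact X.rot_ne _ q.symm
        · exact hab (X.rot_injective q).symm
    · exact not_or.2 ⟨fun q => X.rot_two_ne _ q.symm, near_ne (X.near_rot a) nab⟩
  have va2 : h' (X.rot (X.rot a)) = h x := by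
    rw [hdef, if_neg, if_pos]
    · rw [A.contact _ A.left, if_pos (.inl rfl)]
    · exact not_or.2 ⟨fun q => X.rot_ne _ q.symm, near_ne (X.near_rot a).rot nab⟩
  have va3 : h' g = h x - 1 := by rw [hdef, if_pos (.inl rfl)]
  have vb0 : h' b = h x - 1 := by rw [hdef, if_pos (.inr rfl)]
  have ng : ∀ f, X.Near b f → f ≠ g := fun f hf q => nab (hna.trans (q ▸ hf.symm))
  have vb1 : h' (X.rot b) = h x := by
    rw [hdef, if_neg, if_pos]
    · rw [A.contact _ A.right, if_pos (.inr rfl)]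
    · exact not_or.2 ⟨ng _ (X.near_rot b), X.rot_ne _⟩
  have vb2 : h' (X.rot (X.rot b)) = h x - 1 := by
    rw [hdef, if_neg, if_neg]
    · omega
    · rw [A.contact _ ⟨b, hxb, h2, .inr rfl⟩, if_neg]
      · exact zero_ne_one
      · rintro (q | q)
        · exact hab (X.rot_injective (X.rot_injective q))
        · exact X.rot_ne _ q
    · exact not_or.2 ⟨ng _ (X.near_rot b).rot, X.rot_two_ne _⟩
  have vb3 : h' (X.rot (X.rot (X.rot b))) = h x := by
    rw [hdef, if_neg, if_neg (αne _ (by omega)), b3]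
    exact not_or.2 ⟨ng _ (X.near_rot b).rot.rot, X.rot_three_ne _⟩
  refine ⟨⟨fun d hd => ?_, fun d hd hn => ?_, fun d hd => ?_⟩, by omega, va0⟩
  · have hτd : (W.τ d = g ∨ W.τ d = b) ↔ (d = g ∨ d = b) := by
      have q1 := W.τ_τ hd
      have q2 := W.τ_τ hgS
      rw [hτg] at q2
      clear * - q1 q2 hτg
      grind
    rw [hdef, hdef, A.edge d hd, H.almost.edge d hd]
    exact if_congr hτd rfl rfl
  · by_cases hda : X.Near a d
    · exact proper_of_alternating (H.corner_of_ne a hxa h1) hda (by rw [va2, va0])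
        (by rw [← hg, va3, va1]) (by omega)
    by_cases hdb : X.Near b d
    · exact proper_of_alternating (H.corner_of_ne b hxb h2) hdb (by rw [vb2, vb0])
        (by rw [vb3, vb1]) (by omega)
    have hdef' : ∀ f, X.Near d f → h' f = if α f = 1 then h x else h f := by
      intro f hf
      rw [hdef, if_neg]
      rintro (rfl | rfl)
      · exact hda (hna.trans hf.symm)
      · exact hdb hf.symm
    have hp := H.almost.proper d hd hn
    by_cases hs : ∃ s, W.SameFace x s ∧ X.Near d s
    · obtain ⟨s, hs, hsd⟩ := hs
      have hsx : s ≠ x := fun q => hn (q ▸ hsd).symm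
      refine proper_congr (fun f hf => ?_) hp
      rw [hdef' f hf, if_neg]
      intro q
      have hc := H.contact_of_near hs hsx (hsd.symm.trans hf) (A.height f q).2
      rw [A.contact f hc] at q
      simp only [ite_eq_left_iff, zero_ne_one, imp_false, not_not] at q
      rcases q with rfl | rfl
      · exact hda ((X.near_rot a).rot.trans hf.symm)
      · exact hdb ((X.near_rot b).trans hf.symm)
    · have hht : ∀ f, X.Near d f → h f ≠ h x := by
        intro f hf q
        rcases (H.top f (W.near_mem d hd f hf)).1 q with q | q
        · exact hs ⟨f, q, hf⟩
        · exact hs ⟨_, q, hf.rot⟩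
      have hnc : ¬ W.Contact x d := by
        rintro ⟨s, q1, -, rfl | rfl⟩
        · exact hs ⟨s, q1, (X.near_rot s).symm⟩
        · exact hs ⟨s, q1, (X.near_rot s).rot.symm⟩
      have heq : ∀ f, X.Near d f → h f = h d → α f = α d := by
        intro f hf q
        rcases (hθ.turn d hd hn f hf).1 q with rfl | rfl
        · rfl
        · exact A.partner d hd hnc
      have t0 := hdef' d (.refl X d)
      have t1 := hdef' _ (X.near_mate d)
      have t2 := hdef' _ (X.near_opp d)
      have t3 := hdef' _ (X.near_opp d).mate
      have u0 := hht d (.refl X d)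
      have u1 := hht _ (X.near_mate d)
      have v2 := heq _ (X.near_opp d)
      have v3 := heq _ (X.near_opp d).mate
      have w0 := A.height d
      have w1 := A.height (X.mate d)
      obtain ⟨p1, p2⟩ := hp
      clear * - t0 t1 t2 t3 u0 u1 v2 v3 p1 p2 w0 w1
      constructor <;> grind
  · have hne : ∀ f, X.Near x f → ¬ (f = g ∨ f = b) := by
      rintro f hf (rfl | rfl)
      · exact nxa (hf.trans hna.symm)
      · exact nxb hf
    have hdS := W.near_mem x H.mem d hd
    have q1 := A.partner d hdS fun q => (H.contact_height q).2.2 hd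
    rw [hθ.cell d hd] at q1
    rw [hdef, hdef, if_neg (hne _ hd), if_neg (hne _ hd.mate), q1, H.almost.cell d hd]

end FacialChain

end Wiring

namespace Wiring

variable {D : Type*} {X : CellSystem D} {W : Wiring X}

namespace FacialChain

variable {x : D} {h : D → ℕ} [Finite D] [DecidableEq D]

theorem swap_of_arc (H : W.FacialChain x h)
    (h1 : W.facePerm x ≠ x) (h2 : W.facePerm (W.facePerm x) ≠ x) {θ : D → D} {α : D → ZMod 2}
    (A : IsArc W x h θ (X.rot (X.rot (W.facePerm x))) (X.rot (W.facePerm (W.facePerm x))) α)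
    {d : D} (hd : α d = 1) : swap W x h (X.rot (X.rot (X.rot (W.facePerm x)))) α d = h x := by
  have hx1 : W.SameFace x (W.facePerm x) := sameFace_facePerm x
  have hx2 : W.SameFace x (W.facePerm (W.facePerm x)) := hx1.trans (sameFace_facePerm _)
  have hd' := (A.height d hd).2
  rw [swap, ← facePerm_apply (hx1.mem H.mem), if_neg, if_pos hd]
  rintro (rfl | rfl)
  · have := (H.heights hx1 h1).2.2.2
    omega
  · have := (H.heights hx2 h2).1
    omega

/-- The arc belongs to the first circuit after the exchange. -/
theorem circ_of_arc (H : W.FacialChain x h) {θ : D → D} (hθ : W.IsPartner x h θ)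
    (h1 : W.facePerm x ≠ x) (h2 : W.facePerm (W.facePerm x) ≠ x) {α : D → ZMod 2}
    (A : IsArc W x h θ (X.rot (X.rot (W.facePerm x))) (X.rot (W.facePerm (W.facePerm x))) α)
    {d : D} (hd : α d = 1) :
    W.Circ x (swap W x h (X.rot (X.rot (X.rot (W.facePerm x)))) α)
      (X.rot (X.rot (W.facePerm x))) d := by
  classical
  by_contra hcon
  have hsw := fun {f} => H.swap_of_arc h1 h2 A (d := f)
  set h' := swap W x h (X.rot (X.rot (X.rot (W.facePerm x)))) α
  set q := X.rot (X.rot (W.facePerm x)) with hq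
  obtain ⟨e, he⟩ : ∃ e, e = X.rot (W.facePerm (W.facePerm x)) := ⟨_, rfl⟩
  have hx1 : W.SameFace x (W.facePerm x) := sameFace_facePerm x
  have hx2 : W.SameFace x (W.facePerm (W.facePerm x)) := hx1.trans (sameFace_facePerm _)
  have d12 : W.facePerm (W.facePerm x) ≠ W.facePerm x := fun q => h1 (W.facePerm.injective q)
  rw [← he] at A
  -- The part of the arc missed by the new circuit. If it contained the end `e`, this would be its
  -- only end, against `parity`; if not, it would be closed along the second circuit and hence
  -- contain `q`.
  set T : D → Prop := fun f => α f = 1 ∧ ¬ W.Circ x h' q f with hT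
  have hTS : ∀ f, T f → f ∈ W.S := fun f hf => (A.height f hf.1).1
  have hTτ : ∀ f, T f → T (W.τ f) := by
    intro f hf
    have hfS := hTS f hf
    refine ⟨by rw [A.edge f hfS, hf.1], fun hc => hf.2 ?_⟩
    have := hc.edge (W.τ_mem hfS)
    rwa [W.τ_τ hfS] at this
  have hTθ : ∀ f, ¬ W.Contact x f → T f → T (θ f) := by
    intro f hnc hf
    have hfS := hTS f hf
    have hα : α (θ f) = 1 := by rw [A.partner f hfS hnc, hf.1]
    refine ⟨hα, fun hc => hf.2 ?_⟩
    by_cases hn : X.Near x f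
    · rw [hθ.cell f hn] at hc
      have := hc.cell hn.mate
      rwa [X.mate_mate] at this
    · exact hc.turn (hθ.mem hfS) (fun q => hn (q.trans (hθ.near f hfS).symm)) (hθ.near f hfS).symm
        (by rw [hsw hf.1, hsw hα])
  have hTc : ∀ f, W.Contact x f → T f → f = e := by
    intro f hc hf
    have := hf.1
    rw [A.contact f hc] at this
    simp only [ite_eq_left_iff, zero_ne_one, imp_false, not_not] at this
    rcases this with rfl | rfl
    · exact absurd .refl hf.2
    · rfl
  have heS := (H.contact_height A.right).1
  by_cases hTe : T e
  · have hθe : ¬ T (θ e) := fun hc => hθ.ne e heS (hTc _ (H.contact_partner hθ A.right) hc)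
    have hstep : ∀ f ∈ W.S, f ≠ e → T f → T (θ f) := fun f hf hfe hTf => by
      by_cases hc : W.Contact x f
      · exact absurd (hTc f hc hTf) hfe
      · exact hTθ f hc hTf
    have key := hθ.parity (Y := fun d => if T d then 1 else 0) (fun d hd => ?_) heS (fun d hd q1 q2 => ?_)
    · rw [if_pos hTe, if_neg hθe] at key
      exact zero_ne_one key
    · have h1 : T (W.τ d) → T d := fun y => by
        have := hTτ _ y
        rwa [W.τ_τ hd] at this
      exact if_congr ⟨h1, hTτ d⟩ rfl rfl
    · have h1 : T (θ d) → T d := fun y => by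
        have := hstep _ (hTS _ y) (fun q3 => q2 (by rw [← q3, hθ.invol d hd])) y
        rwa [hθ.invol d hd] at this
      exact if_congr ⟨h1, hstep d hd q1⟩ rfl rfl
  · have hTnc : ∀ f, T f → ¬ W.Contact x f := fun f hf hc => hTe (hTc f hc hf ▸ hf)
    have hdd := A.height d hd
    have hqq := H.contact_height A.left
    have := hθ.circ_induction H.almost (Y := T) (H.circ d hdd.1 q hqq.1 (by omega)) hdd.1 ⟨hd, hcon⟩
      (fun f _ _ hf => hTτ f hf) (fun f _ _ hf => hTθ f (hTnc f hf) hf)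
    exact this.2 .refl

/-- After the exchange the first circuit runs from `x` through the whole arc. Wherever the arc meets
another circuit, it gives a shortcut from the top of the chain past the new second circuit. -/
theorem colourable_of_two_lt (H : W.FacialChain x h) (hP : W.Planar) (hB : W.Bridgeless)
    (ih : W.SmallerColourable) (h1 : W.facePerm x ≠ x) (h2 : W.facePerm (W.facePerm x) ≠ x) :
    W.Colourable := by
  obtain ⟨θ, hθ⟩ := H.almost.exists_isPartner
  have hx1 : W.SameFace x (W.facePerm x) := sameFace_facePerm x
  obtain ⟨e, α, A⟩ := H.exists_arc hθ (q := X.rot (X.rot (W.facePerm x))) ⟨_, hx1, h1, .inr rfl⟩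
  obtain rfl := H.arc_right hP hθ h1 h2 A
  obtain ⟨hc, hb, ha⟩ := H.swap_almost hθ h1 h2 A
  have hsw := fun {f} => H.swap_of_arc h1 h2 A (d := f)
  have hα := fun {f} => H.circ_of_arc hθ h1 h2 A (d := f)
  have hαq : α (X.rot (X.rot (W.facePerm x))) = 1 := by rw [A.contact _ A.left, if_pos (.inl rfl)]
  have hx2 : W.SameFace x (W.facePerm (W.facePerm x)) := hx1.trans (sameFace_facePerm _)
  have d12 : W.facePerm (W.facePerm x) ≠ W.facePerm x := fun q => h1 (W.facePerm.injective q)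
  have hxS := H.mem
  have haS := hx1.mem H.mem
  have hbS := hx2.mem H.mem
  set g := X.rot (X.rot (X.rot (W.facePerm x))) with hg
  have hgS : g ∈ W.S := W.rot_mem (W.rot_mem (W.rot_mem haS))
  have hτg : W.τ g = W.facePerm (W.facePerm x) := (facePerm_apply haS).symm
  have hpos := H.pos
  have hgh := (H.heights hx1 h1).2.2.2
  have hbh := (H.heights hx2 h2).1
  have hdef : ∀ d, h d ≠ h x → α d ≠ 1 → swap W x h g α d = h d := by
    intro d q1 q2
    rw [swap, if_neg, if_neg q2]
    rintro (rfl | rfl)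
    · exact q1 hgh
    · rw [hτg] at q1
      exact q1 hbh
  have hcirc : W.Circ x (swap W x h g α) x (X.rot (X.rot (W.facePerm x))) := by
    have c1 : W.Circ x (swap W x h g α) x (W.facePerm x) := by
      rw [facePerm_apply hxS, ← H.corner]
      exact (Circ.refl.cell (.refl X x)).edge (W.mate_mem hxS)
    exact c1.turn haS (H.not_near hx1 h1) (X.near_opp _) (by rw [hsw hαq, ha])
  have hsx : swap W x h g α x = h x := by
    rw [← hc.circ_eq hcirc, hsw hαq]
  -- The arc passes through the other cell of `x`, so both strands of `x` now lie on one circuit.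
  by_cases hy : α (X.opp x) = 1
  · exact hc.colourable_of_circ hxS (hcirc.trans (hα hy))
  by_cases hd : ∃ d, α d = 1 ∧ ¬ W.Contact x d
  · obtain ⟨d, hd, hdc⟩ := hd
    obtain ⟨hdS, hdh⟩ := A.height d hd
    have hn : ¬ X.Near x d := by
      intro hn
      have hcell := H.almost.cell x (.refl X x)
      have hα2 : α (X.mate (X.opp x)) = α (X.opp x) := by
        rw [← hθ.cell _ (X.near_opp x), A.partner _ (W.opp_mem hxS)]
        exact fun q => (H.contact_height q).2.2 (X.near_opp x)
      rcases hn with rfl | rfl | rfl | rfl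
      · omega
      · omega
      · exact hy hd
      · exact hy (hα2 ▸ hd)
    -- The arc crosses the third circuit here. From it the other cell of `x` is reached at heights
    -- at most `h x - 2`, so the new circuit of colour `h x - 1`, which contains the exchanged edge,
    -- is avoided. In particular `h x ≥ 2`, and that colour does not occur at `x`.
    have hs : h (X.mate d) + 2 = h x := by
      have := H.site d hdS hn
      have : h (X.mate d) ≠ h x := fun q => hdc (H.contact_of_mate hdS hn q hdh)
      omega
    have hO : ∀ d e, ¬ X.Near x d → X.Near d e → ¬ X.Near x e := fun d e h h' h'' =>
      h (h''.trans h'.symm)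
    have c1 := hc.conn_of_circ (T := fun f => swap W x h g α f + 1 ≠ h x) (hcirc.trans (hα hd))
      (fun f _ hf => by omega)
    have c2 := (H.conn (h x - 2) (X.mate d) (W.mate_mem hdS) (by omega)).mono
      (T' := fun f => swap W x h g α f + 1 ≠ h x) (fun f hf => by
        have : α f ≠ 1 := fun q => by
          have := (A.height f q).2
          omega
        rw [hdef f (by omega) this]
        omega) fun _ => id
    obtain ⟨Z, z1, z2, z3⟩ := (c1.mate.trans c2).exists_even
      (fun f hf hT => by rw [hc.edge f hf]; exact hT) hO
    have hopp : swap W x h g α (X.opp x) = 0 := by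
      rw [hdef _ (by rw [H.zero]; omega) hy, H.zero]
    refine hc.colourable_of_avoid hxS hP ih hbS (by omega) (by omega) z1
      (fun f hf hfb => z2 f hf (not_not.2 (by omega))) ?_
    rw [z3 x hxS (fun q => q (.refl X x)), if_pos (.refl X x)]
  -- All darts of the arc are contacts, so the arc is a single edge. It and the exchanged edge join
  -- a cell of the first vertex to a cell of the second, so both cells are split by the same even
  -- sets.
  · push Not at hd
    have hqS := (H.contact_height A.left).1
    have hτq : W.τ (X.rot (X.rot (W.facePerm x))) = X.rot (W.facePerm (W.facePerm x)) := by
      have q1 : α (W.τ (X.rot (X.rot (W.facePerm x)))) = 1 := by rw [A.edge _ hqS, hαq]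
      have q2 := q1
      rw [A.contact _ (hd _ q1)] at q2
      simp only [ite_eq_left_iff, zero_ne_one, imp_false, not_not] at q2
      exact q2.resolve_left (W.τ_ne hqS)
    have hma := mate_opp_of_mate (H.corner_of_ne _ hx1 h1)
    have hmb := H.corner_of_ne _ hx2 h2
    have hmg : X.mate g = X.rot (X.rot (W.facePerm x)) := by
      have := X.mate_mate (X.opp (W.facePerm x))
      rwa [hma] at this
    refine colourable_of_parallel hP hB ih (x := g) (e := W.facePerm (W.facePerm x)) hgS hbS
      (fun q => d12 (H.unique _ _ hx1 hx2 (((X.near_rot _).rot.rot).trans q))) fun Z hZ => ?_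
    rw [hmg, hmb, ← hτq, ← hτg, hZ.edge _ hgS, hZ.edge _ hqS]

end FacialChain

end Wiring

/-! ### Faces of length two, and the induction -/

namespace Wiring

variable {D : Type*} {X : CellSystem D} {W : Wiring X}

/-- The case of a face of length two. -/
theorem colourable_of_digon [DecidableEq D] (hP : W.Planar) (hB : W.Bridgeless)
    (ih : W.SmallerColourable) {x a : D} (hx : x ∈ W.S) (hxa : W.τ (X.mate x) = a)
    (hax : W.τ (X.mate (X.opp a)) = x) (hn : ¬ X.Near x a) : W.Colourable := by
  have ha : a ∈ W.S := hxa ▸ W.τ_mem (W.mate_mem hx)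
  by_cases hpar : ∃ e ∈ W.S, ¬ X.Near a e ∧ ∀ Z, W.Even Z → Z a + Z (X.mate a) = Z e + Z (X.mate e)
  · obtain ⟨e, he, hne, hpar⟩ := hpar
    exact colourable_of_parallel hP hB ih ha he hne hpar
  push Not at hpar
  have hV := star_closed (W := W) a
  have hVS : W.star a ⊆ W.S := Finset.filter_subset _ _
  -- Smooth `a` along its cells. A set survives when it does not split the cells of `a`; as no
  -- vertex is parallel to `a`, one such set splits any given other cell.
  obtain ⟨W', hS', hP', hE', hC'⟩ := W.exists_reduction (V := W.star a) (K := ∅) (θ := X.mate) hVS hV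
    (Finset.empty_subset _) (by simp) (fun d hd => ⟨hV d hd _ (X.near_mate d), X.mate_mate d,
      X.mate_ne d⟩) (by simp) (fun d _ => X.near_mate d) (fun d _ _ h => absurd h (X.mate_ne_opp d))
  have hB' : W'.Bridgeless := by
    intro f hf
    rw [hS', Finset.mem_sdiff, mem_star] at hf
    have hz : ∀ z : ZMod 2, z = 0 ∨ z = 1 := by decide
    have hcl : ∀ Z, W.Even Z → Z a + Z (X.mate a) = 0 → W'.Even Z := by
      intro Z hZ hZa
      refine hE' Z hZ fun d hd _ => ?_
      have := hZ.add_mate ha (mem_star.1 hd).2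
      rw [hZa] at this
      clear * - this
      grind
    obtain ⟨Z, z1, z2⟩ := hB f hf.1
    rcases hz (Z a + Z (X.mate a)) with h0 | h0
    · exact ⟨Z, hcl Z z1 h0, z2⟩
    obtain ⟨Y, y1, y2⟩ := hpar f hf.1 fun q => hf.2 ⟨hf.1, q⟩
    rcases hz (Y a + Y (X.mate a)) with h1 | h1
    · refine ⟨Y, hcl Y y1 h1, (hz _).resolve_left ?_⟩
      rw [h1] at y2
      exact y2.symm
    · refine ⟨Z + Y, hcl _ (z1.add y1) ?_, ?_⟩
      · simp only [Pi.add_apply]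
        clear * - h0 h1
        grind
      · have := (hz (Y f + Y (X.mate f))).resolve_right (by rw [h1] at y2; exact y2.symm)
        simp only [Pi.add_apply]
        clear * - z2 this
        grind
  obtain ⟨c', hc'⟩ := ih W' (by rw [hS']; exact card_sdiff_lt hVS (mem_star.2 ⟨ha, .refl X a⟩)) (hP' hP) hB'
  obtain ⟨c, k1, k2, k3⟩ := hC' ℕ c' (fun d hd => (hc' d hd).1)
  have hoff : ∀ d ∈ W.S, ¬ X.Near a d → Proper X c d := by
    intro d hd hna
    have hnV : ∀ e, X.Near d e → e ∉ W.star a := fun e he q =>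
      hna ((mem_star.1 q).2.trans he.symm)
    exact proper_congr (fun e he => k3 e (hnV e he))
      (hc' d (by rw [hS']; exact Finset.mem_sdiff.2 ⟨hd, hnV d (.refl X d)⟩)).2
  have hmate : ∀ d, X.Near a d → c (X.mate d) = c d := fun d hd =>
    k2 d (mem_star.2 ⟨W.near_mem a ha d hd, hd⟩) (Finset.notMem_empty _)
  have hedge : ∀ d ∈ W.S, c (W.τ d) = c d := fun d hd => k1 d hd (Finset.notMem_empty _)
  have hpx := hoff x hx fun q => hn q.symm
  have hpx' := hoff _ (W.mate_mem hx) fun q => hn (q.trans (X.near_mate x).symm).symm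
  have hmx := W.mate_mem hx
  have hb : X.mate (X.opp a) ∈ W.S := W.mate_mem (W.opp_mem ha)
  have e1 : c a = c (X.mate x) := by rw [← hxa, hedge _ hmx]
  have e2 : c x = c (X.mate (X.opp a)) := by
    have := hedge _ hb
    rwa [hax] at this
  -- Exchange the colours of the two edges of the digon. This merely swaps the two colours in one
  -- cell of `x`, and makes both monochromatic cells of `a` two-coloured.
  refine ⟨fun d => if d = a ∨ d = X.mate x then c x else if d = x ∨ d = X.mate (X.opp a) then c a
    else c d, fun d hd => ⟨?_, ?_⟩⟩
  · have t1 := W.τ_τ hd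
    have t2 := W.τ_τ hmx
    have t3 := W.τ_τ hb
    rw [hxa] at t2
    rw [hax] at t3
    have q1 : (W.τ d = a ∨ W.τ d = X.mate x) ↔ (d = a ∨ d = X.mate x) := by
      clear * - t1 t2 hxa; grind
    have q2 : (W.τ d = x ∨ W.τ d = X.mate (X.opp a)) ↔ (d = x ∨ d = X.mate (X.opp a)) := by
      clear * - t1 t3 hax; grind
    simp only [q1, q2, hedge d hd]
  · have m1 := X.mate_mate a
    have m2 := X.mate_mate x
    have m3 := X.mate_mate (X.opp a)
    have m4 := X.mate_mate (X.opp x)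
    have m5 := X.mate_opp a
    have m6 := X.mate_opp x
    have m7 := X.opp_opp a
    have m8 := X.opp_opp x
    have m9 := X.opp_opp (X.mate a)
    have m10 := X.opp_opp (X.mate x)
    by_cases hda : X.Near a d
    · have ne1 : ∀ f, X.Near a f → f ≠ x ∧ f ≠ X.mate x := fun f hf =>
        ⟨fun q => hn (q ▸ hf).symm, fun q => hn ((X.near_mate x).trans (q ▸ hf).symm)⟩
      have c1 := hmate a (.refl X a)
      have c2 := hmate _ (X.near_opp a)
      have n1 := ne1 a (.refl X a)
      have n2 := ne1 _ (X.near_mate a)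
      have n3 := ne1 _ (X.near_opp a)
      have n4 := ne1 _ (X.near_opp a).mate
      have u1 := X.mate_ne a
      have u2 := X.opp_ne a
      have u3 := X.mate_opp_ne a
      have u4 := X.mate_ne (X.opp a)
      have u5 := X.mate_ne_opp a
      have u6 : X.mate a ≠ X.mate (X.opp a) := fun q => u2 (by rw [← m3, ← q, m1])
      have p := hpx.ne
      clear * - hda c1 c2 n1 n2 n3 n4 u1 u2 u3 u4 u5 u6 e1 e2 p m1 m3 m5 m7 m9
      rcases hda with rfl | rfl | rfl | rfl <;> constructor <;> grind
    · by_cases hdx : X.Near x d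
      · have ne1 : ∀ f, X.Near x f → f ≠ a ∧ f ≠ X.mate (X.opp a) := fun f hf =>
          ⟨fun q => hn (q ▸ hf), fun q => hn (hf.trans (q ▸ (X.near_opp a).mate).symm)⟩
        have n1 := ne1 x (.refl X x)
        have n2 := ne1 _ (X.near_mate x)
        have n3 := ne1 _ (X.near_opp x)
        have n4 := ne1 _ (X.near_opp x).mate
        have u1 := X.mate_ne x
        have u2 := X.opp_ne x
        have u3 := X.mate_opp_ne x
        have u4 := X.mate_ne (X.opp x)
        have u5 := X.mate_ne_opp x
        have u6 : X.mate x ≠ X.mate (X.opp x) := fun q => u2 (by rw [← m4, ← q, m2])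
        have p := hpx.cases hpx'
        have p' := hpx.ne
        clear * - hdx n1 n2 n3 n4 u1 u2 u3 u4 u5 u6 e1 p p' m2 m4 m6 m8 m10
        rcases hdx with rfl | rfl | rfl | rfl <;> constructor <;> grind
      · refine proper_congr (c' := c) (fun f hf => ?_) (hoff d hd hda)
        rw [if_neg, if_neg]
        · rintro (rfl | rfl)
          · exact hdx hf.symm
          · exact hda ((X.near_opp a).mate.trans hf.symm)
        · rintro (rfl | rfl)
          · exact hda hf.symm
          · exact hdx ((X.near_mate x).trans hf.symm)

theorem Planar.colourable_of_smaller [Finite D] (hP : W.Planar) (hB : W.Bridgeless)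
    (ih : W.SmallerColourable) : W.Colourable := by
  classical
  let _ := Fintype.ofFinite D
  by_cases hS : W.S.Nonempty
  swap
  · rw [Finset.not_nonempty_iff_eq_empty] at hS
    exact ⟨fun _ => 0, by simp [hS]⟩
  obtain ⟨d₀, hd₀, hk⟩ := hP.exists_face hS
  by_cases hc : ∃ x, W.SameFace d₀ x ∧ X.mate x = X.rot (X.rot (X.rot x))
  swap
  · push Not at hc
    obtain h | ⟨c, c1, -, c3, -⟩ := exists_facial_colouring hP hB ih hd₀ hk
    · exact h
    · exact ⟨c, fun d hd => ⟨c1 d hd, c3 d hd fun r hr _ => (X.consecutive r).resolve_right (hc r hr)⟩⟩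
  obtain ⟨x, hx₀, hmx⟩ := hc
  have hx : x ∈ W.S := hx₀.mem hd₀
  replace hk : ∀ a b, W.SameFace x a → W.SameFace x b → X.mate a = X.rot (X.rot (X.rot a)) →
      X.mate b = X.rot (X.rot (X.rot b)) → a = b := fun a b ha hb =>
    hk a b (hx₀.trans ha) (hx₀.trans hb)
  have huniq : ∀ a b, W.SameFace x a → W.SameFace x b → X.Near a b → b = a := fun a b ha hb hn =>
    hP.face_corner_unique hB hx hk ha hb hn
  have hcorner : ∀ r, W.SameFace x r → r ≠ x → X.mate r = X.rot r := fun r hr hrx =>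
    (X.consecutive r).resolve_right fun q => hrx (hk r x hr (.refl x) q hmx)
  obtain h | ⟨c, c1, c2, c3, c4⟩ := exists_facial_colouring hP hB ih hx hk
  · exact h
  have hcx : ∀ r, W.SameFace x r → c r = c x ∧ c (X.rot (X.rot (X.rot r))) = c x := fun r hr => by
    have hrS := hr.mem hx
    exact ⟨(c2 r hrS).2 (.inl hr), (c2 _ (W.rot_mem (W.rot_mem (W.rot_mem hrS)))).2
      (.inr (by rwa [X.rot_four]))⟩
  have hc : W.AlmostColouring x c := by
    refine ⟨c1, fun d hd hn => c3 d hd fun r hr hdr => hcorner r hr ?_, fun d hd => ?_⟩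
    · rintro rfl
      exact hn hdr.symm
    · have q1 := (hcx x (.refl x)).2
      have q2 := c4 x (.refl x)
      have q3 := X.mate_mate x
      have q4 := X.mate_mate (X.opp x)
      have q5 : X.mate (X.opp x) = X.rot x := by
        rw [X.mate_opp, hmx]
        exact X.rot_four (X.rot x)
      have q6 : X.opp x = X.rot (X.rot x) := rfl
      clear * - hd q1 q2 q3 q4 q5 q6 hmx
      rcases hd with rfl | rfl | rfl | rfl <;> grind
  have hcirc : ∀ r, W.SameFace x r →
      W.Circ x c x r ∧ W.Circ x c x (X.rot (X.rot (X.rot r))) := by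
    have hstep : ∀ r, W.SameFace x r → W.Circ x c x r → W.Circ x c x (X.rot (X.rot (X.rot r))) := by
      intro r hr h
      by_cases hrx : r = x
      · rw [hrx, ← hmx]
        exact Circ.refl.cell (.refl X x)
      · exact h.turn (hr.mem hx) (fun q => hrx (huniq x r (.refl x) hr q)) (X.near_rot r).rot.rot
          (by rw [(hcx r hr).1, (hcx r hr).2])
    intro r hr
    have h1 : W.Circ x c x r := hr.induction .refl fun d hd h => by
      have hdS := hd.mem hx
      rw [facePerm_apply hdS]
      exact (hstep d hd h).edge (W.rot_mem (W.rot_mem (W.rot_mem hdS)))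
    exact ⟨h1, hstep r hr h1⟩
  obtain h | ⟨h, h1, h2, h3, h4, h5, h6, h7⟩ := hc.exists_heights hx hP hB ih
  · exact h
  have H : W.FacialChain x h := by
    refine ⟨hx, hmx, hcorner, huniq, h1, fun d hd => ?_, fun d hd e he hde => ?_, h3, h4, h5, h6, h7⟩
    · rw [h2 d hd x hx, ← c2 d hd]
      refine ⟨fun q => (hc.circ_eq q).symm, fun q => ?_⟩
      rcases (c2 d hd).1 q with q | q
      · exact (hcirc d q).1.symm
      · have := (hcirc _ q).2
        rw [X.rot_four] at this
        exact this.symm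
    · have key : ∀ f, W.Circ x c d f → W.Circ x h d f := by
        intro f hf
        induction hf with
        | refl => exact .refl
        | edge _ q1 ih => exact ih.edge q1
        | turn q0 q1 q2 q3 q4 ih =>
          refine ih.turn q1 q2 q3 ((h2 _ (W.near_mem _ q1 _ q3) _ q1).2 ?_)
          exact (Circ.refl.turn q1 q2 q3 q4).symm
        | cell _ q1 ih => exact ih.cell q1
      exact key e ((h2 d hd e he).1 hde)
  by_cases hF : W.facePerm x = x
  -- A face of length one is a loop filling a cell, which no even set splits.
  · obtain ⟨Z, z1, z2⟩ := hB x hx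
    rw [facePerm_apply hx, ← hmx] at hF
    have := z1.edge _ (W.mate_mem hx)
    rw [hF] at this
    rw [this] at z2
    exact absurd z2 (by clear * -; grind)
  by_cases hF2 : W.facePerm (W.facePerm x) = x
  · have hxF : W.SameFace x (W.facePerm x) := sameFace_facePerm x
    refine colourable_of_digon hP hB ih hx (a := W.facePerm x) (by rw [hmx, facePerm_apply hx]) ?_
      (H.not_near hxF hF)
    rw [mate_opp_of_mate (hcorner _ hxF hF)]
    exact (facePerm_apply (hxF.mem hx)).symm.trans hF2
  · exact H.colourable_of_two_lt hP hB ih hF hF2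

/-- Every plane 4-regular graph without a nontransverse separation has a colouring. -/
theorem Planar.colourable [Finite D] (hP : W.Planar) (hB : W.Bridgeless) : W.Colourable := by
  induction hn : W.S.card using Nat.strong_induction_on generalizing W with
  | _ n ih => exact hP.colourable_of_smaller hB fun W' hlt hP' hB' => ih _ (hn ▸ hlt) hP' hB' rfl

end Wiring

/-! ### From embedded graphs to darts -/

namespace Graph

variable {α β : Type*} {G : Graph α β}

@[simp] theorem flip_flip (d : G.HalfEdge) : G.flip (G.flip d) = d := by
  simp [Graph.flip]

theorem flip_ne (d : G.HalfEdge) : G.flip d ≠ d := fun h => by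
  have := congrArg Prod.snd h
  simp [Graph.flip] at this

theorem eq_or_eq_flip {d d' : G.HalfEdge} (h : d'.1 = d.1) : d' = d ∨ d' = G.flip d := by
  obtain ⟨e, b⟩ := d
  obtain ⟨e', b'⟩ := d'
  obtain rfl : e' = e := h
  rcases b <;> rcases b' <;> simp [Graph.flip]

namespace RotationSystem

variable (R : RotationSystem G)

theorem isLink_flip (d : G.HalfEdge) : G.IsLink d.1 (R.vert d) (R.vert (G.flip d)) := by
  obtain ⟨e, b⟩ := d
  cases b
  · exact R.isLink e
  · exact (R.isLink e).symm

theorem vert_mem (d : G.HalfEdge) : R.vert d ∈ G.vertexSet := (R.isLink_flip d).left_mem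

/-- An edge is incident with `v` if one of its halves is at `v`, and a loop there if both are. So
this is inclusion and exclusion for the two kinds of halves. -/
theorem encard_vert (v : α) :
    {d | R.vert d = v}.encard = (G.incidenceSet v).encard + (G.loopSet v).encard := by
  set A : Bool → Set G.edgeSet := fun b => {e | R.vert (e, b) = v} with hA
  have h1 : {d | R.vert d = v} = (fun e => (e, false)) '' A false ∪ (fun e => (e, true)) '' A true := by
    ext ⟨e, b⟩
    cases b <;> simp [hA]
  have hinj : ∀ b : Bool, Function.Injective fun e : G.edgeSet => (e, b) := fun b e f h =>
    congrArg Prod.fst h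
  have h2 : Disjoint ((fun e => (e, false)) '' A false) ((fun e => (e, true)) '' A true) := by
    rw [Set.disjoint_left]
    rintro _ ⟨e, -, rfl⟩ ⟨f, -, h⟩
    simpa using congrArg Prod.snd h
  have h3 : Subtype.val '' (A false ∪ A true) = G.incidenceSet v := by
    ext e
    simp only [Set.mem_image, Set.mem_union, mem_incidenceSet]
    constructor
    · rintro ⟨f, hf, rfl⟩
      rcases hf with hf | hf
      · exact hf ▸ (R.isLink f).inc_left
      · exact hf ▸ (R.isLink f).inc_right
    · intro h
      refine ⟨⟨e, h.edge_mem⟩, ?_, rfl⟩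
      exact (h.eq_or_eq_of_isLink (R.isLink ⟨e, h.edge_mem⟩)).imp Eq.symm Eq.symm
  have h4 : Subtype.val '' (A false ∩ A true) = G.loopSet v := by
    ext e
    simp only [Set.mem_image, Set.mem_inter_iff, mem_loopSet]
    constructor
    · rintro ⟨f, ⟨h, h'⟩, rfl⟩
      have := R.isLink f
      rw [h, h'] at this
      exact this
    · intro h
      have := R.isLink ⟨e, h.edge_mem⟩
      exact ⟨⟨e, h.edge_mem⟩, ⟨(h.eq_of_inc this.inc_left).symm, (h.eq_of_inc this.inc_right).symm⟩, rfl⟩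
  rw [h1, Set.encard_union_eq h2, (hinj _).encard_image, (hinj _).encard_image,
    ← Set.encard_union_add_encard_inter, ← h3, ← h4, Subtype.val_injective.encard_image,
    Subtype.val_injective.encard_image]

variable {R}

theorem minimalPeriod_rot (h4 : G.IsFourRegular) (d : G.HalfEdge) :
    Function.minimalPeriod R.rot d = 4 := by
  have h1 := (R.encard_vert (R.vert d)).trans (h4 _ (R.vert_mem d))
  have h2 : {d' | R.vert d' = R.vert d} = MulAction.orbit (Subgroup.zpowers R.rot) d := by
    ext d'
    rw [Set.mem_ofPred_eq, eq_comm, ← R.sameCycle_iff, MulAction.mem_orbit_iff]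
    constructor
    · rintro ⟨i, hi⟩
      exact ⟨⟨R.rot ^ i, i, rfl⟩, hi⟩
    · rintro ⟨⟨_, i, rfl⟩, hi⟩
      exact ⟨i, hi⟩
  rw [h2] at h1
  have hfin : (MulAction.orbit (Subgroup.zpowers R.rot) d).Finite :=
    Set.finite_of_encard_eq_coe (k := 4) h1
  let _ := hfin.fintype
  have h3 := MulAction.minimalPeriod_eq_card (a := R.rot) (b := d)
  have h5 : ((Fintype.card (MulAction.orbit (Subgroup.zpowers R.rot) d) : ℕ) : ℕ∞) = (4 : ℕ) := by
    rw [← Set.toFinset_card, ← Set.encard_eq_coe_toFinset_card]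
    exact h1
  rw [Nat.cast_inj] at h5
  rw [← h5, ← h3]
  rfl

theorem rot_four (h4 : G.IsFourRegular) (d : G.HalfEdge) : R.rot (R.rot (R.rot (R.rot d))) = d := by
  have := Function.isPeriodicPt_minimalPeriod R.rot d
  rw [minimalPeriod_rot h4] at this
  exact this

theorem rot_two_ne (h4 : G.IsFourRegular) (d : G.HalfEdge) : R.rot (R.rot d) ≠ d := fun h => by
  have h1 : Function.IsPeriodicPt R.rot 2 d := h
  have := h1.minimalPeriod_le (by norm_num)
  rw [minimalPeriod_rot h4] at this
  omega

end RotationSystem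

namespace VertexOrientation

variable {R : RotationSystem G} (σ : VertexOrientation R)

/-- The darts of an embedded 4-regular graph with a vertex-orientation. -/
def cellSystem (h4 : G.IsFourRegular) : CellSystem G.HalfEdge where
  rot := R.rot
  mate := σ.mate
  rot_four := R.rot_four h4
  rot_two_ne := R.rot_two_ne h4
  mate_mate := σ.mate_mate
  consecutive d := by
    refine (σ.consecutive d).imp_right fun h => ?_
    rw [h, Equiv.symm_apply_eq, R.rot_four h4]

theorem near_iff (h4 : G.IsFourRegular) {d d' : G.HalfEdge} :
    (σ.cellSystem h4).Near d d' ↔ R.vert d = R.vert d' := by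
  rw [← R.sameCycle_iff]
  constructor
  · intro h
    rcases (σ.cellSystem h4).near_iff_rot.1 h with rfl | rfl | rfl | rfl
    exacts [⟨0, rfl⟩, ⟨1, rfl⟩, ⟨2, rfl⟩, ⟨3, rfl⟩]
  · rintro ⟨i, rfl⟩
    have hz : ∀ d : G.HalfEdge, (σ.cellSystem h4).Near d (R.rot d) := (σ.cellSystem h4).near_rot
    induction i using Int.induction_on generalizing d with
    | zero => exact .refl _ d
    | succ i ih =>
      rw [zpow_add_one]
      exact (hz d).trans ih
    | pred i ih =>
      rw [zpow_sub_one, Equiv.Perm.mul_apply]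
      have := (hz (R.rot⁻¹ d)).symm
      rw [show R.rot (R.rot⁻¹ d) = d from R.rot.apply_symm_apply d] at this
      exact this.trans ih

/-- All darts, with the edges as wires. -/
def wiring [Fintype G.HalfEdge] (h4 : G.IsFourRegular) : Wiring (σ.cellSystem h4) where
  S := Finset.univ
  τ := G.flip
  near_mem _ _ _ _ := Finset.mem_univ _
  matching d _ := ⟨Finset.mem_univ _, flip_flip d, flip_ne d⟩

end VertexOrientation

end Graph

/-! ### Planarity from Euler's formula -/

theorem finrank_range_funLeft {K A Q : Type*} [Field K] [Finite A] [Finite Q] {p : A → Q}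
    (hp : Function.Surjective p) :
    Module.finrank K (LinearMap.range (LinearMap.funLeft K K p)) = Nat.card Q := by
  have := Fintype.ofFinite Q
  rw [LinearMap.finrank_range_of_inj (LinearMap.funLeft_injective_of_surjective _ _ _ hp),
    Module.finrank_fintype_fun_eq_card, Nat.card_eq_fintype_card]

theorem mem_range_funLeft {K A Q : Type*} [Semiring K] {p : A → Q} (hp : Function.Surjective p)
    {f : A → K} : f ∈ LinearMap.range (LinearMap.funLeft K K p) ↔ ∀ a b, p a = p b → f a = f b := by
  constructor
  · rintro ⟨g, rfl⟩ a b h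
    simp [LinearMap.funLeft_apply, h]
  · intro h
    refine ⟨fun q => f (hp q).choose, ?_⟩
    ext a
    exact h _ _ (hp (p a)).choose_spec

namespace Graph.VertexOrientation

variable {α β : Type*} {G : Graph α β} {R : RotationSystem G} (σ : VertexOrientation R)

/-- The two face permutations are mutually inverse, as they run round the faces in opposite
directions. -/
theorem sameFace_iff [Fintype G.HalfEdge] (h4 : G.IsFourRegular) {d d' : G.HalfEdge} :
    (σ.wiring h4).SameFace d d' ↔ R.facePerm.SameCycle d d' := by
  have : (σ.wiring h4).facePerm = R.facePerm⁻¹ := by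
    rw [eq_inv_iff_mul_eq_one]
    ext1 d
    change (σ.wiring h4).facePerm (R.rot (G.flip d)) = d
    exact (Wiring.facePerm_rot (W := σ.wiring h4) (Finset.mem_univ _)).trans (flip_flip d)
  rw [Wiring.SameFace, this, Equiv.Perm.sameCycle_inv]

/-- Boundaries of face sets have dimension at least `F - C`, where `C` is the number of components.
Even sets lie in the annihilator of the functions constant on edges plus those constant on vertices,
of dimension at most `2E - (E + V - C)`. Euler's formula makes the two bounds equal, so every even
set is a boundary. -/
theorem planar [Fintype G.HalfEdge] (h4 : G.IsFourRegular) (hR : R.IsPlane) :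
    (σ.wiring h4).Planar := by
  classical
  set W := σ.wiring h4
  have hE : Finite G.edgeSet := Finite.of_surjective (Prod.fst : G.HalfEdge → _) Prod.fst_surjective
  let Γ := Subgroup.closure {R.rot, G.flip}
  let pE : G.HalfEdge → G.edgeSet := Prod.fst
  let pV := Quotient.mk (Equiv.Perm.SameCycle.setoid R.rot)
  let pF := Quotient.mk (Equiv.Perm.SameCycle.setoid R.facePerm)
  let pC : G.HalfEdge → MulAction.orbitRel.Quotient Γ G.HalfEdge := Quotient.mk _
  have hpV : ∀ d d', pV d = pV d' ↔ R.rot.SameCycle d d' := fun d d' => Quotient.eq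
  have hpF : ∀ d d', pF d = pF d' ↔ R.facePerm.SameCycle d d' := fun d d' => Quotient.eq
  have sE : Function.Surjective pE := Prod.fst_surjective
  have sV : Function.Surjective pV := Quotient.mk_surjective
  have sF : Function.Surjective pF := Quotient.mk_surjective
  have sC : Function.Surjective pC := Quotient.mk_surjective
  let range {Q : Type _} (p : G.HalfEdge → Q) : Submodule (ZMod 2) (G.HalfEdge → ZMod 2) :=
    LinearMap.range (LinearMap.funLeft (ZMod 2) (ZMod 2) p)
  have hinv : ∀ φ : G.HalfEdge → ZMod 2, (∀ d, φ (R.rot d) = φ d) → (∀ d, φ (G.flip d) = φ d) →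
      φ ∈ range pC := by
    intro φ h1 h2
    have key : ∀ g ∈ Γ, ∀ b, φ (g b) = φ b := by
      intro g hg
      induction hg using Subgroup.closure_induction with
      | mem x hx =>
        rcases hx with rfl | rfl
        exacts [h1, h2]
      | one => exact fun b => rfl
      | mul x y _ _ ihx ihy => exact fun b => (ihx (y b)).trans (ihy b)
      | inv x _ ih =>
        intro b
        rw [← ih (x⁻¹ b), ← Equiv.Perm.mul_apply, mul_inv_cancel, Equiv.Perm.one_apply]
    rw [mem_range_funLeft sC]
    intro a b hab
    obtain ⟨⟨g, hg⟩, rfl⟩ := MulAction.orbitRel_apply.1 (Quotient.exact hab)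
    exact key g hg b
  have hface : ∀ φ ∈ range pF, W.Even (fun d => φ d + φ (R.rot d)) ∧
      W.IsFaceColouring (fun d => φ d + φ (R.rot d)) φ := by
    intro φ hφ
    rw [mem_range_funLeft sF] at hφ
    exact Wiring.even_boundary fun a b h => hφ a b ((hpF a b).2 ((σ.sameFace_iff h4).1 h))
  let r : (G.HalfEdge → ZMod 2) →ₗ[ZMod 2] (G.HalfEdge → ZMod 2) :=
    LinearMap.id + LinearMap.funLeft (ZMod 2) (ZMod 2) R.rot
  let b := r.domRestrict (range pF)
  -- A face set without boundary is constant around vertices and along edges, hence on components.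
  have hker : (LinearMap.ker b).map (range pF).subtype ≤ range pC := by
    rintro _ ⟨⟨φ, hφ⟩, hφ0, rfl⟩
    have h0 : ∀ d, φ d + φ (R.rot d) = 0 := fun d => congrFun (LinearMap.mem_ker.1 hφ0) d
    have h1 : ∀ d, φ (R.rot d) = φ d := fun d => by
      have := h0 d
      clear * - this
      grind
    refine hinv φ h1 fun d => ?_
    have := ((hface φ hφ).2 d (Finset.mem_univ d)).2
    exact this.trans (h1 d)
  have hpair : ∀ Z, W.Even Z → ∀ Y ∈ range pE ⊔ range pV, ∑ d, Z d * Y d = 0 := by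
    intro Z hZ Y hY
    obtain ⟨Y₁, hY₁, Y₂, hY₂, rfl⟩ := Submodule.mem_sup.1 hY
    rw [mem_range_funLeft sE] at hY₁
    rw [mem_range_funLeft sV] at hY₂
    simp only [Pi.add_apply, mul_add, Finset.sum_add_distrib]
    have e1 : ∑ d, Z d * Y₁ d = 0 := by
      refine Wiring.sum_eq_zero_of_edge (W := W) (Z := fun d => Z d * Y₁ d) le_rfl
        (fun d _ => Finset.mem_univ _) fun d hd => ?_
      have q1 := hZ.edge d hd
      have q2 : Y₁ (W.τ d) = Y₁ d := hY₁ _ _ rfl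
      simp only [q1, q2]
    have e2 : ∑ d, Z d * Y₂ d = 0 := by
      have q := hZ.sum_eq_zero (K := Finset.univ.filter fun d => Y₂ d = 1) (Finset.subset_univ _)
        fun d hd e he => by
          rw [Finset.mem_filter] at hd ⊢
          refine ⟨Finset.mem_univ _, ?_⟩
          rw [← hd.2]
          exact hY₂ _ _ ((hpV _ _).2 ((R.sameCycle_iff _ _).2 ((σ.near_iff h4).1 he).symm))
      rw [Finset.sum_filter] at q
      rw [← q]
      refine Finset.sum_congr rfl fun d _ => ?_
      have hz : ∀ z : ZMod 2, z = 0 ∨ z = 1 := by decide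
      rcases hz (Y₂ d) with h | h <;> simp [h]
    rw [e1, e2, add_zero]
  let E : Submodule (ZMod 2) (G.HalfEdge → ZMod 2) :=
    (range pE ⊔ range pV).dualAnnihilator.comap (dotProductEquiv (ZMod 2) G.HalfEdge).toLinearMap
  have hWE : ∀ Z, W.Even Z → Z ∈ E := by
    intro Z hZ
    rw [Submodule.mem_comap, Submodule.mem_dualAnnihilator]
    exact hpair Z hZ
  have hrE : LinearMap.range b ≤ E := by
    rintro _ ⟨⟨φ, hφ⟩, rfl⟩
    exact hWE _ (hface φ hφ).1
  have cE : Module.finrank (ZMod 2) (range pE) = Nat.card G.edgeSet := finrank_range_funLeft sE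
  have cV : Module.finrank (ZMod 2) (range pV) = R.numVertices := finrank_range_funLeft sV
  have cF : Module.finrank (ZMod 2) (range pF) = R.numFaces := finrank_range_funLeft sF
  have cC : Module.finrank (ZMod 2) (range pC) = R.numComponents := finrank_range_funLeft sC
  -- A function constant on edges and on vertices is constant on components.
  have hinf : range pE ⊓ range pV ≤ range pC := by
    rintro φ ⟨h1, h2⟩
    rw [SetLike.mem_coe, mem_range_funLeft sE] at h1
    rw [SetLike.mem_coe, mem_range_funLeft sV] at h2
    exact hinv φ (fun d => h2 _ _ ((hpV _ _).2 ⟨-1, by simp⟩)) fun d => h1 _ _ rfl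
  have d1 := Submodule.finrank_sup_add_finrank_inf_eq (range pE) (range pV)
  have d2 := Submodule.finrank_mono hinf
  have d3 := Subspace.finrank_add_finrank_dualAnnihilator_eq (range pE ⊔ range pV)
  have d4 : Module.finrank (ZMod 2) E =
      Module.finrank (ZMod 2) (range pE ⊔ range pV).dualAnnihilator :=
    (LinearEquiv.ofSubmodule' (dotProductEquiv (ZMod 2) G.HalfEdge) _).finrank_eq
  have d5 := LinearMap.finrank_range_add_finrank_ker b
  have d6 := Submodule.finrank_mono hker
  rw [← (Submodule.equivMapOfInjective _ (range pF).injective_subtype _).finrank_eq] at d6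
  have d7 : Module.finrank (ZMod 2) (G.HalfEdge → ZMod 2) = 2 * Nat.card G.edgeSet := by
    rw [Module.finrank_fintype_fun_eq_card, ← Nat.card_eq_fintype_card, Nat.card_prod, mul_comm]
    simp
  have hrange : LinearMap.range b = E := by
    refine Submodule.eq_of_le_of_finrank_le hrE ?_
    have := hR
    unfold RotationSystem.IsPlane at this
    omega
  intro Z hZ
  obtain ⟨⟨φ, hφ⟩, hφZ⟩ := hrange.ge (hWE Z hZ)
  refine ⟨φ, ?_⟩
  rw [← hφZ]
  exact (hface φ hφ).2

end Graph.VertexOrientation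

/-! ### Bridgelessness from transversality -/

namespace Graph

variable {α β : Type*} {G : Graph α β}

theorem Reachable.symm {x y : α} (h : G.Reachable x y) : G.Reachable y x := by
  induction h with
  | refl => exact .refl
  | tail _ h1 ih => exact .head h1.symm ih

namespace VertexOrientation

variable {R : RotationSystem G} (σ : VertexOrientation R)

theorem far_adj {v : α} (d : G.HalfEdge) (h : R.vert d ≠ v) (h' : R.far d ≠ v) :
    (G.deleteVerts {v}).Adj (R.vert d) (R.far d) :=
  ⟨d.1, (deleteVerts_isLink G {v}).2 ⟨R.isLink_flip d, h, h'⟩⟩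

/-- If the two cells at `d` are not joined outside the vertex of `d`, then the two edges of each
cell lead to the same component. -/
theorem reachable_far_mate [Fintype G.HalfEdge] (h4 : G.IsFourRegular) {d : G.HalfEdge}
    (h : ¬ (σ.wiring h4).Conn (fun _ => True) (fun e => ¬ (σ.cellSystem h4).Near d e) d
      ((σ.cellSystem h4).opp d))
    (hl : ∀ e, R.vert e = R.vert d → R.far e ≠ R.vert d) :
    ¬ (G.deleteVerts {R.vert d}).Reachable (R.far d) (R.far ((σ.cellSystem h4).opp d)) ∧
      (G.deleteVerts {R.vert d}).Reachable (R.far d) (R.far (σ.mate d)) := by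
  classical
  set X := σ.cellSystem h4 with hX
  set W := σ.wiring h4 with hW
  set v := R.vert d with hv
  set U : α → Prop := (G.deleteVerts {v}).Reachable (R.far d) with hU
  set C : G.HalfEdge → Prop := W.Conn (fun _ => True) (fun e => ¬ X.Near d e) d with hC
  have hCf : ∀ e, C e → C (G.flip e) := fun e he => he.edge (Finset.mem_univ e) trivial
  have hnear : ∀ {e f}, X.Near e f ↔ R.vert e = R.vert f := σ.near_iff h4
  have hCv : ∀ e f, R.vert e ≠ v → C e → R.vert e = R.vert f → C f := by
    intro e f hev he hef
    have hn : ¬ X.Near d e := fun q => hev (hnear.1 q).symm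
    rcases hnear.2 hef with rfl | rfl | rfl | rfl
    exacts [he, he.mate, he.opp hn, (he.opp hn).mate]
  have hUv : ∀ u, U u → u ≠ v := by
    intro u hu
    induction hu with
    | refl => exact hl d rfl
    | tail _ h1 _ =>
      obtain ⟨e, he⟩ := h1
      exact ((deleteVerts_isLink G {v}).1 he).2.2
  have hUC : ∀ u, U u → ∀ e, R.vert e = u → C e := by
    intro u hu
    induction hu with
    | refl => exact fun e he => hCv (G.flip d) e (hl d rfl) (hCf d .refl) he.symm
    | @tail u w hu' h1 ih =>
      intro e he
      obtain ⟨f, hf⟩ := h1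
      obtain ⟨hf, hfu, hfw⟩ := (deleteVerts_isLink G {v}).1 hf
      obtain ⟨g, hg, hg'⟩ : ∃ g : G.HalfEdge, R.vert g = u ∧ R.far g = w := by
        have hl := R.isLink ⟨f, hf.edge_mem⟩
        rcases hf.eq_and_eq_or_eq_and_eq hl with ⟨q1, q2⟩ | ⟨q1, q2⟩
        · exact ⟨(⟨f, hf.edge_mem⟩, false), q1.symm, q2.symm⟩
        · exact ⟨(⟨f, hf.edge_mem⟩, true), q1.symm, q2.symm⟩
      refine hCv (G.flip g) e ?_ (hCf g (ih g hg)) (hg'.trans he.symm)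
      change R.far g ≠ v
      rw [hg']
      exact fun q => hfw q
  have hopp : ∀ e, X.Near d e → U (R.far e) → C e := by
    intro e _ hU
    have := hCf _ (hUC _ hU (G.flip e) rfl)
    rwa [flip_flip] at this
  have hnU : ∀ e, (e = X.opp d ∨ e = X.mate (X.opp d)) → ¬ U (R.far e) := by
    rintro e he hU
    rcases he with rfl | rfl
    · exact h (hopp _ (X.near_opp d) hU)
    · have := (hopp _ (X.near_opp d).mate hU).mate
      rw [X.mate_mate] at this
      exact h this
  refine ⟨hnU _ (.inl rfl), ?_⟩
  -- Let `U` be the component of `R.far d`. Otherwise `d` would be the only half-edge at `v` leading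
  -- into it. Pairing by cells shows that the number of half-edges at `U` is even, pairing by edges
  -- the same for those of edges inside `U`; the single remaining half-edge is a contradiction.
  by_contra hm
  have s1 : ∑ e, (if U (R.vert e) then (1 : ZMod 2) else 0) = 0 := by
    refine Finset.sum_involution (fun e _ => X.mate e) (fun e _ => ?_) (fun e _ _ => X.mate_ne e)
      (fun e _ => Finset.mem_univ _) (fun e _ => X.mate_mate e)
    rw [hnear.1 (X.near_mate e)]
    clear * -
    grind
  have s2 : ∑ e, (if U (R.vert e) ∧ U (R.far e) then (1 : ZMod 2) else 0) = 0 := by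
    refine Finset.sum_involution (fun e _ => G.flip e) (fun e _ => ?_) (fun e _ _ => flip_ne e)
      (fun e _ => Finset.mem_univ _) (fun e _ => flip_flip e)
    have : (U (R.vert (G.flip e)) ∧ U (R.far (G.flip e))) ↔ (U (R.vert e) ∧ U (R.far e)) := by
      unfold RotationSystem.far
      rw [flip_flip, and_comm]
    rw [if_congr this rfl rfl]
    clear * -
    grind
  have s3 : ∑ e, (if e = d then (1 : ZMod 2) else 0) = 1 := by simp
  have s4 : ∑ e, (if U (R.vert e) then (1 : ZMod 2) else 0) =
      ∑ e, ((if U (R.vert e) ∧ U (R.far e) then (1 : ZMod 2) else 0) +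
        if e = G.flip d then 1 else 0) := by
    refine Finset.sum_congr rfl fun e _ => ?_
    by_cases hUe : U (R.vert e)
    · by_cases hUf : U (R.far e)
      · have : e ≠ G.flip d := by
          rintro rfl
          have := hUv _ hUf
          rw [RotationSystem.far, flip_flip] at this
          exact this rfl
        simp [hUe, hUf, this]
      · have hfv : R.far e = v := by
          by_contra hne
          exact hUf (Relation.ReflTransGen.tail hUe (far_adj e (hUv _ hUe) hne))
        have : G.flip e = d := by
          have hfar : R.far (G.flip e) = R.vert e := by rw [RotationSystem.far, flip_flip]
          have hUe' : U (R.far (G.flip e)) := by rwa [hfar]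
          rcases hnear.2 (show R.vert d = R.vert (G.flip e) from hfv.symm) with q | q | q | q
          · exact q
          · rw [q] at hUe'
            exact absurd hUe' hm
          · exact absurd hUe' (hnU _ (.inl q))
          · exact absurd hUe' (hnU _ (.inr q))
        have : e = G.flip d := by rw [← this, flip_flip]
        simp only [hUe, hUf, and_false, if_false, if_pos this, if_true, zero_add]
    · have : e ≠ G.flip d := by
        rintro rfl
        exact hUe .refl
      simp [hUe, this]
  rw [Finset.sum_add_distrib, s1, s2] at s4
  simp at s4

/-- If no even set splits the cells at `d`, no walk joins them outside the vertex. A loop at the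
vertex must then fill a cell, a nontransverse loop-anchor. Without loops the cells lead into
different components, and by parity the two edges of each cell into the same one: a nontransverse
cut-vertex. -/
theorem bridgeless [Fintype G.HalfEdge] (h4 : G.IsFourRegular) (hσ : σ.IsTransverse) :
    (σ.wiring h4).Bridgeless := by
  intro d hd
  by_contra hcon
  set X := σ.cellSystem h4 with hX
  set W := σ.wiring h4 with hW
  have hnear : ∀ {e f}, X.Near e f ↔ R.vert e = R.vert f := σ.near_iff h4
  have h : ¬ W.Conn (fun _ => True) (fun e => ¬ X.Near d e) d (X.opp d) := by
    intro h
    obtain ⟨Z, z1, -, z3⟩ := h.exists_even (fun _ _ => id) fun a b h h' h'' => h (h''.trans h'.symm)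
    refine hcon ⟨Z, z1, ?_⟩
    rw [z3 d hd (fun q => q (.refl X d)), if_pos (.refl X d)]
  have h' : ¬ W.Conn (fun _ => True) (fun e => ¬ X.Near (X.opp d) e) (X.opp d) (X.opp (X.opp d)) := by
    intro q
    rw [X.opp_opp] at q
    refine h (Wiring.Conn.symm (q.mono (fun _ => id) fun e he hn => he (Wiring.near_opp_left.2 hn))
      (fun _ _ => id) fun e he hn => he (hn.trans (X.near_opp e).symm))
  have hflip : ∀ e f, W.Conn (fun _ => True) (fun e => ¬ X.Near d e) e f →
      W.Conn (fun _ => True) (fun e => ¬ X.Near d e) e (G.flip f) :=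
    fun e f q => q.edge (Finset.mem_univ _) trivial
  have hside : ∀ f, X.Near d f →
      W.Conn (fun _ => True) (fun e => ¬ X.Near d e) d f ∧ (f = d ∨ f = X.mate d) ∨
        ¬ W.Conn (fun _ => True) (fun e => ¬ X.Near d e) d f ∧ (f = X.opp d ∨ f = X.mate (X.opp d)) := by
    rintro f (rfl | rfl | rfl | rfl)
    · exact .inl ⟨.refl, .inl rfl⟩
    · exact .inl ⟨.mate .refl, .inr rfl⟩
    · exact .inr ⟨h, .inl rfl⟩
    · refine .inr ⟨fun q => h ?_, .inr rfl⟩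
      have := q.mate
      rwa [X.mate_mate] at this
  have hl : ∀ e, R.vert e = R.vert d → R.far e ≠ R.vert d := by
    intro e he hfe
    have hmate : G.flip e = X.mate e := by
      have q1 := hflip d e
      have q2 := hflip d (G.flip e)
      rw [flip_flip] at q2
      have q3 := flip_ne e
      have q4 := X.mate_mate d
      have q5 := X.mate_mate (X.opp d)
      have q6 := hside e (hnear.2 he.symm)
      have q7 := hside (G.flip e) (hnear.2 hfe.symm)
      clear * - q1 q2 q3 q4 q5 q6 q7
      grind
    refine hσ.2 (R.vert d) ⟨e.1, ?_⟩ ⟨e, he, by rw [hmate]; rfl⟩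
    have := R.isLink_flip e
    rw [he] at this
    change G.IsLink _ _ (R.far e) at this
    rwa [hfe] at this
  have hvo : R.vert (X.opp d) = R.vert d := (hnear.1 (X.near_opp d)).symm
  obtain ⟨r1, r2⟩ := σ.reachable_far_mate h4 h hl
  obtain ⟨-, r3⟩ := σ.reachable_far_mate h4 h' (by rwa [hvo])
  rw [hvo] at r3
  have hvf : ∀ e, R.vert e = R.vert d → G.Adj (R.vert d) (R.far e) := fun e he =>
    he ▸ ⟨e.1, R.isLink_flip e⟩
  refine hσ.1 (R.vert d) ⟨R.vert_mem d, R.far d, ⟨R.vert_mem _, hl d rfl⟩, R.far (X.opp d),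
    ⟨R.vert_mem _, hl _ hvo⟩, ?_, r1⟩ fun e he => ?_
  · exact Relation.ReflTransGen.tail (.single (hvf d rfl).symm) (hvf _ hvo)
  · rcases hnear.2 he.symm with rfl | rfl | rfl | rfl
    · exact r2
    · have : σ.mate (X.mate d) = d := X.mate_mate _
      rw [this]
      exact r2.symm
    · exact r3
    · have : σ.mate (X.mate (X.opp d)) = X.opp d := X.mate_mate _
      rw [this]
      exact r3.symm

end VertexOrientation

end Graph

/-! ### o-colourings and o-cycles -/

namespace Graph.VertexOrientation

open Wiring

variable {α β : Type*} {G : Graph α β} {R : RotationSystem G} (σ : VertexOrientation R)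

theorem image_cell {γ : Type*} (f : G.HalfEdge → γ) (d : G.HalfEdge) :
    f '' σ.cell d = {f d, f (σ.mate d)} := Set.image_pair f d (σ.mate d)

/-- The colours at a vertex, from one of its cells. -/
theorem colours_eq (h4 : G.IsFourRegular) {ε : G.edgeSet → ℕ} {d : G.HalfEdge}
    (h : Proper (σ.cellSystem h4) (fun d => ε d.1) d)
    (h' : Proper (σ.cellSystem h4) (fun d => ε d.1) (σ.mate d)) :
    {c | ∃ d', R.vert d' = R.vert d ∧ ε d'.1 = c} = {ε d.1, ε (σ.mate d).1} := by
  ext c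
  simp only [Set.mem_ofPred_eq, Set.mem_insert_iff, Set.mem_singleton_iff]
  constructor
  · rintro ⟨d', h1, rfl⟩
    have := h.cases h'
    rcases (σ.near_iff h4).2 h1.symm with rfl | rfl | rfl | rfl
    · exact .inl rfl
    · exact .inr rfl
    · exact this.imp And.left And.right
    · exact this.symm.imp And.left And.right
  · rintro (rfl | rfl)
    · exact ⟨d, rfl, rfl⟩
    · exact ⟨σ.mate d, ((σ.near_iff h4).1 ((σ.cellSystem h4).near_mate d)).symm, rfl⟩

/-- Two colours at a vertex, both in each cell, means that each cell is two-coloured and each of its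
colours recurs in the opposite cell. -/
theorem isOColouring_iff (h4 : G.IsFourRegular) (ε : G.edgeSet → ℕ) :
    σ.IsOColouring ε ↔ ∀ d, Proper (σ.cellSystem h4) (fun d => ε d.1) d := by
  have hv : ∀ d, R.vert (σ.mate d) = R.vert d := fun d =>
    ((σ.near_iff h4).1 ((σ.cellSystem h4).near_mate d)).symm
  have ho : ∀ d, R.vert ((σ.cellSystem h4).opp d) = R.vert d := fun d =>
    ((σ.near_iff h4).1 ((σ.cellSystem h4).near_opp d)).symm
  constructor
  · intro h d
    obtain ⟨h1, h2⟩ := h (R.vert d) (R.vert_mem d)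
    have h3 := h2 d rfl
    have h5 := h2 _ (ho d)
    rw [image_cell] at h3 h5
    refine ⟨fun (he : ε (σ.mate d).1 = ε d.1) => ?_, ?_⟩
    · rw [← h3, he, Set.pair_eq_singleton, Set.ncard_singleton] at h1
      omega
    · have : ε d.1 ∈ ({ε ((σ.cellSystem h4).opp d).1, ε (σ.mate ((σ.cellSystem h4).opp d)).1} : Set ℕ) :=
        h5 ▸ ⟨d, rfl, rfl⟩
      exact this.imp Eq.symm Eq.symm
  · intro h v hvm
    have hcol : ∀ d, R.vert d = v →
        {c | ∃ d', R.vert d' = v ∧ ε d'.1 = c} = {ε d.1, ε (σ.mate d).1} := fun d hd =>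
      hd ▸ σ.colours_eq h4 (h d) (h _)
    refine ⟨?_, fun d hd => by rw [hcol d hd, image_cell]⟩
    have h1 := (R.encard_vert v).trans (h4 v hvm)
    obtain ⟨d, hd⟩ : {d | R.vert d = v}.Nonempty := by
      rw [← Set.encard_ne_zero, h1]
      norm_num
    rw [hcol d hd]
    exact Set.ncard_pair (h d).ne.symm

variable {σ}

/-- An o-cycle has exactly two half-edges at each of its vertices, and they belong to different
cells. -/
theorem IsOCycle.exists_pair {C : Set G.edgeSet} (hC : σ.IsOCycle C) {d : G.HalfEdge} (hd : d.1 ∈ C) :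
    ∃ f, R.vert f = R.vert d ∧ f.1 ∈ C ∧ σ.cell f ≠ σ.cell d ∧
      ∀ g, g.1 ∈ C → R.vert g = R.vert d → g = d ∨ g = f := by
  obtain ⟨k, c, h1, h2, -, h4, rfl⟩ := hC
  have hends : ∀ g : G.HalfEdge, g.1 ∈ Set.range (fun i => (c i).1) →
      ∃ i, R.vert g = R.vert (c i) ∧ (g = c i ∨ g = G.flip (c (i - 1))) := by
    rintro g ⟨j, hj⟩
    rcases eq_or_eq_flip (d := c j) (d' := g) hj.symm with rfl | rfl
    · exact ⟨j, rfl, .inl rfl⟩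
    · exact ⟨j + 1, h1 j, .inr (by rw [add_sub_cancel_right])⟩
  obtain ⟨i, hi, hdi⟩ := hends d hd
  have hprev : R.vert (G.flip (c (i - 1))) = R.vert (c i) := by
    have := h1 (i - 1)
    rwa [sub_add_cancel] at this
  have hcell : σ.cell (G.flip (c (i - 1))) ≠ σ.cell (c i) := by
    have := h4 (i - 1)
    rwa [sub_add_cancel] at this
  have hall : ∀ g : G.HalfEdge, g.1 ∈ Set.range (fun i => (c i).1) → R.vert g = R.vert d →
      g = c i ∨ g = G.flip (c (i - 1)) := by
    intro g hg hgd
    obtain ⟨j, hj, hgj⟩ := hends g hg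
    obtain rfl : j = i := h2 (hj.symm.trans (hgd.trans hi))
    exact hgj
  rcases hdi with rfl | rfl
  · exact ⟨G.flip (c (i - 1)), hprev, ⟨i - 1, rfl⟩, hcell, hall⟩
  · exact ⟨c i, hprev.symm, ⟨i, rfl⟩, hcell.symm, fun g hg hgd => (hall g hg hgd).symm⟩

theorem cell_mate (d : G.HalfEdge) : σ.cell (σ.mate d) = σ.cell d := by
  rw [cell, cell, σ.mate_mate, Set.pair_comm]

/-- The o-cycle through `d` has just one further half-edge at the vertex, in the other cell. If the
mate of `d` had the colour of `d`, disjointness would put it on the same o-cycle, where there is no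
room for it. -/
theorem IsOCycleColouring.isOColouring (h4 : G.IsFourRegular) {ε : G.edgeSet → ℕ}
    (h : σ.IsOCycleColouring ε) : σ.IsOColouring ε := by
  obtain ⟨𝒞, h1, h2, h3, h5⟩ := h
  rw [isOColouring_iff σ h4]
  intro d
  obtain ⟨C, ⟨hC, hdC⟩, -⟩ := h1.2 d.1
  obtain ⟨f, f1, f2, f3, f4⟩ := (h2 C hC).exists_pair hdC
  have hvm : R.vert (σ.mate d) = R.vert d :=
    ((σ.near_iff h4).1 ((σ.cellSystem h4).near_mate d)).symm
  have hinc : ∀ d : G.HalfEdge, G.Inc d.1 (R.vert d) := fun d => (R.isLink_flip d).inc_left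
  constructor
  · intro (he : ε (σ.mate d).1 = ε d.1)
    have hmC : (σ.mate d).1 ∈ C := by
      obtain ⟨C', ⟨hC', hmC'⟩, -⟩ := h1.2 (σ.mate d).1
      by_contra hne
      have hCC : C' ≠ C := fun q => hne (q ▸ hmC')
      exact h5 C' hC' C hC hCC _ hmC' _ hdC he _ ⟨hvm ▸ hinc (σ.mate d), hinc d⟩
    rcases f4 _ hmC hvm with q | q
    · exact (σ.cellSystem h4).mate_ne d q
    · exact f3 (by rw [← q, cell_mate])
  · have hcol := h3 C hC _ f2 _ hdC
    rcases (σ.near_iff h4).2 f1.symm with rfl | rfl | rfl | rfl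
    · exact absurd rfl f3
    · exact absurd (cell_mate d) f3
    · exact .inl hcol
    · exact .inr hcol

end Graph.VertexOrientation

/-- Following an edge `f` and then a pairing `θ`, one never meets the mate of the start. -/
theorem zpow_mul_involutions_ne {D : Type*} {θ f : Equiv.Perm D} (hθ : ∀ d, θ (θ d) = d)
    (hf : ∀ d, f (f d) = d) (hθ' : ∀ d, θ d ≠ d) (hf' : ∀ d, f d ≠ d) (i : ℤ) (d : D) :
    θ d ≠ ((θ * f) ^ i) d := by
  have hθi : θ⁻¹ = θ := inv_eq_of_mul_eq_one_left (by ext1 d; exact hθ d)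
  have hfi : f⁻¹ = f := inv_eq_of_mul_eq_one_left (by ext1 d; exact hf d)
  have hθθ : θ * θ = 1 := by ext1 d; exact hθ d
  have hconj : ∀ j : ℤ, θ * (θ * f) ^ j = (θ * f) ^ (-j) * θ := by
    intro j
    have h1 : (θ * f)⁻¹ = θ * (θ * f) * θ⁻¹ := by
      rw [mul_inv_rev, hθi, hfi, ← mul_assoc, hθθ, one_mul]
    rw [zpow_neg, ← inv_zpow, h1, conj_zpow, inv_mul_cancel_right]
  intro h
  -- In the dihedral action, moving half of the way turns the coincidence into a fixed point of `θ`
  -- when `i` is even, and of `f` when `i` is odd.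
  obtain ⟨s, rfl | rfl⟩ := Int.even_or_odd' i
  · apply hθ' (((θ * f) ^ s) d)
    rw [← Equiv.Perm.mul_apply, hconj, Equiv.Perm.mul_apply, h, ← Equiv.Perm.mul_apply, ← zpow_add]
    congr 2; ring
  · apply hf' (((θ * f) ^ s) d)
    have h3 : f * (θ * f) ^ s = (θ * f) ^ (-(s + 1)) * θ := by
      rw [← hconj, add_comm, zpow_one_add, ← mul_assoc θ, ← mul_assoc θ θ, hθθ, one_mul]
    rw [← Equiv.Perm.mul_apply, h3, Equiv.Perm.mul_apply, h, ← Equiv.Perm.mul_apply, ← zpow_add]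
    congr 2; ring

namespace Graph.VertexOrientation

open Wiring

variable {α β : Type*} {G : Graph α β} {R : RotationSystem G} {σ : VertexOrientation R}

/-- The o-cycles are the orbits of crossing an edge and then turning to the other half-edge of the
same colour. An orbit never contains the partner of one of its half-edges, so it meets each vertex
and each edge at most once. -/
theorem IsOColouring.isOCycleColouring [Finite G.HalfEdge] (h4 : G.IsFourRegular) {ε : G.edgeSet → ℕ}
    (h : σ.IsOColouring ε) : σ.IsOCycleColouring ε := by
  rw [isOColouring_iff σ h4] at h
  set X := σ.cellSystem h4
  have spec := fun d => (h d).partner_spec (h (X.mate d))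
  let θ : Equiv.Perm G.HalfEdge := ⟨partner X fun d => ε d.1, partner X fun d => ε d.1,
    fun d => (spec d).1.2.1, fun d => (spec d).1.2.1⟩
  have θv : ∀ d, R.vert (θ d) = R.vert d := fun d => ((σ.near_iff h4).1 (spec d).1.1).symm
  have θθ : ∀ d, θ (θ d) = d := fun d => (spec d).1.2.1
  have θne : ∀ d, θ d ≠ d := fun d => (spec d).1.2.2.1
  have θc : ∀ d, ε (θ d).1 = ε d.1 := fun d => (spec d).1.2.2.2
  have θeq : ∀ d e, R.vert e = R.vert d → ε e.1 = ε d.1 → e = d ∨ e = θ d := fun d e h1 h2 =>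
    ((spec d).2.1 e ((σ.near_iff h4).2 h1.symm)).1 h2
  have θcell : ∀ d, σ.cell d ≠ σ.cell (θ d) := by
    intro d hd
    have h1 : θ d ∈ σ.cell d := hd ▸ Set.mem_insert _ _
    have e1 := X.mate_ne_opp d
    have e2 := X.opp_ne d
    have e3 := X.mate_opp_ne d
    have e4 : X.mate (X.opp d) ≠ X.mate d := fun h => e2 (by
      rw [← X.mate_mate (X.opp d), h, X.mate_mate])
    rcases h1 with h1 | h1 <;> rcases (spec d).2.2 with h2 | h2
    · exact e2 (h2.symm.trans h1)
    · exact e3 (h2.symm.trans h1)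
    · exact e1 (h1.symm.trans h2)
    · exact e4 (h2.symm.trans h1)
  clear_value θ
  set w := θ * G.flip with hw
  have key := zpow_mul_involutions_ne θθ flip_flip θne flip_ne
  have hwc : ∀ (i : ℤ) d, ε ((w ^ i) d).1 = ε d.1 := by
    intro i d
    have h1 : ∀ d, ε (w d).1 = ε d.1 := fun d => θc _
    induction i using Int.induction_on with
    | zero => rfl
    | succ i ih => rw [add_comm, zpow_one_add, Equiv.Perm.mul_apply, h1, ih]
    | pred i ih =>
      rw [← ih, ← h1, ← Equiv.Perm.mul_apply, ← zpow_one_add]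
      congr 4; ring
  have hwcol : ∀ d d', w.SameCycle d d' → ε d'.1 = ε d.1 := by
    rintro d _ ⟨i, rfl⟩
    exact hwc i d
  have hθnot : ∀ d, ¬ w.SameCycle d (θ d) := fun d ⟨i, hi⟩ => key i d hi.symm
  have hw1 : ∀ d, w.SameCycle d (w d) := fun d => ⟨1, rfl⟩
  have hwflip : ∀ d, θ (w d) = G.flip d := fun d => θθ _
  -- Conjugation by `flip` inverts `w`: the reversed half-edges trace the same cycle backwards. So
  -- each edge set below arises from two orbits.
  have hflip : ∀ d d', w.SameCycle d d' → w.SameCycle (G.flip d) (G.flip d') := by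
    intro d d' hd
    have h1 := hd.conj (g := G.flip)
    have h2 : G.flip * w * G.flip⁻¹ = w⁻¹ := by
      have hθi : θ⁻¹ = θ := inv_eq_of_mul_eq_one_left (by ext1 d; exact θθ d)
      rw [hw, mul_inv_rev, hθi]
      refine Equiv.ext fun d => ?_
      change G.flip (θ (G.flip (G.flip.symm d))) = G.flip.symm (θ d)
      rw [Equiv.apply_symm_apply]
      exact (G.flip.symm_apply_eq.2 (flip_flip _).symm).symm
    rwa [h2, Equiv.Perm.sameCycle_inv] at h1
  let C : G.HalfEdge → Set G.edgeSet := fun d => {e | ∃ d', w.SameCycle d d' ∧ d'.1 = e}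
  have hself : ∀ d, d.1 ∈ C d := fun d => ⟨d, .refl _ _, rfl⟩
  have hCs : ∀ d d', w.SameCycle d d' → C d ⊆ C d' := by
    rintro d d' hd _ ⟨f, hf, rfl⟩
    exact ⟨f, hd.symm.trans hf, rfl⟩
  have hCf : ∀ d, C (G.flip d) ⊆ C d := by
    rintro d _ ⟨f, hf, rfl⟩
    have := hflip _ _ hf
    rw [flip_flip] at this
    exact ⟨_, this, rfl⟩
  have hC : ∀ d d', d'.1 ∈ C d → C d' = C d := by
    rintro d d' ⟨f, hf, hfd⟩
    have h1 : C f = C d := (hCs _ _ hf.symm).antisymm (hCs _ _ hf)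
    rcases eq_or_eq_flip hfd.symm with rfl | rfl
    · exact h1
    · rw [← h1]
      refine (hCf f).antisymm ?_
      have := hCf (G.flip f)
      rwa [flip_flip] at this
  have hcyc : ∀ d, σ.IsOCycle (C d) := by
    intro d
    have hp : 0 < Function.minimalPeriod w d :=
      Function.minimalPeriod_pos_of_mem_periodicPts (w.injective.mem_periodicPts d)
    -- The cycle is indexed by one period of the orbit.
    obtain ⟨k, hk⟩ : ∃ k, Function.minimalPeriod w d = k + 1 := ⟨_, (Nat.succ_pred hp.ne').symm⟩
    let c : Fin (k + 1) → G.HalfEdge := fun i => w^[i] d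
    have hmod : ∀ n, w^[n % (k + 1)] d = w^[n] d := fun n => by
      rw [← hk, Function.iterate_mod_minimalPeriod_eq]
    have hcw : ∀ n, w.SameCycle d (w^[n] d) := fun n => ⟨n, by
      rw [zpow_natCast, Equiv.Perm.coe_pow]⟩
    have hsucc : ∀ i, c (i + 1) = w (c i) := by
      intro i
      change w^[((i + 1 : Fin (k + 1)) : ℕ)] d = w (w^[i] d)
      rw [← Function.iterate_succ_apply' w i d, ← hmod ((i : ℕ) + 1)]
      congr 2
      simp [Fin.val_add]
    have hcc : ∀ i j, w.SameCycle (c i) (c j) := fun i j => (hcw _).symm.trans (hcw _)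
    have hinj : Function.Injective c := fun i j hij => by
      refine Fin.ext (Function.iterate_injOn_Iio_minimalPeriod (f := w) (x := d) ?_ ?_ hij)
      · exact Set.mem_Iio.2 (by rw [hk]; exact i.2)
      · exact Set.mem_Iio.2 (by rw [hk]; exact j.2)
    refine ⟨k, c, fun i => ?_, fun i j hij => hinj ?_, fun i j hij => hinj ?_, fun i => ?_, ?_⟩
    · rw [hsucc]
      exact (θv _).symm
    · refine ((θeq _ _ hij (hwcol _ _ (hcc j i))).resolve_right fun q => ?_)
      exact hθnot (c j) (q ▸ hcc j i)
    · refine (eq_or_eq_flip hij).resolve_right fun q => ?_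
      rw [← hwflip] at q
      exact hθnot (w (c j)) (q ▸ (hw1 _).symm.trans (hcc j i))
    · rw [hsucc]
      exact θcell _
    · ext e
      constructor
      · rintro ⟨d', hd', rfl⟩
        obtain ⟨n, rfl⟩ := hd'.exists_nat_pow_eq
        refine ⟨⟨n % (k + 1), Nat.mod_lt _ k.succ_pos⟩, ?_⟩
        change (w^[n % (k + 1)] d).1 = _
        rw [hmod, Equiv.Perm.coe_pow]
      · rintro ⟨i, rfl⟩
        exact ⟨c i, hcw _, rfl⟩
  refine ⟨Set.range C, ⟨?_, fun e => ?_⟩, ?_, ?_, ?_⟩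
  · rintro ⟨d, hd⟩
    have := hself d
    rw [hd] at this
    exact this
  · refine ⟨C (e, false), ⟨⟨_, rfl⟩, hself (e, false)⟩, ?_⟩
    rintro _ ⟨⟨d, rfl⟩, he⟩
    exact (hC d (e, false) he).symm
  · rintro _ ⟨d, rfl⟩
    exact hcyc d
  · rintro _ ⟨d, rfl⟩ _ ⟨a, ha, rfl⟩ _ ⟨b, hb, rfl⟩
    rw [hwcol _ _ ha, hwcol _ _ hb]
  · rintro _ ⟨d, rfl⟩ _ ⟨d', rfl⟩ hne e he f hf hef v ⟨hev, hfv⟩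
    have hhalf : ∀ e : G.edgeSet, G.Inc e v → ∃ a : G.HalfEdge, a.1 = e ∧ R.vert a = v := by
      intro e he
      rcases he.eq_or_eq_of_isLink (R.isLink e) with q | q
      exacts [⟨(e, false), rfl, q.symm⟩, ⟨(e, true), rfl, q.symm⟩]
    obtain ⟨a, rfl, hav⟩ := hhalf e hev
    obtain ⟨b, rfl, hbv⟩ := hhalf f hfv
    refine hne ((hC d a he).symm.trans (Eq.trans ?_ (hC d' b hf)))
    rcases θeq a b (hbv.trans hav.symm) hef.symm with rfl | rfl
    · rfl
    · refine hC _ _ ⟨G.flip a, ?_, rfl⟩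
      have := hw1 (G.flip a)
      rw [hw, Equiv.Perm.mul_apply, flip_flip] at this
      exact this.symm

end Graph.VertexOrientation

theorem theorem3p1 {α β : Type*} (G : Graph α β)
    (hV : G.vertexSet.Finite) (hE : G.edgeSet.Finite) (h4 : G.IsFourRegular)
    (R : Graph.RotationSystem G) (hR : R.IsPlane)
    (σ : Graph.VertexOrientation R) (hσ : σ.IsTransverse) :
    (∃ ε : G.edgeSet → ℕ, σ.IsOColouring ε) ∧
      ∀ ε : G.edgeSet → ℕ, σ.IsOColouring ε ↔ σ.IsOCycleColouring ε := by
  have : Finite G.edgeSet := hE.to_subtype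
  have : Finite G.HalfEdge := inferInstanceAs (Finite (G.edgeSet × Bool))
  let _ : Fintype G.HalfEdge := Fintype.ofFinite _
  refine ⟨?_, fun ε => ⟨fun h => h.isOCycleColouring h4, fun h => h.isOColouring h4⟩⟩
  obtain ⟨c, hc⟩ := (σ.planar h4 hR).colourable (σ.bridgeless h4 hσ)
  -- Both halves of an edge have the same colour, so either may be read.
  refine ⟨fun e => c (e, false), (σ.isOColouring_iff h4 _).2 fun d => ?_⟩
  refine Wiring.proper_congr (fun e _ => ?_) (hc d (Finset.mem_univ d)).2
  rcases e with ⟨e, _ | _⟩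
  · rfl
  · exact (hc (e, true) (Finset.mem_univ _)).1
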